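/- Identify $\mathbb C^4$ with $\mathbb H^2$ via $(z_0,z_1,z_2,z_3)\mapsto(z_0+z_1j,\,z_2+z_3j)$, and let $\pi:\mathbb S^7\to\mathbb{CP}^3$ be the Hopf fibration (the quotient by left multiplication by unit complex numbers). Let $g_1$ be the Fubini–Study metric making $\pi$ a Riemannian submersion from the unit sphere, and let $J_1$ be the complex structure induced by left multiplication by $i$. Let $\mathcal D_1^2\subset T\mathbb{CP}^3$ be the image under $d\pi$ of the distribution $p\mapsto\operatorname{span}\{jp,kp\}$ on $\mathbb S^7$, and let $\mathcal D_2^4$ be the image under $d\pi$ of the distribution $p\mapsto\operatorname{span}\{p,ip,jp,kp\}^\perp$. Let $P$ be the almost product structure equal to $+\mathrm{id}$ on $\mathcal D_2^4$ and $-\mathrm{id}$ on $\mathcal D_1^2$. Put $$J=PJ_1,\qquad g(X,Y)=\tfrac32\,g_1(X,Y)+\tfrac12\,g_1(X,PY);$$ $(\mathbb{CP}^3,g,J)$ is the nearly Kähler $\mathbb{CP}^3$. Let $\mathcal H$ be a smooth (immersed) hypersurface of the nearly Kähler $\mathbb{CP}^3$, with unit normal $N$ (defined locally up to sign). With $\nabla$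 the Levi-Civita connection of $g$, let $\alpha(X,Y)=g(\nabla_XY,N)$ be its second fundamental form and $A$ its shape operator, given by $g(AX,Y)=\alpha(X,Y)$ for tangent $X,Y$. The hypersurface is called Hopf if at every point $JN$ is an eigenvector of $A$ (the eigenvalue may depend on the point). It is called horizontal if the angle $\theta\in[0,\pi/2]$ defined by $\cos 2\theta=g(N,PN)$ vanishes identically, that is, if $N\in\mathcal D_2^4$ at every point. **Proposition.** Every Hopf hypersurface of the nearly Kähler $\mathbb{CP}^3$ is horizontal: $\theta\equiv0$, and $N\in\mathcal D_2^4$ at every point. -/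

import Mathlib

open scoped Manifold ContDiff

/-! ### Complex projective 3-space as a smooth manifold -/

/-- `ℂ⁴`, identified with `ℍ²` by `(z₀, z₁, z₂, z₃) ↦ (z₀ + z₁ j, z₂ + z₃ j)`, so that scalar
multiplication by complex numbers is multiplication from the left. -/
abbrev C4 : Type := Fin 4 → ℂ

/-- The model space `ℂ³` (used as a real vector space of dimension 6). -/
abbrev C3 : Type := Fin 3 → ℂ

/-- Complex projective 3-space, the quotient of `ℂ⁴ ∖ {0}` by nonzero complex scalars
(equivalently, of the sphere `S⁷` by unit complex scalars). -/
def CP3 : Type := Projectivization ℂ C4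

namespace CP3

/-- The projection `ℂ⁴ ∖ {0} → ℂP³`; its restriction to `S⁷` is the Hopf fibration. -/
noncomputable def mk (z : {z : C4 // z ≠ 0}) : CP3 := Projectivization.mk' ℂ z

/-- The quotient topology. -/
instance : TopologicalSpace CP3 :=
  inferInstanceAs (TopologicalSpace (Quotient (projectivizationSetoid ℂ C4)))

theorem isQuotientMap_mk : Topology.IsQuotientMap mk := isQuotientMap_quotient_mk'

theorem mk_eq_mk_iff (z z' : {z : C4 // z ≠ 0}) :
    mk z = mk z' ↔ ∃ a : ℂ, a • (z' : C4) = z :=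
  Projectivization.mk_eq_mk_iff' ℂ z.1 z'.1 z.2 z'.2

/-- `w ↦ (w, with 1 inserted at place k)`: the section of the projection over the `k`-th affine
piece `{z_k ≠ 0}`. -/
def affineLift (k : Fin 4) (w : C3) : C4 := k.insertNth (α := fun _ => ℂ) (1 : ℂ) w

/-- `X ↦ (X, with 0 inserted at place k)`: the differential of `affineLift k`. -/
def tangentLift (k : Fin 4) (X : C3) : C4 := k.insertNth (α := fun _ => ℂ) (0 : ℂ) X

@[simp] theorem affineLift_same (k : Fin 4) (w : C3) : affineLift k w k = 1 := by
  simp [affineLift]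

@[simp] theorem affineLift_succAbove (k : Fin 4) (w : C3) (i : Fin 3) :
    affineLift k w (k.succAbove i) = w i := by
  simp [affineLift]

@[simp] theorem tangentLift_same (k : Fin 4) (X : C3) : tangentLift k X k = 0 := by
  simp [tangentLift]

@[simp] theorem tangentLift_succAbove (k : Fin 4) (X : C3) (i : Fin 3) :
    tangentLift k X (k.succAbove i) = X i := by
  simp [tangentLift]

theorem affineLift_ne_zero (k : Fin 4) (w : C3) : affineLift k w ≠ 0 := fun h => by
  have := congrFun h k
  simp at this

/-- The affine coordinates `z_i / z_k`, `i ≠ k`, of a point of `ℂ⁴`. -/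
noncomputable def affineCoord (k : Fin 4) (z : C4) : C3 := fun i => z (k.succAbove i) / z k

theorem affineCoord_smul (k : Fin 4) (z : C4) {a : ℂ} (ha : a ≠ 0) :
    affineCoord k (a • z) = affineCoord k z := by
  funext i
  simp [affineCoord, mul_div_mul_left _ _ ha]

/-- The affine coordinates of a point of `ℂP³`. -/
noncomputable def coord (k : Fin 4) : CP3 → C3 :=
  Projectivization.lift (fun z => affineCoord k z.1) (by
    intro z z' a h
    have ha : a ≠ 0 := by
      rintro rfl
      exact z.2 (by simpa using h)
    change affineCoord k z.1 = affineCoord k z'.1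
    rw [h, affineCoord_smul k _ ha])

@[simp] theorem coord_mk (k : Fin 4) (z : {z : C4 // z ≠ 0}) :
    coord k (mk z) = affineCoord k z.1 := rfl

/-- The `k`-th affine piece `{z_k ≠ 0}` of `ℂP³`. -/
def affinePiece (k : Fin 4) : Set CP3 := {p | ∃ z : {z : C4 // z ≠ 0}, z.1 k ≠ 0 ∧ mk z = p}

theorem mk_mem_affinePiece (k : Fin 4) (z : {z : C4 // z ≠ 0}) :
    mk z ∈ affinePiece k ↔ z.1 k ≠ 0 := by
  constructor
  · rintro ⟨z', hz', h⟩ h0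
    obtain ⟨a, ha⟩ := (mk_eq_mk_iff _ _).1 h
    exact hz' (by rw [← ha]; simp [h0])
  · exact fun h => ⟨z, h, rfl⟩

theorem continuous_affineLift (k : Fin 4) : Continuous (affineLift k) := by
  refine continuous_pi fun j => ?_
  rcases Fin.eq_self_or_eq_succAbove k j with rfl | ⟨i, rfl⟩
  · simpa using continuous_const
  · simpa using continuous_apply i

/-- The `k`-th affine chart of `ℂP³`, a homeomorphism of `{z_k ≠ 0}` onto `ℂ³`. -/
noncomputable def affineChart (k : Fin 4) : OpenPartialHomeomorph CP3 C3 where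
  toFun := coord k
  invFun w := mk ⟨affineLift k w, affineLift_ne_zero k w⟩
  source := affinePiece k
  target := Set.univ
  map_source' _ _ := Set.mem_univ _
  map_target' w _ := (mk_mem_affinePiece k _).2 (by simp)
  left_inv' := by
    rintro _ ⟨z, hz, rfl⟩
    rw [mk_eq_mk_iff]
    refine ⟨(z.1 k)⁻¹, ?_⟩
    funext j
    rcases Fin.eq_self_or_eq_succAbove k j with rfl | ⟨i, rfl⟩
    · simp [hz]
    · simp [affineCoord, div_eq_inv_mul]
  right_inv' w _ := by
    funext i
    simp [affineCoord]
  open_source := by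
    rw [← isQuotientMap_mk.isOpen_preimage]
    have : mk ⁻¹' affinePiece k = {z | z.1 k ≠ 0} := by
      ext z
      exact mk_mem_affinePiece k z
    rw [this]
    exact isOpen_ne_fun ((continuous_apply k).comp continuous_subtype_val) continuous_const
  open_target := isOpen_univ
  continuousOn_toFun := by
    have ho : IsOpen (affinePiece k) := by
      rw [← isQuotientMap_mk.isOpen_preimage]
      have : mk ⁻¹' affinePiece k = {z | z.1 k ≠ 0} := by
        ext z
        exact mk_mem_affinePiece k z
      rw [this]
      exact isOpen_ne_fun ((continuous_apply k).comp continuous_subtype_val) continuous_const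
    rw [isQuotientMap_mk.continuousOn_isOpen_iff ho]
    refine continuousOn_pi.2 fun i => ?_
    refine ContinuousOn.div ?_ ?_ fun z hz => (mk_mem_affinePiece k z).1 hz
    · exact ((continuous_apply _).comp continuous_subtype_val).continuousOn
    · exact ((continuous_apply _).comp continuous_subtype_val).continuousOn
  continuousOn_invFun :=
    (isQuotientMap_mk.continuous.comp
      ((continuous_affineLift k).subtype_mk (affineLift_ne_zero k))).continuousOn

theorem exists_mem_affinePiece (p : CP3) : ∃ k, p ∈ affinePiece k := by
  obtain ⟨z, rfl⟩ := isQuotientMap_mk.surjective p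
  obtain ⟨k, hk⟩ := Function.ne_iff.1 z.2
  exact ⟨k, (mk_mem_affinePiece k z).2 hk⟩

/-- The index of the affine chart that is used at the point `p`. -/
noncomputable def chartIndex (p : CP3) : Fin 4 := Classical.choose (exists_mem_affinePiece p)

noncomputable instance : ChartedSpace C3 CP3 where
  atlas := Set.range affineChart
  chartAt p := affineChart (chartIndex p)
  mem_chart_source p := Classical.choose_spec (exists_mem_affinePiece p)
  chart_mem_atlas _ := ⟨_, rfl⟩

theorem contDiff_affineLift {n : WithTop ℕ∞} (k : Fin 4) : ContDiff ℝ n (affineLift k) := by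
  refine contDiff_pi.2 fun j => ?_
  rcases Fin.eq_self_or_eq_succAbove k j with rfl | ⟨i, rfl⟩
  · simpa using contDiff_const
  · simpa using contDiff_apply ℝ ℂ i

/-- The affine charts make `ℂP³` a smooth (real) manifold. -/
instance : IsManifold 𝓘(ℝ, C3) ∞ CP3 := by
  refine isManifold_of_contDiffOn _ _ _ ?_
  rintro _ _ ⟨k, rfl⟩ ⟨l, rfl⟩
  refine ContDiffOn.congr (f := fun w : C3 => affineCoord l (affineLift k w)) ?_ fun w _ => rfl
  refine contDiffOn_pi.2 fun i => ?_
  simp only [affineCoord, div_eq_mul_inv]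
  refine ContDiffOn.mul ?_ (ContDiffOn.inv ?_ ?_)
  · exact ((contDiff_apply ℝ ℂ _).comp (contDiff_affineLift k)).contDiffOn
  · exact ((contDiff_apply ℝ ℂ _).comp (contDiff_affineLift k)).contDiffOn
  · rintro w ⟨⟨-, hw⟩, -⟩
    exact (mk_mem_affinePiece l _).1 hw

/-! ### The homogeneous structures of `ℂP³`, read in the affine charts

Throughout, a tangent vector at the point with coordinates `w` in the `k`-th chart is given by its
coordinates `X : ℂ³`. With `z = affineLift k w`, the vector `tangentLift k X` of `ℂ⁴` projects to it
under the differential at `z` of `π : ℂ⁴ ∖ {0} → ℂP³`. -/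

/-- The Hermitian product of `ℂ⁴`, conjugate linear in the first variable. Its real part is the
Euclidean inner product. -/
noncomputable def herm (z v : C4) : ℂ := ∑ i, star (z i) * v i

/-- Multiplication by the quaternion `j` from the left on `ℂ⁴ = ℍ²`. -/
noncomputable def quatJ (z : C4) : C4 := ![-star (z 1), star (z 0), -star (z 3), star (z 2)]

/-- The differential at `affineLift k w` of `affineCoord k`, that is, the differential of
`π : ℂ⁴ ∖ {0} → ℂP³` read in the `k`-th chart (see `hasFDerivAt_affineCoord`). -/
noncomputable def dproj (k : Fin 4) (w : C3) (v : C4) : C3 :=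
  fun i => v (k.succAbove i) - v k * w i

/-- The component of `v` orthogonal to `z` and `i z`, the horizontal space of the Hopf fibration. -/
noncomputable def horiz (z v : C4) : C4 := v - (herm z v / herm z z) • z

/-- The component of `v` in the span of `j z` and `k z = i j z`, the lift of `𝒟₁²`. -/
noncomputable def lift1 (z v : C4) : C4 := (herm (quatJ z) v / herm z z) • quatJ z

/-- The component of `v` orthogonal to `z`, `i z`, `j z` and `k z`, in the lift of `𝒟₂⁴`. -/
noncomputable def lift2 (z v : C4) : C4 := horiz z v - lift1 z v

/-- The Fubini-Study metric `g₁` in the `k`-th chart: the metric for which the Hopf fibration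
`S⁷ → ℂP³` is a Riemannian submersion. As `z = affineLift k w` need not have length one, the vectors
are rescaled by `|z|⁻¹`. -/
noncomputable def chartFS (k : Fin 4) (w X Y : C3) : ℝ :=
  (herm (horiz (affineLift k w) (tangentLift k X)) (horiz (affineLift k w) (tangentLift k Y))).re /
    (herm (affineLift k w) (affineLift k w)).re

/-- The projection to `𝒟₁²`. -/
noncomputable def chartP1 (k : Fin 4) (w X : C3) : C3 :=
  dproj k w (lift1 (affineLift k w) (tangentLift k X))

/-- The projection to `𝒟₂⁴`. -/
noncomputable def chartP2 (k : Fin 4) (w X : C3) : C3 :=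
  dproj k w (lift2 (affineLift k w) (tangentLift k X))

/-- The almost product structure `P`: the identity on `𝒟₂⁴` and minus the identity on `𝒟₁²`. -/
noncomputable def chartP (k : Fin 4) (w X : C3) : C3 := chartP2 k w X - chartP1 k w X

/-- The Kähler complex structure `J₁`, induced by multiplication by `i` on `ℂ⁴`. -/
noncomputable def chartJ1 (k : Fin 4) (w X : C3) : C3 :=
  dproj k w (Complex.I • tangentLift k X)

/-- The nearly Kähler almost complex structure `J = P J₁`. -/
noncomputable def chartJ (k : Fin 4) (w X : C3) : C3 := chartP k w (chartJ1 k w X)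

/-- The nearly Kähler metric `g(X, Y) = 3/2 g₁(X, Y) + 1/2 g₁(X, P Y)`. -/
noncomputable def chartMetric (k : Fin 4) (w X Y : C3) : ℝ :=
  3 / 2 * chartFS k w X Y + 1 / 2 * chartFS k w X (chartP k w Y)

/-! ### Elementary properties -/

theorem dproj_tangentLift (k : Fin 4) (w X : C3) : dproj k w (tangentLift k X) = X := by
  funext i
  simp [dproj]

theorem tangentLift_add (k : Fin 4) (X Y : C3) :
    tangentLift k (X + Y) = tangentLift k X + tangentLift k Y := by
  funext j
  rcases Fin.eq_self_or_eq_succAbove k j with rfl | ⟨i, rfl⟩ <;> simp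

theorem tangentLift_smul (k : Fin 4) (a : ℝ) (X : C3) :
    tangentLift k (a • X) = a • tangentLift k X := by
  funext j
  rcases Fin.eq_self_or_eq_succAbove k j with rfl | ⟨i, rfl⟩ <;> simp

theorem hasFDerivAt_affineLift (k : Fin 4) (w : C3) :
    ∃ L : C3 →L[ℝ] C4, (∀ X, L X = tangentLift k X) ∧ HasFDerivAt (affineLift k) L w := by
  let L : C3 →ₗ[ℝ] C4 :=
    { toFun := tangentLift k
      map_add' := tangentLift_add k
      map_smul' := tangentLift_smul k }
  refine ⟨L.toContinuousLinearMap, fun X => rfl, ?_⟩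
  have h : affineLift k = fun w => L.toContinuousLinearMap w + affineLift k 0 := by
    funext w j
    change _ = tangentLift k w j + affineLift k 0 j
    rcases Fin.eq_self_or_eq_succAbove k j with rfl | ⟨i, rfl⟩ <;> simp
  rw [h]
  exact L.toContinuousLinearMap.hasFDerivAt.add_const _

theorem hasFDerivAt_affineCoord (k : Fin 4) (w : C3) :
    ∃ L : C4 →L[ℝ] C3, (∀ v, L v = dproj k w v) ∧ HasFDerivAt (affineCoord k) L (affineLift k w) := by
  let p : Fin 4 → (C4 →L[ℝ] ℂ) := fun j => ContinuousLinearMap.proj j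
  refine ⟨ContinuousLinearMap.pi fun i => p (k.succAbove i) - w i • p k, fun v => ?_, ?_⟩
  · funext i
    simp [p, dproj, mul_comm]
  · refine hasFDerivAt_pi.2 fun i => ?_
    have h1 : HasFDerivAt (fun z : C4 => z (k.succAbove i)) (p (k.succAbove i)) (affineLift k w) :=
      (p (k.succAbove i)).hasFDerivAt
    have h2 : HasFDerivAt (fun z : C4 => z k) (p k) (affineLift k w) := (p k).hasFDerivAt
    have h3 := h1.mul ((hasFDerivAt_inv' (𝕜 := ℝ) (x := affineLift k w k) (by simp)).comp
      (affineLift k w) h2)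
    simp only [affineCoord, div_eq_mul_inv]
    refine h3.congr_fderiv ?_
    ext v
    simp [p]
    ring

theorem herm_add_right (z v v' : C4) : herm z (v + v') = herm z v + herm z v' := by
  simp [herm, mul_add, Finset.sum_add_distrib]

theorem herm_smul_right (z v : C4) (a : ℂ) : herm z (a • v) = a * herm z v := by
  simp only [herm, Finset.mul_sum, Pi.smul_apply, smul_eq_mul]
  exact Finset.sum_congr rfl fun i _ => by ring

theorem herm_sub_right (z v v' : C4) : herm z (v - v') = herm z v - herm z v' := by
  simp [herm, mul_sub, Finset.sum_sub_distrib]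

theorem star_herm (z v : C4) : star (herm z v) = herm v z := by
  simp [herm, mul_comm]

theorem herm_self (z : C4) : herm z z = ((herm z z).re : ℂ) := by
  apply (Complex.conj_eq_iff_re.1 _).symm
  exact star_herm z z

theorem herm_self_re (z : C4) : (herm z z).re = ∑ i, ‖z i‖ ^ 2 := by
  simp only [herm, Complex.re_sum]
  refine Finset.sum_congr rfl fun i _ => ?_
  rw [← Complex.normSq_eq_norm_sq, Complex.star_def, ← Complex.normSq_eq_conj_mul_self]
  simp

theorem herm_self_nonneg (z : C4) : 0 ≤ (herm z z).re := by
  rw [herm_self_re]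
  positivity

theorem herm_self_eq_zero {z : C4} (h : (herm z z).re = 0) : z = 0 := by
  rw [herm_self_re, Finset.sum_eq_zero_iff_of_nonneg fun i _ => by positivity] at h
  funext i
  simpa using h i (Finset.mem_univ i)

theorem herm_affineLift_pos (k : Fin 4) (w : C3) :
    0 < (herm (affineLift k w) (affineLift k w)).re :=
  lt_of_le_of_ne (herm_self_nonneg _) fun h => affineLift_ne_zero k w (herm_self_eq_zero h.symm)

theorem herm_add_left (z z' v : C4) : herm (z + z') v = herm z v + herm z' v := by
  simp [herm, add_mul, Finset.sum_add_distrib]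

theorem herm_smul_left (z v : C4) (a : ℂ) : herm (a • z) v = star a * herm z v := by
  rw [← star_herm, herm_smul_right, star_mul', star_herm]

theorem herm_quatJ_right (z : C4) : herm z (quatJ z) = 0 := by
  simp [herm, quatJ, Fin.sum_univ_four]
  ring

theorem herm_quatJ_left (z : C4) : herm (quatJ z) z = 0 := by
  rw [← star_herm, herm_quatJ_right, star_zero]

theorem herm_quatJ_quatJ (z : C4) : herm (quatJ z) (quatJ z) = herm z z := by
  simp [herm, quatJ, Fin.sum_univ_four]
  ring

theorem herm_affineLift_ne_zero (k : Fin 4) (w : C3) :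
    herm (affineLift k w) (affineLift k w) ≠ 0 := fun h => by
  have := herm_affineLift_pos k w
  rw [h] at this
  simp at this

theorem herm_lift1 {z : C4} (v : C4) : herm z (lift1 z v) = 0 := by
  rw [lift1, herm_smul_right, herm_quatJ_right, mul_zero]

theorem herm_lift2 {z : C4} (hz : herm z z ≠ 0) (v : C4) : herm z (lift2 z v) = 0 := by
  rw [lift2, herm_sub_right, herm_lift1, horiz, herm_sub_right, herm_smul_right,
    div_mul_cancel₀ _ hz, sub_self, sub_zero]

theorem herm_quatJ_lift2 {z : C4} (hz : herm z z ≠ 0) (v : C4) :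
    herm (quatJ z) (lift2 z v) = 0 := by
  rw [lift2, herm_sub_right, lift1, herm_smul_right, herm_quatJ_quatJ, div_mul_cancel₀ _ hz, horiz,
    herm_sub_right, herm_smul_right, herm_quatJ_left, mul_zero, sub_zero, sub_self]

theorem herm_lift1_lift2 {z : C4} (hz : herm z z ≠ 0) (v v' : C4) :
    herm (lift1 z v) (lift2 z v') = 0 := by
  rw [lift1, herm_smul_left, herm_quatJ_lift2 hz, mul_zero]

theorem herm_lift2_lift1 {z : C4} (hz : herm z z ≠ 0) (v v' : C4) :
    herm (lift2 z v) (lift1 z v') = 0 := by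
  rw [← star_herm, herm_lift1_lift2 hz, star_zero]

theorem horiz_of_herm_eq_zero {z v : C4} (h : herm z v = 0) : horiz z v = v := by
  simp [horiz, h]

theorem tangentLift_dproj (k : Fin 4) (w : C3) (v : C4) :
    tangentLift k (dproj k w v) = v - v k • affineLift k w := by
  funext j
  rcases Fin.eq_self_or_eq_succAbove k j with rfl | ⟨i, rfl⟩ <;> simp [dproj]

theorem horiz_tangentLift_dproj (k : Fin 4) (w : C3) (v : C4) :
    horiz (affineLift k w) (tangentLift k (dproj k w v)) = horiz (affineLift k w) v := by
  have h := herm_affineLift_ne_zero k w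
  rw [tangentLift_dproj, horiz, horiz, herm_sub_right, herm_smul_right, sub_div,
    mul_div_cancel_right₀ _ h, sub_smul]
  abel

theorem chartP_eq (k : Fin 4) (w X : C3) : chartP k w X =
    dproj k w (lift2 (affineLift k w) (tangentLift k X) -
      lift1 (affineLift k w) (tangentLift k X)) := by
  funext i
  simp only [chartP, chartP2, chartP1, dproj, Pi.sub_apply]
  ring

/-- On `𝒟₂⁴` the nearly Kähler metric is twice the Fubini-Study metric, on `𝒟₁²` they agree. -/
theorem chartMetric_eq (k : Fin 4) (w X Y : C3) : chartMetric k w X Y =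
    ((herm (lift1 (affineLift k w) (tangentLift k X))
        (lift1 (affineLift k w) (tangentLift k Y))).re +
      2 * (herm (lift2 (affineLift k w) (tangentLift k X))
        (lift2 (affineLift k w) (tangentLift k Y))).re) /
      (herm (affineLift k w) (affineLift k w)).re := by
  have hz := herm_affineLift_ne_zero k w
  set z := affineLift k w with hzdef
  have e : ∀ v, horiz z v = lift1 z v + lift2 z v := fun v => by simp [lift2]
  have hP : horiz z (tangentLift k (chartP k w Y)) =
      lift2 z (tangentLift k Y) - lift1 z (tangentLift k Y) := by
    rw [chartP_eq, hzdef, horiz_tangentLift_dproj, ← hzdef, horiz_of_herm_eq_zero]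
    rw [herm_sub_right, herm_lift1, herm_lift2 hz, sub_zero]
  simp only [chartMetric, chartFS, ← hzdef, hP]
  simp only [e, herm_add_left, herm_add_right, herm_sub_right, herm_lift1_lift2 hz,
    herm_lift2_lift1 hz]
  simp
  ring

theorem chartMetric_symm (k : Fin 4) (w X Y : C3) : chartMetric k w X Y = chartMetric k w Y X := by
  have h : ∀ v v' : C4, (herm v v').re = (herm v' v).re := fun v v' => by
    rw [← star_herm v' v]
    simp
  simp only [chartMetric_eq]
  rw [h (lift1 _ _), h (lift2 _ _)]

theorem chartMetric_pos (k : Fin 4) (w : C3) {X : C3} (hX : X ≠ 0) : 0 < chartMetric k w X X := by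
  have hz := herm_affineLift_pos k w
  rw [chartMetric_eq]
  refine div_pos ?_ hz
  set z := affineLift k w with hzdef
  have h1 := herm_self_nonneg (lift1 z (tangentLift k X))
  have h2 := herm_self_nonneg (lift2 z (tangentLift k X))
  by_contra hn
  have e1 := herm_self_eq_zero (le_antisymm (by linarith) h1)
  have e2 := herm_self_eq_zero (le_antisymm (by linarith) h2)
  have e : horiz z (tangentLift k X) = 0 := by
    rw [lift2, e1, sub_zero] at e2
    exact e2
  have hk := congrFun e k
  simp only [horiz, hzdef, Pi.sub_apply, Pi.smul_apply, tangentLift_same, affineLift_same,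
    Pi.zero_apply, smul_eq_mul, mul_one, zero_sub, neg_eq_zero] at hk
  rw [horiz, hzdef, hk, zero_smul, sub_zero] at e
  apply hX
  rw [← dproj_tangentLift k w X, e]
  funext i
  simp [dproj]

theorem dproj_add (k : Fin 4) (w : C3) (v v' : C4) :
    dproj k w (v + v') = dproj k w v + dproj k w v' := by
  funext i
  simp only [dproj, Pi.add_apply]
  ring

theorem lift1_add (z v v' : C4) : lift1 z (v + v') = lift1 z v + lift1 z v' := by
  simp only [lift1, herm_add_right, add_div, add_smul]

theorem lift2_add (z v v' : C4) : lift2 z (v + v') = lift2 z v + lift2 z v' := by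
  simp only [lift2, horiz, lift1_add, herm_add_right, add_div, add_smul]
  abel

theorem herm_real_smul_right (z v : C4) (a : ℝ) : herm z (a • v) = a * herm z v :=
  herm_smul_right z v a

theorem lift1_smul (z v : C4) (a : ℝ) : lift1 z (a • v) = a • lift1 z v := by
  simp only [lift1, herm_real_smul_right, mul_div_assoc, mul_smul]
  rfl

theorem lift2_smul (z v : C4) (a : ℝ) : lift2 z (a • v) = a • lift2 z v := by
  simp only [lift2, horiz, lift1_smul, herm_real_smul_right, mul_div_assoc, mul_smul, smul_sub]
  rfl

theorem chartMetric_add_right (k : Fin 4) (w X Y Y' : C3) :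
    chartMetric k w X (Y + Y') = chartMetric k w X Y + chartMetric k w X Y' := by
  simp only [chartMetric_eq, tangentLift_add, lift1_add, lift2_add, herm_add_right, Complex.add_re]
  ring

theorem chartMetric_smul_right (k : Fin 4) (w X Y : C3) (a : ℝ) :
    chartMetric k w X (a • Y) = a * chartMetric k w X Y := by
  simp only [chartMetric_eq, tangentLift_smul, lift1_smul, lift2_smul, herm_real_smul_right,
    Complex.re_ofReal_mul]
  ring

/-- The nearly Kähler metric in a chart as a bilinear form. -/
noncomputable def chartMetricForm (k : Fin 4) (w : C3) : LinearMap.BilinForm ℝ C3 :=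
  LinearMap.mk₂ ℝ (chartMetric k w)
    (fun X X' Y => by
      rw [chartMetric_symm, chartMetric_add_right, chartMetric_symm k w Y, chartMetric_symm k w Y])
    (fun a X Y => by
      rw [chartMetric_symm, chartMetric_smul_right, chartMetric_symm k w Y, smul_eq_mul])
    (chartMetric_add_right k w)
    (fun a X Y => chartMetric_smul_right k w X Y a)

theorem exists_chartMetric_eq (k : Fin 4) (w : C3) (l : C3 →ₗ[ℝ] ℝ) :
    ∃ V, ∀ Y, chartMetric k w V Y = l Y := by
  have hinj : Function.Injective (chartMetricForm k w) := by
    rw [← LinearMap.ker_eq_bot, LinearMap.ker_eq_bot']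
    intro X hX
    by_contra h0
    exact (chartMetric_pos k w h0).ne' (LinearMap.congr_fun hX X)
  obtain ⟨V, hV⟩ := (LinearMap.injective_iff_surjective_of_finrank_eq_finrank
    (Subspace.dual_finrank_eq (K := ℝ) (V := C3)).symm).1 hinj l
  exact ⟨V, fun Y => LinearMap.congr_fun hV Y⟩

theorem contDiff_herm {n : WithTop ℕ∞} {f h : C3 → C4} (hf : ContDiff ℝ n f)
    (hh : ContDiff ℝ n h) : ContDiff ℝ n fun w => herm (f w) (h w) := by
  refine ContDiff.sum fun i _ => ContDiff.mul ?_ ?_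
  · exact Complex.conjCLE.contDiff.comp ((contDiff_apply ℝ ℂ i).comp hf)
  · exact (contDiff_apply ℝ ℂ i).comp hh

theorem contDiff_quatJ {n : WithTop ℕ∞} {f : C3 → C4} (hf : ContDiff ℝ n f) :
    ContDiff ℝ n fun w => quatJ (f w) := by
  have h : ∀ i, ContDiff ℝ n fun w => star (f w i) := fun i =>
    Complex.conjCLE.contDiff.comp ((contDiff_apply ℝ ℂ i).comp hf)
  refine contDiff_pi.2 fun i => ?_
  fin_cases i
  · exact (h 1).neg
  · exact h 0
  · exact (h 3).neg
  · exact h 2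

theorem contDiff_lift1 {n : WithTop ℕ∞} (k : Fin 4) (v : C4) :
    ContDiff ℝ n fun w => lift1 (affineLift k w) v := by
  have h := contDiff_affineLift (n := n) k
  simp only [lift1, div_eq_mul_inv]
  exact ((contDiff_herm (contDiff_quatJ h) contDiff_const).mul ((contDiff_herm h h).inv
    (herm_affineLift_ne_zero k))).smul (contDiff_quatJ h)

theorem contDiff_lift2 {n : WithTop ℕ∞} (k : Fin 4) (v : C4) :
    ContDiff ℝ n fun w => lift2 (affineLift k w) v := by
  have h := contDiff_affineLift (n := n) k
  simp only [lift2, horiz, div_eq_mul_inv]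
  exact (contDiff_const.sub (((contDiff_herm h contDiff_const).mul ((contDiff_herm h h).inv
    (herm_affineLift_ne_zero k))).smul h)).sub (contDiff_lift1 k v)

/-- The nearly Kähler metric is smooth. -/
theorem contDiff_chartMetric {n : WithTop ℕ∞} (k : Fin 4) (X Y : C3) :
    ContDiff ℝ n fun w => chartMetric k w X Y := by
  have h := contDiff_affineLift (n := n) k
  have hre : ∀ {f : C3 → ℂ}, ContDiff ℝ n f → ContDiff ℝ n fun w => (f w).re := fun hf =>
    Complex.reCLM.contDiff.comp hf
  simp only [chartMetric_eq]
  refine ContDiff.div ?_ (hre (contDiff_herm h h)) fun w => (herm_affineLift_pos k w).ne'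
  exact (hre (contDiff_herm (contDiff_lift1 k _) (contDiff_lift1 k _))).add
    (contDiff_const.mul (hre (contDiff_herm (contDiff_lift2 k _) (contDiff_lift2 k _))))

/-! ### The Levi-Civita connection of the nearly Kähler metric -/

/-- The Christoffel symbols of the first kind:
`1/2 (D_X g(Y, Z) + D_Y g(X, Z) - D_Z g(X, Y))` for constant `X`, `Y`, `Z`. -/
noncomputable def christoffelFirst (k : Fin 4) (w X Y Z : C3) : ℝ :=
  1 / 2 * (fderiv ℝ (fun w' => chartMetric k w' Y Z) w X +
    fderiv ℝ (fun w' => chartMetric k w' X Z) w Y -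
    fderiv ℝ (fun w' => chartMetric k w' X Y) w Z)

theorem exists_christoffel (k : Fin 4) (w X Y : C3) :
    ∃ V, ∀ Z, chartMetric k w V Z = christoffelFirst k w X Y Z := by
  have hd : ∀ X Y, DifferentiableAt ℝ (fun w' => chartMetric k w' X Y) w := fun X Y =>
    (contDiff_chartMetric (n := 1) k X Y).differentiable one_ne_zero w
  have ha : ∀ X Y Y' V, fderiv ℝ (fun w' => chartMetric k w' X (Y + Y')) w V =
      fderiv ℝ (fun w' => chartMetric k w' X Y) w V +
        fderiv ℝ (fun w' => chartMetric k w' X Y') w V := fun X Y Y' V => by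
    simp only [chartMetric_add_right]
    rw [fderiv_fun_add (hd _ _) (hd _ _)]
    rfl
  have hs : ∀ (a : ℝ) X Y V, fderiv ℝ (fun w' => chartMetric k w' X (a • Y)) w V =
      a * fderiv ℝ (fun w' => chartMetric k w' X Y) w V := fun a X Y V => by
    simp only [chartMetric_smul_right]
    rw [fderiv_const_mul (hd _ _)]
    rfl
  exact exists_chartMetric_eq k w
    { toFun := christoffelFirst k w X Y
      map_add' := fun Z Z' => by
        simp only [christoffelFirst, ha, map_add]
        ring
      map_smul' := fun a Z => by
        simp only [christoffelFirst, hs, map_smul, smul_eq_mul, RingHom.id_apply]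
        ring }

/-- The Christoffel symbols `Γ(X, Y) = ∇_X Y` (`X`, `Y` constant) of the Levi-Civita connection in
the `k`-th chart. -/
noncomputable def christoffel (k : Fin 4) (w X Y : C3) : C3 :=
  Classical.choose (exists_christoffel k w X Y)

theorem chartMetric_christoffel (k : Fin 4) (w X Y Z : C3) :
    chartMetric k w (christoffel k w X Y) Z = christoffelFirst k w X Y Z :=
  Classical.choose_spec (exists_christoffel k w X Y) Z

/-- The covariant derivative `∇_X V = D_X V + Γ(D_X F, V)` at `x` of a vector field `V` along a map
`F`, everything read in the `k`-th chart of `ℂP³`. -/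
noncomputable def covDerivAlong {E : Type*} [NormedAddCommGroup E] [NormedSpace ℝ E] (k : Fin 4)
    (F V : E → C3) (x X : E) : C3 :=
  fderiv ℝ V x X + christoffel k (F x) (fderiv ℝ F x X) (V x)

/-! ### The structures on the tangent spaces of `ℂP³` -/

section Tangent

variable (p : CP3)

/-- The nearly Kähler metric `g`. -/
noncomputable def metric (X Y : TangentSpace 𝓘(ℝ, C3) p) : ℝ :=
  chartMetric (chartIndex p) (coord (chartIndex p) p) X Y

/-- The nearly Kähler almost complex structure `J`. -/
noncomputable def J (X : TangentSpace 𝓘(ℝ, C3) p) : TangentSpace 𝓘(ℝ, C3) p :=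
  chartJ (chartIndex p) (coord (chartIndex p) p) X

/-- The almost product structure `P`. -/
noncomputable def P (X : TangentSpace 𝓘(ℝ, C3) p) : TangentSpace 𝓘(ℝ, C3) p :=
  chartP (chartIndex p) (coord (chartIndex p) p) X

/-- The distribution `𝒟₂⁴`: the image under the differential of the Hopf fibration of the vectors
orthogonal to `z`, `i z`, `j z` and `k z`. -/
def D2 : Set (TangentSpace 𝓘(ℝ, C3) p) :=
  {X | ∃ v : C4, herm (affineLift (chartIndex p) (coord (chartIndex p) p)) v = 0 ∧
    herm (quatJ (affineLift (chartIndex p) (coord (chartIndex p) p))) v = 0 ∧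
    dproj (chartIndex p) (coord (chartIndex p) p) v = X}

end Tangent

/-! ### Hypersurfaces -/

section Hypersurface

variable {M : Type*} [TopologicalSpace M] [ChartedSpace (EuclideanSpace ℝ (Fin 5)) M]

/-- A smooth immersion of a 5-dimensional manifold. -/
structure IsHypersurface (f : M → CP3) : Prop where
  contMDiff : ContMDiff (𝓡 5) 𝓘(ℝ, C3) ∞ f
  injective_mfderiv : ∀ p, Function.Injective (mfderiv (𝓡 5) 𝓘(ℝ, C3) f p)

/-- `N` is a unit normal at `p` with respect to the nearly Kähler metric. -/
def IsUnitNormal (f : M → CP3) (p : M) (N : TangentSpace 𝓘(ℝ, C3) (f p)) : Prop :=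
  metric (f p) N N = 1 ∧
    ∀ X : TangentSpace (𝓡 5) p, metric (f p) (mfderiv (𝓡 5) 𝓘(ℝ, C3) f p X) N = 0

/-- The map `f`, read in the preferred charts at `p` and `f p`. -/
noncomputable def localMap (f : M → CP3) (p : M) : EuclideanSpace ℝ (Fin 5) → C3 :=
  writtenInExtChartAt (𝓡 5) 𝓘(ℝ, C3) p f

/-- The ambient covariant derivative `∇_X (df Y)` at `p`, where the tangent vector `Y` is extended
to the vector field that is constant in the preferred chart at `p`. -/
noncomputable def ambientDeriv (f : M → CP3) (p : M) (X Y : TangentSpace (𝓡 5) p) :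
    TangentSpace 𝓘(ℝ, C3) (f p) :=
  covDerivAlong (E := EuclideanSpace ℝ (Fin 5)) (chartIndex (f p)) (localMap f p)
    (fun x => fderiv ℝ (localMap f p) x Y) (extChartAt (𝓡 5) p p) X

/-- The scalar second fundamental form `α(X, Y) = g(h(X, Y), N) = g(∇_X Y, N)` with respect to a
unit normal `N` at `p`. -/
noncomputable def secondFundamentalForm (f : M → CP3) (p : M) (N : TangentSpace 𝓘(ℝ, C3) (f p))
    (X Y : TangentSpace (𝓡 5) p) : ℝ :=
  metric (f p) (ambientDeriv f p X Y) N

/-- `A` is the shape operator for the unit normal `N` at `p`, i.e. `g(A X, Y) = α(X, Y)`. -/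
def IsShapeOperator (f : M → CP3) (p : M) (N : TangentSpace 𝓘(ℝ, C3) (f p))
    (A : Module.End ℝ (TangentSpace (𝓡 5) p)) : Prop :=
  ∀ X Y : TangentSpace (𝓡 5) p,
    metric (f p) (mfderiv (𝓡 5) 𝓘(ℝ, C3) f p (A X)) (mfderiv (𝓡 5) 𝓘(ℝ, C3) f p Y) =
      secondFundamentalForm f p N X Y

/-- Hopf: at each point, with unit normal `N`, the tangent vector `J N` is an eigenvector of the
shape operator. (The condition does not depend on the sign of `N`, and the eigenvalue may vary from
point to point.) -/
def IsHopf (f : M → CP3) : Prop :=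
  ∀ p N, IsUnitNormal f p N →
    ∃ (A : Module.End ℝ (TangentSpace (𝓡 5) p)) (ξ : TangentSpace (𝓡 5) p) (μ : ℝ),
      IsShapeOperator f p N A ∧ mfderiv (𝓡 5) 𝓘(ℝ, C3) f p ξ = J (f p) N ∧
        Module.End.HasEigenvector A μ ξ

/-- The angle `θ ∈ [0, π/2]` of a unit normal `N`, given by `cos (2 θ) = g(N, P N)`. -/
noncomputable def angle (q : CP3) (N : TangentSpace 𝓘(ℝ, C3) q) : ℝ :=
  Real.arccos (metric q N (P q N)) / 2

/-- Horizontal: the angle vanishes identically. -/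
def IsHorizontal (f : M → CP3) : Prop :=
  ∀ p N, IsUnitNormal f p N → angle (f p) N = 0

end Hypersurface

end CP3

/-! Suppose that a unit normal `N` of a Hopf hypersurface has a nonzero `𝒟₁` component at some
point. Lift the hypersurface locally to `p` in `S⁷` and `N` to a horizontal vector `n`. The normal
cannot lie in `𝒟₁` on an open set: all of `𝒟₂` would be tangent there, whereas brackets of sections
of `𝒟₂` have a component along `N` (`NormalLift.false_of_vertical`). Hence both components of `N`
are nonzero on some open set, and a change of phase brings the lift to the form `n = s jp + (c/2) r`
with `s, c > 0`, the sine and cosine of the angle.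

This provides a moving frame `p, jp, r, jr` of `ℂ⁴` and an invariant coframe `η, κ₁, κ₂, γ₁, γ₂` of
the hypersurface, `η` being dual to the structure vector `ξ = JN`. The second fundamental form is
`-1/2` times the first variation of the induced metric. That variation is natural under the
projection to `ℂP³`, so it can be computed on `ℂ⁴` without Christoffel symbols; it turns `α(ξ, ·)`
into an explicit form `ω` (`AdaptedFrame.second_form`). The Hopf condition becomes `ω = μ η`.

The rest is repeated exterior differentiation (`HopfForms.false_of_mem`). Contracting `dω = d(μη)`
with `ξ` gives `dμ = m η + f κ₁`, where `f = 2sc(3s² - 2c²)` is `slope`. From `d²μ = 0` come the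
shape `dm = n η + f (-scχ - μκ₂ - γ₂)` and linear equations for the entries of the shape operator;
`d²m = 0` adds a quadratic one. Three cases remain. If `f ≠ 0` and `m ≡ 0`, the equations contradict
each other at once. If `f m ≠ 0`, they make `m²` a function of the angle; then `dm` is a multiple of
the differential of the angle, and `tan²` of the angle must satisfy polynomial conditions with no
common positive solution. If `f ≡ 0`, the angle and `μ` are locally constant, `χ` has constant
coefficients in the coframe, and the structure equation for `dχ` fails. -/

/-! ### Elimination for the real algebraic system of the generic case. -/

/-- Here `T = tan²` of the angle and `h = m / c⁴`; the unknowns `a, b, x, y` are normalized shape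
operator entries. The first four equations are linear in these and determine them from `T` and `h`;
substitution into the quadratic one leaves a relation between `T` and `h` alone. -/
theorem sq_mul_eq_of_pairing_relations {T h a b x y : ℝ} (hT : 0 < T) (hh : h ≠ 0)
    (hQ : 6 * T - 4 ≠ 0)
    (e13 : h * (y - x) - (26 * T - 4) * a - T * (6 * T - 4) = 0)
    (e24 : h * (y - x) - (6 * T - 4) * b + T * (6 * T - 4) = 0)
    (e14 : h * (a + b + 2) - (26 * T - 4) * x = 0)
    (e23 : -h * (a + b - 2) - (6 * T - 4) * y = 0)
    (star : 2 * (4 * T - 1) * (a * b - x * y) + 5 * T ^ 2 * a + T ^ 2 * (3 * T - 2) = 0) :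
    2 * (4 * T - 1) * h ^ 2 = (3 * T - 2) * (25 * T ^ 3 - 104 * T ^ 2 + 42 * T - 4) := by
  -- The elimination below multiplies by `26 T - 4`, so its zero is treated by direct substitution.
  by_cases hP : 26 * T - 4 = 0
  · have hT' : T = 2 / 13 := by linarith
    subst hT'
    have hu : a + b + 2 = 0 := by
      have : h * (a + b + 2) = 0 := by linarith
      simpa [hh] using this
    have hb : b = 4 / 13 := by linarith
    have ha : a = -30 / 13 := by linarith
    subst hb ha
    have hy : y = -13 * h / 10 := by linarith
    subst hy
    have hx : h * x = -13 * h ^ 2 / 10 + 80 / 169 := by linarith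
    linarith
  -- Cramer's rule: up to sign, the common factor of `hA` and `hB` is the determinant of the four
  -- linear equations. Note that `32 T - 8` is the sum of `26 T - 4` and `6 T - 4`.
  · have hA : a * ((26 * T - 4) ^ 2 * (6 * T - 4) ^ 2 + h ^ 2 * (32 * T - 8) ^ 2) =
        -(6 * T - 4) * T * ((26 * T - 4) * (6 * T - 4) ^ 2 + 8 * h ^ 2 * (8 * T - 7)) := by
      linear_combination (6 * T - 4) * (-(26 * T - 4) * h * e23 + (6 * T - 4) * h * e14 -
        (26 * T - 4) * (6 * T - 4) * e13) + h ^ 2 * (32 * T - 8) * (e24 - e13)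
    have hB : b * ((26 * T - 4) ^ 2 * (6 * T - 4) ^ 2 + h ^ 2 * (32 * T - 8) ^ 2) =
        T * ((26 * T - 4) ^ 2 * (6 * T - 4) ^ 2 + 16 * h ^ 2 * (24 * T ^ 2 + 43 * T - 6)) := by
      apply mul_left_cancel₀ hQ
      linear_combination (26 * T - 4) * hA +
        (e13 - e24) * ((26 * T - 4) ^ 2 * (6 * T - 4) ^ 2 + h ^ 2 * (32 * T - 8) ^ 2)
    -- Removes `x` and `y` from the quadratic expression `a b - x y`.
    have hD : (26 * T - 4) * (6 * T - 4) * (a * b - x * y) =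
        (26 * T - 4) * (6 * T - 4) * a * b + h ^ 2 * ((a + b) ^ 2 - 4) := by
      linear_combination (6 * T - 4) * y * e14 + h * (a + b + 2) * e23
    have hE : 0 < (26 * T - 4) ^ 2 * (6 * T - 4) ^ 2 + h ^ 2 * (32 * T - 8) ^ 2 := by positivity
    set F := (26 * T - 4) ^ 2 * (6 * T - 4) ^ 2 + h ^ 2 * (32 * T - 8) ^ 2 with hF
    have key : 16 * ((26 * T - 4) * (6 * T - 4)) * F * h ^ 2 * (2 * (4 * T - 1) * h ^ 2 -
        (3 * T - 2) * (25 * T ^ 3 - 104 * T ^ 2 + 42 * T - 4)) = 0 := by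
      have s1 : 2 * (4 * T - 1) * ((26 * T - 4) * (6 * T - 4) * (a * F) * (b * F) +
          h ^ 2 * ((a * F + b * F) ^ 2 - 4 * F ^ 2)) + (26 * T - 4) * (6 * T - 4) *
          (5 * T ^ 2 * (a * F) * F + T ^ 2 * (3 * T - 2) * F ^ 2) = 0 := by
        linear_combination F ^ 2 * (26 * T - 4) * (6 * T - 4) * star -
          2 * (4 * T - 1) * F ^ 2 * hD
      rw [hA, hB] at s1
      rw [hF] at s1 ⊢
      linear_combination -s1
    have := (mul_eq_zero.1 key).resolve_left (by positivity)
    linarith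

/-- The extra relation `hxy` says that `dm` and the differential of the angle are proportional on
the plane of `X 3` and `X 4`. It makes the system overdetermined: eliminating `a` and then `h`
leaves a sextic in `T`, whose positive roots are excluded by the sign of `h²`. -/
theorem false_of_pairing_relations {T h a b x y : ℝ} (hT : 0 < T) (hh : h ≠ 0)
    (hQ : 6 * T - 4 ≠ 0)
    (e13 : h * (y - x) - (26 * T - 4) * a - T * (6 * T - 4) = 0)
    (e24 : h * (y - x) - (6 * T - 4) * b + T * (6 * T - 4) = 0)
    (e14 : h * (a + b + 2) - (26 * T - 4) * x = 0)
    (e23 : -h * (a + b - 2) - (6 * T - 4) * y = 0)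
    (star : 2 * (4 * T - 1) * (a * b - x * y) + 5 * T ^ 2 * a + T ^ 2 * (3 * T - 2) = 0)
    (hH : 2 * (4 * T - 1) * h ^ 2 = (3 * T - 2) * (25 * T ^ 3 - 104 * T ^ 2 + 42 * T - 4))
    (hxy : y * x = a * (b + 1)) : False := by
  have hA : a * ((26 * T - 4) ^ 2 * (6 * T - 4) ^ 2 + h ^ 2 * (32 * T - 8) ^ 2) =
      -(6 * T - 4) * T * ((26 * T - 4) * (6 * T - 4) ^ 2 + 8 * h ^ 2 * (8 * T - 7)) := by
    linear_combination (6 * T - 4) * (-(26 * T - 4) * h * e23 + (6 * T - 4) * h * e14 -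
      (26 * T - 4) * (6 * T - 4) * e13) + h ^ 2 * (32 * T - 8) * (e24 - e13)
  -- By `hxy`, `a b - x y = -a`, so the quadratic equation becomes linear in `a`.
  have ha : a * (5 * T ^ 2 - 8 * T + 2) = T ^ 2 * (2 - 3 * T) := by
    linear_combination star + 2 * (4 * T - 1) * hxy
  have hpos : 0 < h ^ 2 := by positivity
  have k1 : 4 * h ^ 2 * (-24 * T ^ 3 - 67 * T ^ 2 + 68 * T - 14) =
      (26 * T - 4) * (6 * T - 4) ^ 2 * (4 * T - 1) * (T + 1) := by
    have : T * (6 * T - 4) * (4 * h ^ 2 * (-24 * T ^ 3 - 67 * T ^ 2 + 68 * T - 14) -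
      (26 * T - 4) * (6 * T - 4) ^ 2 * (4 * T - 1) * (T + 1)) = 0 := by
      linear_combination (-(5 * T ^ 2 - 8 * T + 2) * hA + ((26 * T - 4) ^ 2 * (6 * T - 4) ^ 2 +
        h ^ 2 * (32 * T - 8) ^ 2) * ha) / (-2)
    have := (mul_eq_zero.1 this).resolve_left (by positivity)
    linarith
  have hR : (120 * T ^ 6 + 335 * T ^ 5 - 1692 * T ^ 4 + 1656 * T ^ 3 - 680 * T ^ 2 + 124 * T - 8) = 0 := by
    have : 5 * (3 * T - 2) * (120 * T ^ 6 + 335 * T ^ 5 - 1692 * T ^ 4 + 1656 * T ^ 3 - 680 * T ^ 2 + 124 * T - 8) = 0 := by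
      linear_combination -(4 * T - 1) / 2 * k1 +
        (-24 * T ^ 3 - 67 * T ^ 2 + 68 * T - 14) * hH
    have h3 : 3 * T - 2 ≠ 0 := fun h0 => hQ (by linarith)
    have := (mul_eq_zero.1 this).resolve_left (by positivity)
    linarith
  -- Since `h² > 0`, equation `k1` forces this cubic to have the sign of `(13 T - 2)(4 T - 1)`.
  have hW : 0 ≤ (13 * T - 2) * (4 * T - 1) →
      0 ≤ -24 * T ^ 3 - 67 * T ^ 2 + 68 * T - 14 := fun hs => by
    have h1 : 0 ≤ 4 * h ^ 2 * (-24 * T ^ 3 - 67 * T ^ 2 + 68 * T - 14) := by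
      have : 0 ≤ (13 * T - 2) * (4 * T - 1) * (2 * (6 * T - 4) ^ 2 * (T + 1)) := by positivity
      rw [k1]
      linarith
    exact nonneg_of_mul_nonneg_right h1 (by positivity)
  -- The half line is cut so that on each interval either the sextic has no zero or the cubic has
  -- the sign forbidden by `hW`.
  rcases le_total T (3 / 20) with h1 | h1
  · have := hW (mul_nonneg_of_nonpos_of_nonpos (by linarith) (by linarith))
    nlinarith [mul_pos hT hT, mul_pos hT (mul_pos hT hT)]
  rcases le_total T (1 / 4) with h2 | h2
  -- The sextic in the Bernstein basis of `[3/20, 1/4]`: all coefficients are positive.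
  · have e : 0 < 947695/16 * (T - 3/20) ^ 0 * (1/4 - T) ^ 6 + 1339450 * (T - 3/20) ^ 1 * (1/4 - T) ^ 5 + 68780175/16 * (T - 3/20) ^ 2 * (1/4 - T) ^ 4 + 11418875/2 * (T - 3/20) ^ 3 * (1/4 - T) ^ 3 + 59228125/16 * (T - 3/20) ^ 4 * (1/4 - T) ^ 2 + 2265625/2 * (T - 3/20) ^ 5 * (1/4 - T) ^ 1 + 1953125/16 * (T - 3/20) ^ 6 * (1/4 - T) ^ 0 := by
      rcases h1.eq_or_lt with rfl | h1
      · norm_num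
      · have a1 : 0 < T - 3 / 20 := by linarith
        have a2 : 0 ≤ 1 / 4 - T := by linarith
        positivity
    linarith
  have h41 : 0 ≤ (13 * T - 2) * (4 * T - 1) := mul_nonneg (by linarith) (by linarith)
  rcases le_total T (3 / 10) with h3 | h3
  · nlinarith [hW h41, mul_nonneg (sub_nonneg.2 h2) (sub_nonneg.2 h3), mul_pos hT (mul_pos hT hT)]
  rcases le_total T (11 / 20) with h4 | h4
  -- Minus the sextic in the Bernstein basis of `[3/10, 11/20]`, again with positive coefficients.
  · have e : 0 < 1173376/3125 * (T - 3/10) ^ 0 * (11/20 - T) ^ 6 + 20796736/3125 * (T - 3/10) ^ 1 * (11/20 - T) ^ 5 + 16996608/625 * (T - 3/10) ^ 2 * (11/20 - T) ^ 4 + 31410464/625 * (T - 3/10) ^ 3 * (11/20 - T) ^ 3 + 40600088/625 * (T - 3/10) ^ 4 * (11/20 - T) ^ 2 + 170945156/3125 * (T - 3/10) ^ 5 * (11/20 - T) ^ 1 + 59262356/3125 * (T - 3/10) ^ 6 * (11/20 - T) ^ 0 := by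
      rcases h3.eq_or_lt with rfl | h3
      · norm_num
      · have a1 : 0 < T - 3 / 10 := by linarith
        have a2 : 0 ≤ 11 / 20 - T := by linarith
        positivity
    linarith
  · nlinarith [hW h41, mul_nonneg (sub_nonneg.2 h4) (sub_nonneg.2 h4), mul_nonneg hT.le (mul_nonneg (sub_nonneg.2 h4) (sub_nonneg.2 h4))]


/-! ### Exterior calculus of 1-forms on a normed space. -/

section ExtD

variable {V : Type*} [NormedAddCommGroup V] [NormedSpace ℝ V]

/-- The exterior derivative of a 1-form on a normed space, evaluated on two constant vectors. -/
noncomputable def extD (σ : V → V → ℝ) (x X Y : V) : ℝ :=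
  fderiv ℝ (fun y => σ y Y) x X - fderiv ℝ (fun y => σ y X) x Y

/-- The wedge product of two covectors. -/
def wedge (a b : V → ℝ) (X Y : V) : ℝ := a X * b Y - a Y * b X

/-- A 1-form is smooth at `x` when its values on constant vectors are. -/
def SmoothFormAt (σ : V → V → ℝ) (x : V) : Prop := ∀ Y, ContDiffAt ℝ ∞ (fun y => σ y Y) x

theorem SmoothFormAt.differentiableAt {σ : V → V → ℝ} {x : V} (h : SmoothFormAt σ x) (Y : V) :
    DifferentiableAt ℝ (fun y => σ y Y) x := (h Y).differentiableAt (by simp)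

theorem SmoothFormAt.add {σ σ' : V → V → ℝ} {x : V} (h : SmoothFormAt σ x)
    (h' : SmoothFormAt σ' x) : SmoothFormAt (fun y Y => σ y Y + σ' y Y) x :=
  fun Y => (h Y).add (h' Y)

theorem SmoothFormAt.sub {σ σ' : V → V → ℝ} {x : V} (h : SmoothFormAt σ x)
    (h' : SmoothFormAt σ' x) : SmoothFormAt (fun y Y => σ y Y - σ' y Y) x :=
  fun Y => (h Y).sub (h' Y)

theorem SmoothFormAt.neg {σ : V → V → ℝ} {x : V} (h : SmoothFormAt σ x) :
    SmoothFormAt (fun y Y => -σ y Y) x :=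
  fun Y => (h Y).neg

theorem SmoothFormAt.mul {g : V → ℝ} {σ : V → V → ℝ} {x : V} (hg : ContDiffAt ℝ ∞ g x)
    (h : SmoothFormAt σ x) : SmoothFormAt (fun y Y => g y * σ y Y) x :=
  fun Y => hg.mul (h Y)

theorem smoothFormAt_fderiv {g : V → ℝ} {x : V} (hg : ContDiffAt ℝ ∞ g x) :
    SmoothFormAt (fun y Y => fderiv ℝ g y Y) x := fun Y =>
  (hg.fderiv_right (m := ∞) (by simp)).clm_apply contDiffAt_const

theorem extD_add {σ σ' : V → V → ℝ} {x : V} (h : SmoothFormAt σ x) (h' : SmoothFormAt σ' x)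
    (X Y : V) : extD (fun y Y => σ y Y + σ' y Y) x X Y = extD σ x X Y + extD σ' x X Y := by
  simp only [extD]
  rw [fderiv_fun_add (h.differentiableAt _) (h'.differentiableAt _),
    fderiv_fun_add (h.differentiableAt _) (h'.differentiableAt _)]
  simp only [add_apply]
  ring

theorem extD_sub {σ σ' : V → V → ℝ} {x : V} (h : SmoothFormAt σ x) (h' : SmoothFormAt σ' x)
    (X Y : V) : extD (fun y Y => σ y Y - σ' y Y) x X Y = extD σ x X Y - extD σ' x X Y := by
  simp only [extD]
  rw [fderiv_fun_sub (h.differentiableAt _) (h'.differentiableAt _),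
    fderiv_fun_sub (h.differentiableAt _) (h'.differentiableAt _)]
  simp only [sub_apply]
  ring

theorem extD_neg {σ : V → V → ℝ} {x : V} (X Y : V) :
    extD (fun y Y => -σ y Y) x X Y = -extD σ x X Y := by
  simp only [extD]
  rw [fderiv_fun_neg, fderiv_fun_neg]
  simp only [neg_apply]
  ring

theorem extD_mul {g : V → ℝ} {σ : V → V → ℝ} {x : V} (hg : ContDiffAt ℝ ∞ g x)
    (h : SmoothFormAt σ x) (X Y : V) : extD (fun y Y => g y * σ y Y) x X Y =
      wedge (fun Z => fderiv ℝ g x Z) (σ x) X Y + g x * extD σ x X Y := by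
  have hg' : DifferentiableAt ℝ g x := hg.differentiableAt (by simp)
  simp only [extD, wedge]
  rw [fderiv_fun_mul hg' (h.differentiableAt _), fderiv_fun_mul hg' (h.differentiableAt _)]
  simp only [add_apply, smul_apply, smul_eq_mul]
  ring

theorem extD_congr {σ σ' : V → V → ℝ} {U : Set V} (hU : IsOpen U) {x : V} (hx : x ∈ U)
    (h : ∀ y ∈ U, ∀ Y, σ y Y = σ' y Y) (X Y : V) : extD σ x X Y = extD σ' x X Y := by
  have e : ∀ Y, (fun y => σ y Y) =ᶠ[nhds x] fun y => σ' y Y := fun Y => by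
    filter_upwards [hU.mem_nhds hx] with y hy using h y hy Y
  simp only [extD, (e _).fderiv_eq]

theorem extD_fderiv {g : V → ℝ} {x : V} (hg : ContDiffAt ℝ ∞ g x) (X Y : V) :
    extD (fun y Y => fderiv ℝ g y Y) x X Y = 0 := by
  have hd : DifferentiableAt ℝ (fderiv ℝ g) x :=
    (hg.fderiv_right (m := ∞) (by simp)).differentiableAt (by simp)
  have e : ∀ X Y : V, fderiv ℝ (fun y => fderiv ℝ g y Y) x X = fderiv ℝ (fderiv ℝ g) x X Y := by
    intro X Y
    rw [fderiv_clm_apply hd (differentiableAt_const _)]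
    simp
  rw [extD, e, e, sub_eq_zero]
  exact (hg.isSymmSndFDerivAt (by simp; exact WithTop.coe_le_coe.2 le_top)).eq X Y

/-- If a smooth 1-form is pointwise of the form `m η + φ`, then the coefficient `m` is smooth. -/
theorem exists_smooth_coeff {U : Set V} (hU : IsOpen U) {σ η φ : V → V → ℝ}
    (hσ : ∀ x ∈ U, SmoothFormAt σ x) (hη : ∀ x ∈ U, SmoothFormAt η x)
    (hφ : ∀ x ∈ U, SmoothFormAt φ x) (hne : ∀ x ∈ U, ∃ X, η x X ≠ 0)
    (h : ∀ x ∈ U, ∃ m, ∀ Y, σ x Y = m * η x Y + φ x Y) :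
    ∃ m : V → ℝ, (∀ x ∈ U, ContDiffAt ℝ ∞ m x) ∧ ∀ x ∈ U, ∀ Y, σ x Y = m x * η x Y + φ x Y := by
  classical
  choose! m hm using h
  refine ⟨m, fun x hx => ?_, hm⟩
  obtain ⟨X, hX⟩ := hne x hx
  have h1 : ContDiffAt ℝ ∞ (fun y => (σ y X - φ y X) / η y X) x :=
    ((hσ x hx X).sub (hφ x hx X)).div (hη x hx X) hX
  refine h1.congr_of_eventuallyEq ?_
  filter_upwards [hU.mem_nhds hx,
    (hη x hx X).continuousAt.eventually_ne hX] with y hy hy'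
  rw [hm y hy X]
  field_simp
  ring

end ExtD

/-! ### The exterior differential system of a Hopf hypersurface. -/

/-- `X` is the frame dual to the coframe `η, κ₁, κ₂, γ₁, γ₂`. -/
structure IsDualFrame {V : Type*} [AddCommGroup V] [Module ℝ V] (η κ₁ κ₂ γ₁ γ₂ : V → ℝ)
    (X : Fin 5 → V) : Prop where
  expand : ∀ Y, Y = η Y • X 0 + κ₁ Y • X 1 + κ₂ Y • X 2 + γ₁ Y • X 3 + γ₂ Y • X 4
  apply_η : ∀ i, η (X i) = if i = 0 then 1 else 0
  apply_κ₁ : ∀ i, κ₁ (X i) = if i = 1 then 1 else 0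
  apply_κ₂ : ∀ i, κ₂ (X i) = if i = 2 then 1 else 0
  apply_γ₁ : ∀ i, γ₁ (X i) = if i = 3 then 1 else 0
  apply_γ₂ : ∀ i, γ₂ (X i) = if i = 4 then 1 else 0

/-- Invariant forms of a hypersurface with Hopf structure vector, in an adapted moving frame: the
coframe `η, κ₁, κ₂, γ₁, γ₂`, the connection forms `χ, e₁, e₂` and `θ`, where `(c, s)` is the pair
`(cos, sin)` of an angle with differential `θ`, together with their structure equations. -/
structure HopfForms {V : Type*} [NormedAddCommGroup V] [NormedSpace ℝ V] (U : Set V)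
    (s c μ : V → ℝ) (η κ₁ κ₂ γ₁ γ₂ θ χ e₁ e₂ : V → V → ℝ) : Prop where
  isOpen : IsOpen U
  smooth_s : ∀ x ∈ U, ContDiffAt ℝ ∞ s x
  smooth_c : ∀ x ∈ U, ContDiffAt ℝ ∞ c x
  smooth_μ : ∀ x ∈ U, ContDiffAt ℝ ∞ μ x
  smooth_η : ∀ x ∈ U, SmoothFormAt η x
  smooth_κ₁ : ∀ x ∈ U, SmoothFormAt κ₁ x
  smooth_κ₂ : ∀ x ∈ U, SmoothFormAt κ₂ x
  smooth_γ₂ : ∀ x ∈ U, SmoothFormAt γ₂ x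
  smooth_χ : ∀ x ∈ U, SmoothFormAt χ x
  s_pos : ∀ x ∈ U, 0 < s x
  c_pos : ∀ x ∈ U, 0 < c x
  sq_add_sq : ∀ x ∈ U, s x ^ 2 + c x ^ 2 = 1
  deriv_s : ∀ x ∈ U, ∀ X, fderiv ℝ s x X = c x * θ x X
  deriv_c : ∀ x ∈ U, ∀ X, fderiv ℝ c x X = -s x * θ x X
  coframe : ∀ x ∈ U, ∃ X : Fin 5 → V, IsDualFrame (η x) (κ₁ x) (κ₂ x) (γ₁ x) (γ₂ x) X
  linear_χ : ∀ x ∈ U, IsLinearMap ℝ (χ x)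
  normal : ∀ x ∈ U, ∀ X Y, wedge (θ x) (κ₁ x) X Y + s x * c x * wedge (χ x) (κ₂ x) X Y +
    c x * wedge (e₁ x) (γ₁ x) X Y - c x * wedge (e₂ x) (γ₂ x) X Y - wedge (κ₁ x) (γ₁ x) X Y +
    wedge (κ₂ x) (γ₂ x) X Y = 0
  ext_η : ∀ x ∈ U, ∀ X Y, extD η x X Y = wedge (θ x) (κ₂ x) X Y -
    s x * c x * wedge (χ x) (κ₁ x) X Y + c x * wedge (e₁ x) (γ₂ x) X Y +
    c x * wedge (e₂ x) (γ₁ x) X Y + wedge (κ₁ x) (γ₂ x) X Y + wedge (κ₂ x) (γ₁ x) X Y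
  ext_μη : ∀ x ∈ U, ∀ X Y, extD (fun y Y => μ y * η y Y) x X Y =
    -2 * s x * c x * wedge (θ x) (χ x) X Y + 2 * c x ^ 2 * wedge (e₁ x) (e₂ x) X Y +
    2 * s x * c x * (2 * c x ^ 2 - 3 * s x ^ 2) * wedge (η x) (κ₁ x) X Y +
    2 * (-c x ^ 4 + 3 * s x ^ 2 * c x ^ 2 - s x ^ 4) * wedge (κ₁ x) (κ₂ x) X Y -
    2 * s x ^ 2 * wedge (γ₁ x) (γ₂ x) X Y
  ext_κ₁ : ∀ x ∈ U, ∀ X Y, extD κ₁ x X Y = s x * c x * wedge (χ x) (η x) X Y -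
    (μ x * wedge (η x) (κ₂ x) X Y + (s x ^ 2 - c x ^ 2) * wedge (χ x) (κ₂ x) X Y) -
    s x * wedge (e₁ x) (γ₁ x) X Y + s x * wedge (e₂ x) (γ₂ x) X Y - wedge (η x) (γ₂ x) X Y
  ext_κ₂ : ∀ x ∈ U, ∀ X Y, extD κ₂ x X Y = -wedge (θ x) (η x) X Y +
    (μ x * wedge (η x) (κ₁ x) X Y + (s x ^ 2 - c x ^ 2) * wedge (χ x) (κ₁ x) X Y) -
    s x * wedge (e₁ x) (γ₂ x) X Y - s x * wedge (e₂ x) (γ₁ x) X Y - wedge (η x) (γ₁ x) X Y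
  ext_γ₂ : ∀ x ∈ U, ∀ X Y, extD γ₂ x X Y = -2 * μ x * wedge (η x) (γ₁ x) X Y +
    (c x ^ 2 - s x ^ 2) * wedge (χ x) (γ₁ x) X Y - c x * wedge (e₁ x) (η x) X Y +
    s x * wedge (e₁ x) (κ₂ x) X Y - s x * wedge (e₂ x) (κ₁ x) X Y + wedge (η x) (κ₁ x) X Y
  ext_χ : ∀ x ∈ U, ∀ X Y, extD χ x X Y =
    -(2 * (3 * c x ^ 2 - 2 * s x ^ 2)) * wedge (κ₁ x) (κ₂ x) X Y +
    10 * s x * c x * wedge (η x) (κ₁ x) X Y + 2 * wedge (γ₁ x) (γ₂ x) X Y +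
    2 * wedge (e₁ x) (e₂ x) X Y

namespace HopfForms

variable {V : Type*} [NormedAddCommGroup V] [NormedSpace ℝ V] {U : Set V}
    {s c μ : V → ℝ} {η κ₁ κ₂ γ₁ γ₂ θ χ e₁ e₂ : V → V → ℝ}

theorem mono (H : HopfForms U s c μ η κ₁ κ₂ γ₁ γ₂ θ χ e₁ e₂) {U' : Set V} (ho : IsOpen U')
    (hs : U' ⊆ U) : HopfForms U' s c μ η κ₁ κ₂ γ₁ γ₂ θ χ e₁ e₂ :=
  ⟨ho, fun x hx => H.smooth_s x (hs hx), fun x hx => H.smooth_c x (hs hx),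
    fun x hx => H.smooth_μ x (hs hx), fun x hx => H.smooth_η x (hs hx),
    fun x hx => H.smooth_κ₁ x (hs hx), fun x hx => H.smooth_κ₂ x (hs hx),
    fun x hx => H.smooth_γ₂ x (hs hx), fun x hx => H.smooth_χ x (hs hx),
    fun x hx => H.s_pos x (hs hx), fun x hx => H.c_pos x (hs hx),
    fun x hx => H.sq_add_sq x (hs hx), fun x hx => H.deriv_s x (hs hx),
    fun x hx => H.deriv_c x (hs hx), fun x hx => H.coframe x (hs hx),
    fun x hx => H.linear_χ x (hs hx),
    fun x hx => H.normal x (hs hx), fun x hx => H.ext_η x (hs hx),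
    fun x hx => H.ext_μη x (hs hx), fun x hx => H.ext_κ₁ x (hs hx),
    fun x hx => H.ext_κ₂ x (hs hx), fun x hx => H.ext_γ₂ x (hs hx),
    fun x hx => H.ext_χ x (hs hx)⟩

/-- The structure vector is annihilated by the connection forms. -/
theorem eq_zero_of_dual (H : HopfForms U s c μ η κ₁ κ₂ γ₁ γ₂ θ χ e₁ e₂) {x : V} (hx : x ∈ U)
    {X : Fin 5 → V} (hX : IsDualFrame (η x) (κ₁ x) (κ₂ x) (γ₁ x) (γ₂ x) X) :
    θ x (X 0) = 0 ∧ χ x (X 0) = 0 ∧ e₁ x (X 0) = 0 ∧ e₂ x (X 0) = 0 := by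
  have hs := H.s_pos x hx
  have hc := H.c_pos x hx
  -- No `η` occurs in `normal`, so pairing `X 0` with each of the other frame vectors isolates a
  -- single value.
  have h := fun i => H.normal x hx (X 0) (X i)
  simp only [wedge, hX.apply_κ₁, hX.apply_κ₂, hX.apply_γ₁, hX.apply_γ₂] at h
  have h1 := h 1
  have h2 := h 2
  have h3 := h 3
  have h4 := h 4
  simp at h1 h2 h3 h4
  refine ⟨h1, ?_, ?_, ?_⟩
  · rcases h2 with h | h
    · rcases h with h | h <;> linarith
    · exact h
  · exact h3.resolve_left hc.ne'
  · exact h4.resolve_left hc.ne'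

/-- The function `f` with `dμ = m η + f κ₁`. -/
def slope (s c : ℝ) : ℝ := 2 * s * c * (3 * s ^ 2 - 2 * c ^ 2)

/-- Contraction of the equation for `d(μη)` with `X 0`: as `θ, χ, e₁, e₂` vanish there, `dη`
contributes nothing and only the `η ∧ κ₁` term survives on the right. -/
theorem exists_deriv_μ (H : HopfForms U s c μ η κ₁ κ₂ γ₁ γ₂ θ χ e₁ e₂) :
    ∃ m : V → ℝ, (∀ x ∈ U, ContDiffAt ℝ ∞ m x) ∧
      ∀ x ∈ U, ∀ Y, fderiv ℝ μ x Y = m x * η x Y + slope (s x) (c x) * κ₁ x Y := by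
  refine exists_smooth_coeff H.isOpen (fun x hx => smoothFormAt_fderiv (H.smooth_μ x hx))
    H.smooth_η (fun x hx => SmoothFormAt.mul ?_ (H.smooth_κ₁ x hx)) (fun x hx => ?_)
    fun x hx => ?_
  · have := H.smooth_s x hx
    have := H.smooth_c x hx
    unfold slope
    fun_prop
  · obtain ⟨X, hX⟩ := H.coframe x hx
    exact ⟨X 0, by simp [hX.apply_η]⟩
  · obtain ⟨X, hX⟩ := H.coframe x hx
    obtain ⟨t0, k0, u0, v0⟩ := H.eq_zero_of_dual hx hX
    refine ⟨fderiv ℝ μ x (X 0), fun Y => ?_⟩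
    have h := H.ext_μη x hx (X 0) Y
    rw [extD_mul (H.smooth_μ x hx) (H.smooth_η x hx), H.ext_η x hx] at h
    simp only [wedge, hX.apply_η, hX.apply_κ₁, hX.apply_κ₂, hX.apply_γ₁, hX.apply_γ₂, t0, k0, u0, v0] at h
    simp at h
    unfold slope
    linear_combination -h

theorem slope_hasFDerivAt (H : HopfForms U s c μ η κ₁ κ₂ γ₁ γ₂ θ χ e₁ e₂) {x : V} (hx : x ∈ U)
    (X : V) : fderiv ℝ (fun y => slope (s y) (c y)) x X =
      (30 * s x ^ 2 * c x ^ 2 - 6 * s x ^ 4 - 4 * c x ^ 4) * θ x X := by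
  have h1 := ((H.smooth_s x hx).differentiableAt (by simp)).hasFDerivAt
  have h2 := ((H.smooth_c x hx).differentiableAt (by simp)).hasFDerivAt
  have h3 := ((h1.const_mul 2).mul h2).mul (((h1.pow 2).const_mul 3).sub ((h2.pow 2).const_mul 2))
  have h4 : HasFDerivAt (fun y => slope (s y) (c y)) _ x := h3
  rw [h4.fderiv]
  simp [H.deriv_s x hx, H.deriv_c x hx]
  ring

theorem smooth_slope (H : HopfForms U s c μ η κ₁ κ₂ γ₁ γ₂ θ χ e₁ e₂) {x : V} (hx : x ∈ U) :
    ContDiffAt ℝ ∞ (fun y => slope (s y) (c y)) x := by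
  have := H.smooth_s x hx
  have := H.smooth_c x hx
  unfold slope
  fun_prop

/-- The form `ψ₂ - μ κ₂ - γ₂` with `ψ₂ = - s c χ`. -/
theorem smooth_rest (H : HopfForms U s c μ η κ₁ κ₂ γ₁ γ₂ θ χ e₁ e₂) {x : V} (hx : x ∈ U) :
    SmoothFormAt (fun y Y => (-(s y * c y)) * χ y Y - μ y * κ₂ y Y - γ₂ y Y) x :=
  ((SmoothFormAt.mul ((H.smooth_s x hx).mul (H.smooth_c x hx)).neg (H.smooth_χ x hx)).sub
    (SmoothFormAt.mul (H.smooth_μ x hx) (H.smooth_κ₂ x hx))).sub (H.smooth_γ₂ x hx)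

/-- The closedness of `dμ = m η + f κ₁`. -/
theorem closed_μ (H : HopfForms U s c μ η κ₁ κ₂ γ₁ γ₂ θ χ e₁ e₂) {m : V → ℝ}
    (hm : ∀ x ∈ U, ContDiffAt ℝ ∞ m x)
    (hμ : ∀ x ∈ U, ∀ Y, fderiv ℝ μ x Y = m x * η x Y + slope (s x) (c x) * κ₁ x Y)
    {x : V} (hx : x ∈ U) (X Y : V) :
    wedge (fun Z => fderiv ℝ m x Z) (η x) X Y + m x * extD η x X Y +
      (30 * s x ^ 2 * c x ^ 2 - 6 * s x ^ 4 - 4 * c x ^ 4) * wedge (θ x) (κ₁ x) X Y +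
      slope (s x) (c x) * extD κ₁ x X Y = 0 := by
  have h := extD_fderiv (H.smooth_μ x hx) X Y
  rw [extD_congr H.isOpen hx hμ, extD_add (SmoothFormAt.mul (hm x hx) (H.smooth_η x hx))
    (SmoothFormAt.mul (H.smooth_slope hx) (H.smooth_κ₁ x hx)), extD_mul (hm x hx) (H.smooth_η x hx),
    extD_mul (H.smooth_slope hx) (H.smooth_κ₁ x hx)] at h
  simp only [wedge, H.slope_hasFDerivAt hx] at h ⊢
  linear_combination h

/-- Contraction of `d²μ = 0` with `X 0`. Again `dη` drops out, and the second summand is `slope`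
times the contraction of `dκ₁`. -/
theorem exists_deriv_m (H : HopfForms U s c μ η κ₁ κ₂ γ₁ γ₂ θ χ e₁ e₂) {m : V → ℝ}
    (hm : ∀ x ∈ U, ContDiffAt ℝ ∞ m x)
    (hμ : ∀ x ∈ U, ∀ Y, fderiv ℝ μ x Y = m x * η x Y + slope (s x) (c x) * κ₁ x Y) :
    ∃ n : V → ℝ, (∀ x ∈ U, ContDiffAt ℝ ∞ n x) ∧
      ∀ x ∈ U, ∀ Y, fderiv ℝ m x Y = n x * η x Y +
        slope (s x) (c x) * ((-(s x * c x)) * χ x Y - μ x * κ₂ x Y - γ₂ x Y) := by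
  refine exists_smooth_coeff H.isOpen (fun x hx => smoothFormAt_fderiv (hm x hx))
    H.smooth_η (fun x hx => SmoothFormAt.mul (H.smooth_slope hx) (H.smooth_rest hx))
    (fun x hx => ?_) fun x hx => ?_
  · obtain ⟨X, hX⟩ := H.coframe x hx
    exact ⟨X 0, by simp [hX.apply_η]⟩
  · obtain ⟨X, hX⟩ := H.coframe x hx
    obtain ⟨t0, k0, u0, v0⟩ := H.eq_zero_of_dual hx hX
    refine ⟨fderiv ℝ m x (X 0), fun Y => ?_⟩
    have h := H.closed_μ hm hμ hx (X 0) Y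
    rw [H.ext_η x hx, H.ext_κ₁ x hx] at h
    simp only [wedge, hX.apply_η, hX.apply_κ₁, hX.apply_κ₂, hX.apply_γ₁, hX.apply_γ₂, t0, k0, u0, v0] at h
    simp at h
    linear_combination -h

/-- The component of the closedness of `dm` along a pair of vectors annihilated by `η` and `dη`. -/
theorem closed_m (H : HopfForms U s c μ η κ₁ κ₂ γ₁ γ₂ θ χ e₁ e₂) {m n : V → ℝ}
    (hm : ∀ x ∈ U, ContDiffAt ℝ ∞ m x) (hn : ∀ x ∈ U, ContDiffAt ℝ ∞ n x)
    (hμ : ∀ x ∈ U, ∀ Y, fderiv ℝ m x Y = n x * η x Y +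
        slope (s x) (c x) * ((-(s x * c x)) * χ x Y - μ x * κ₂ x Y - γ₂ x Y))
    {x : V} (hx : x ∈ U) (X Y : V) (hX : η x X = 0) (hY : η x Y = 0) (hXY : extD η x X Y = 0) :
    (30 * s x ^ 2 * c x ^ 2 - 6 * s x ^ 4 - 4 * c x ^ 4) *
      wedge (θ x) (fun Z => (-(s x * c x)) * χ x Z - μ x * κ₂ x Z - γ₂ x Z) X Y +
      slope (s x) (c x) * (-(c x ^ 2 - s x ^ 2) * wedge (θ x) (χ x) X Y - s x * c x * extD χ x X Y -
        wedge (fun Z => fderiv ℝ μ x Z) (κ₂ x) X Y - μ x * extD κ₂ x X Y - extD γ₂ x X Y) = 0 := by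
  have h := extD_fderiv (hm x hx) X Y
  have g1 : ContDiffAt ℝ ∞ (fun y => -(s y * c y)) x :=
    ((H.smooth_s x hx).mul (H.smooth_c x hx)).neg
  have f1 := SmoothFormAt.mul g1 (H.smooth_χ x hx)
  have f2 := SmoothFormAt.mul (H.smooth_μ x hx) (H.smooth_κ₂ x hx)
  rw [extD_congr H.isOpen hx hμ, extD_add (SmoothFormAt.mul (hn x hx) (H.smooth_η x hx))
    (SmoothFormAt.mul (H.smooth_slope hx) (H.smooth_rest hx)), extD_mul (hn x hx) (H.smooth_η x hx),
    extD_mul (H.smooth_slope hx) (H.smooth_rest hx), extD_sub (f1.sub f2) (H.smooth_γ₂ x hx),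
    extD_sub f1 f2, extD_mul g1 (H.smooth_χ x hx),
    extD_mul (H.smooth_μ x hx) (H.smooth_κ₂ x hx), hXY] at h
  have g2 : ∀ Z, fderiv ℝ (fun y => -(s y * c y)) x Z = -(c x ^ 2 - s x ^ 2) * θ x Z := fun Z => by
    have h1 := ((H.smooth_s x hx).differentiableAt (by simp)).hasFDerivAt
    have h2 := ((H.smooth_c x hx).differentiableAt (by simp)).hasFDerivAt
    have h4 : HasFDerivAt (fun y => -(s y * c y)) _ x := (h1.mul h2).neg
    rw [h4.fderiv]
    simp [H.deriv_s x hx, H.deriv_c x hx]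
    ring
  simp only [wedge, H.slope_hasFDerivAt hx, g2, hX, hY] at h ⊢
  linear_combination h

end HopfForms


namespace HopfForms

variable {V : Type*} [NormedAddCommGroup V] [NormedSpace ℝ V] {U : Set V}
    {s c μ : V → ℝ} {η κ₁ κ₂ γ₁ γ₂ θ χ e₁ e₂ : V → V → ℝ}

/-- The symmetry relations of the shape operator. -/
theorem symm_relations (H : HopfForms U s c μ η κ₁ κ₂ γ₁ γ₂ θ χ e₁ e₂) {x : V} (hx : x ∈ U)
    {X : Fin 5 → V} (hX : IsDualFrame (η x) (κ₁ x) (κ₂ x) (γ₁ x) (γ₂ x) X) :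
    -θ x (X 2) + s x * c x * χ x (X 1) = 0 ∧ -θ x (X 3) + c x * e₁ x (X 1) - 1 = 0 ∧
    -θ x (X 4) - c x * e₂ x (X 1) = 0 ∧ -(s x * c x * χ x (X 3)) + c x * e₁ x (X 2) = 0 ∧
    -(s x * c x * χ x (X 4)) - c x * e₂ x (X 2) + 1 = 0 ∧
    -(c x * e₁ x (X 4)) - c x * e₂ x (X 3) = 0 := by
  have h := fun i j => H.normal x hx (X i) (X j)
  simp only [wedge, hX.apply_κ₁, hX.apply_κ₂, hX.apply_γ₁, hX.apply_γ₂] at h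
  have h12 := h 1 2
  have h13 := h 1 3
  have h14 := h 1 4
  have h23 := h 2 3
  have h24 := h 2 4
  have h34 := h 3 4
  simp at h12 h13 h14 h23 h24 h34
  refine ⟨?_, ?_, ?_, ?_, ?_, ?_⟩ <;> linarith

/-- The components of `d²μ = 0` transversal to the structure vector. -/
theorem closed_relations (H : HopfForms U s c μ η κ₁ κ₂ γ₁ γ₂ θ χ e₁ e₂) {m : V → ℝ}
    (hm : ∀ x ∈ U, ContDiffAt ℝ ∞ m x)
    (hμ : ∀ x ∈ U, ∀ Y, fderiv ℝ μ x Y = m x * η x Y + slope (s x) (c x) * κ₁ x Y)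
    {x : V} (hx : x ∈ U)
    {X : Fin 5 → V} (hX : IsDualFrame (η x) (κ₁ x) (κ₂ x) (γ₁ x) (γ₂ x) X) :
    m x * (s x * c x * χ x (X 3) - θ x (X 4)) -
        (26 * s x ^ 2 * c x ^ 2 - 4 * c x ^ 4) * θ x (X 3) -
        s x ^ 2 * (6 * s x ^ 2 - 4 * c x ^ 2) = 0 ∧
    m x * (s x * c x * χ x (X 3) - θ x (X 4)) -
        c x ^ 2 * (6 * s x ^ 2 - 4 * c x ^ 2) * (s x * c x * χ x (X 4)) +
        s x ^ 2 * (6 * s x ^ 2 - 4 * c x ^ 2) = 0 ∧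
    m x * (θ x (X 3) + s x * c x * χ x (X 4) + 2) -
        (26 * s x ^ 2 * c x ^ 2 - 4 * c x ^ 4) * θ x (X 4) = 0 ∧
    -m x * (θ x (X 3) + s x * c x * χ x (X 4) - 2) -
        c x ^ 2 * (6 * s x ^ 2 - 4 * c x ^ 2) * (s x * c x * χ x (X 3)) = 0 ∧
    m x * (e₁ x (X 3) - e₂ x (X 4)) = 0 := by
  obtain ⟨-, i13, i14, i23, i24, i34⟩ := H.symm_relations hx hX
  -- The symmetry relations serve to replace the values of `e₁` and `e₂` by those of `θ` and `χ`.
  have h := fun i j => H.closed_μ hm hμ hx (X i) (X j)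
  simp only [H.ext_η x hx, H.ext_κ₁ x hx, wedge, hX.apply_η, hX.apply_κ₁, hX.apply_κ₂, hX.apply_γ₁,
    hX.apply_γ₂, slope] at h
  have h13 := h 1 3
  have h14 := h 1 4
  have h23 := h 2 3
  have h24 := h 2 4
  have h34 := h 3 4
  simp at h13 h14 h23 h24 h34
  have hc := H.c_pos x hx
  refine ⟨?_, ?_, ?_, ?_, ?_⟩
  · linear_combination h13 + m x * i14 + 2 * s x ^ 2 * (3 * s x ^ 2 - 2 * c x ^ 2) * i13
  · linear_combination h24 - m x * i23 + 2 * s x ^ 2 * (3 * s x ^ 2 - 2 * c x ^ 2) * i24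
  · linear_combination h14 - m x * i13 + 2 * s x ^ 2 * (3 * s x ^ 2 - 2 * c x ^ 2) * i14
  · linear_combination h23 + m x * i24 + 2 * s x ^ 2 * (3 * s x ^ 2 - 2 * c x ^ 2) * i23
  · apply mul_left_cancel₀ hc.ne'
    linear_combination h34 + 2 * s x ^ 2 * (3 * s x ^ 2 - 2 * c x ^ 2) * i34

/-- This is `d²m = 0` on the pair `X 3, X 4`. For `m ≠ 0` the last closedness relation makes `dη`
vanish on that pair, so neither `n` nor its differential enters; the equation for `d(μη)` on the
same pair removes the product of the values of `e₁` and `e₂`. -/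
theorem star_relation (H : HopfForms U s c μ η κ₁ κ₂ γ₁ γ₂ θ χ e₁ e₂) {m n : V → ℝ}
    (hm : ∀ x ∈ U, ContDiffAt ℝ ∞ m x) (hn : ∀ x ∈ U, ContDiffAt ℝ ∞ n x)
    (hμ : ∀ x ∈ U, ∀ Y, fderiv ℝ μ x Y = m x * η x Y + slope (s x) (c x) * κ₁ x Y)
    (hm' : ∀ x ∈ U, ∀ Y, fderiv ℝ m x Y = n x * η x Y +
        slope (s x) (c x) * ((-(s x * c x)) * χ x Y - μ x * κ₂ x Y - γ₂ x Y))
    {x : V} (hx : x ∈ U) (hmx : m x ≠ 0)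
    {X : Fin 5 → V} (hX : IsDualFrame (η x) (κ₁ x) (κ₂ x) (γ₁ x) (γ₂ x) X) :
    2 * (4 * s x ^ 2 - c x ^ 2) * c x ^ 4 * (θ x (X 3) * (s x * c x * χ x (X 4)) -
      θ x (X 4) * (s x * c x * χ x (X 3))) + 5 * s x ^ 4 * c x ^ 2 * θ x (X 3) +
      s x ^ 4 * (3 * s x ^ 2 - 2 * c x ^ 2) = 0 := by
  obtain ⟨-, i13, i14, i23, i24, i34⟩ := H.symm_relations hx hX
  obtain ⟨r13, r24, -, -, r34⟩ := H.closed_relations hm hμ hx hX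
  have hc := H.c_pos x hx
  have hsc := H.sq_add_sq x hx
  have r : e₁ x (X 3) - e₂ x (X 4) = 0 := (mul_eq_zero.1 r34).resolve_left hmx
  have hη : extD η x (X 3) (X 4) = 0 := by
    rw [H.ext_η x hx]
    simp only [wedge, hX.apply_κ₁, hX.apply_κ₂, hX.apply_γ₁, hX.apply_γ₂]
    simp
    linear_combination c x * r
  have h1 := H.closed_m hm hn hm' hx (X 3) (X 4) (by simp [hX.apply_η]) (by simp [hX.apply_η]) hη
  have h2 := H.ext_μη x hx (X 3) (X 4)
  rw [extD_mul (H.smooth_μ x hx) (H.smooth_η x hx), hη] at h2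
  simp only [H.ext_χ x hx, H.ext_κ₂ x hx, H.ext_γ₂ x hx, hμ x hx, wedge, hX.apply_η, hX.apply_κ₁,
    hX.apply_κ₂, hX.apply_γ₁, hX.apply_γ₂, slope] at h1 h2
  simp at h1 h2
  linear_combination -1 / 4 * (c x ^ 2 * h1 -
    2 * s x ^ 2 * c x ^ 2 * (3 * s x ^ 2 - 2 * c x ^ 2) * h2 - (c x ^ 2 - s x ^ 2) * (r13 - r24) -
    2 * s x ^ 2 * c x ^ 3 * (3 * s x ^ 2 - 2 * c x ^ 2) * μ x * r +
    2 * s x ^ 2 * c x ^ 2 * (6 * s x ^ 2 - 4 * c x ^ 2) * hsc)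


theorem slope_eq_zero_iff (H : HopfForms U s c μ η κ₁ κ₂ γ₁ γ₂ θ χ e₁ e₂) {x : V} (hx : x ∈ U) :
    slope (s x) (c x) = 0 ↔ 3 * s x ^ 2 - 2 * c x ^ 2 = 0 := by
  have := H.s_pos x hx
  have := H.c_pos x hx
  simp [slope, this.ne', (H.s_pos x hx).ne']

/-- The relations between the normalized entries of the shape operator. -/
theorem pairing_relations (H : HopfForms U s c μ η κ₁ κ₂ γ₁ γ₂ θ χ e₁ e₂) {m n : V → ℝ}
    (hm : ∀ x ∈ U, ContDiffAt ℝ ∞ m x) (hn : ∀ x ∈ U, ContDiffAt ℝ ∞ n x)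
    (hμ : ∀ x ∈ U, ∀ Y, fderiv ℝ μ x Y = m x * η x Y + slope (s x) (c x) * κ₁ x Y)
    (hm' : ∀ x ∈ U, ∀ Y, fderiv ℝ m x Y = n x * η x Y +
        slope (s x) (c x) * ((-(s x * c x)) * χ x Y - μ x * κ₂ x Y - γ₂ x Y))
    {x : V} (hx : x ∈ U) (hmx : m x ≠ 0) (hf : slope (s x) (c x) ≠ 0)
    {X : Fin 5 → V} (hX : IsDualFrame (η x) (κ₁ x) (κ₂ x) (γ₁ x) (γ₂ x) X)
    {T h a b p q : ℝ} (hT : T = s x ^ 2 / c x ^ 2) (hh : h = m x / c x ^ 4) (ha : a = θ x (X 3))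
    (hb : b = s x * c x * χ x (X 4)) (hp : p = θ x (X 4)) (hq : q = s x * c x * χ x (X 3)) :
    0 < T ∧ h ≠ 0 ∧ 6 * T - 4 ≠ 0 ∧
    h * (q - p) - (26 * T - 4) * a - T * (6 * T - 4) = 0 ∧
    h * (q - p) - (6 * T - 4) * b + T * (6 * T - 4) = 0 ∧
    h * (a + b + 2) - (26 * T - 4) * p = 0 ∧ -h * (a + b - 2) - (6 * T - 4) * q = 0 ∧
    2 * (4 * T - 1) * (a * b - p * q) + 5 * T ^ 2 * a + T ^ 2 * (3 * T - 2) = 0 := by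
  obtain ⟨r13, r24, r14, r23, -⟩ := H.closed_relations hm hμ hx hX
  have rs := H.star_relation hm hn hμ hm' hx hmx hX
  have hs := H.s_pos x hx
  have hc := H.c_pos x hx
  rw [ne_eq, H.slope_eq_zero_iff hx] at hf
  rw [← ha, ← hb, ← hp, ← hq] at *
  have hT' : s x ^ 2 = T * c x ^ 2 := by rw [hT]; field_simp
  have hh' : m x = h * c x ^ 4 := by rw [hh]; field_simp
  have h4 : s x ^ 4 = T ^ 2 * c x ^ 4 := by linear_combination (s x ^ 2 + T * c x ^ 2) * hT'
  rw [hT', hh'] at r13 r24 r14 r23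
  rw [hT', h4] at rs
  rw [hT'] at hf
  refine ⟨by rw [hT]; positivity, by rw [hh]; positivity, fun h0 => hf ?_, ?_, ?_, ?_, ?_, ?_⟩
  · linear_combination c x ^ 2 / 2 * h0
  -- With `s² = T c²` and `m = h c⁴` the linear relations are homogeneous of degree 4 in `(s, c)`,
  -- and the quadratic one is of degree 6.
  · apply mul_left_cancel₀ (pow_ne_zero 4 hc.ne')
    linear_combination r13
  · apply mul_left_cancel₀ (pow_ne_zero 4 hc.ne')
    linear_combination r24
  · apply mul_left_cancel₀ (pow_ne_zero 4 hc.ne')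
    linear_combination r14
  · apply mul_left_cancel₀ (pow_ne_zero 4 hc.ne')
    linear_combination r23
  · apply mul_left_cancel₀ (pow_ne_zero 6 hc.ne')
    linear_combination rs

/-- The elimination holds on the whole open set and expresses `m²` through the angle.
Differentiating this makes `dm` a multiple of `θ`; comparison with the known shape of `dm` yields
the extra relation that the algebra excludes. -/
theorem false_of_ne_zero (H : HopfForms U s c μ η κ₁ κ₂ γ₁ γ₂ θ χ e₁ e₂) {m n : V → ℝ}
    (hm : ∀ x ∈ U, ContDiffAt ℝ ∞ m x) (hn : ∀ x ∈ U, ContDiffAt ℝ ∞ n x)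
    (hμ : ∀ x ∈ U, ∀ Y, fderiv ℝ μ x Y = m x * η x Y + slope (s x) (c x) * κ₁ x Y)
    (hm' : ∀ x ∈ U, ∀ Y, fderiv ℝ m x Y = n x * η x Y +
        slope (s x) (c x) * ((-(s x * c x)) * χ x Y - μ x * κ₂ x Y - γ₂ x Y))
    (hmx : ∀ x ∈ U, m x ≠ 0) (hf : ∀ x ∈ U, slope (s x) (c x) ≠ 0) {x : V} (hx : x ∈ U) :
    False := by
  have hrel : ∀ y ∈ U, 2 * (4 * s y ^ 2 - c y ^ 2) * m y ^ 2 = c y ^ 2 * (3 * s y ^ 2 - 2 * c y ^ 2) *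
      (25 * s y ^ 6 - 104 * s y ^ 4 * c y ^ 2 + 42 * s y ^ 2 * c y ^ 4 - 4 * c y ^ 6) := by
    intro y hy
    obtain ⟨X, hX⟩ := H.coframe y hy
    obtain ⟨p1, p2, p3, p4, p5, p6, p7, p8⟩ :=
      H.pairing_relations hm hn hμ hm' hy (hmx y hy) (hf y hy) hX rfl rfl rfl rfl rfl rfl
    have := sq_mul_eq_of_pairing_relations p1 p2 p3 p4 p5 p6 p7 p8
    have hc := H.c_pos y hy
    field_simp at this
    linear_combination this
  obtain ⟨X, hX⟩ := H.coframe x hx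
  obtain ⟨p1, p2, p3, p4, p5, p6, p7, p8⟩ :=
    H.pairing_relations hm hn hμ hm' hx (hmx x hx) (hf x hx) hX rfl rfl rfl rfl rfl rfl
  have hH := sq_mul_eq_of_pairing_relations p1 p2 p3 p4 p5 p6 p7 p8
  have hs := H.s_pos x hx
  have hc := H.c_pos x hx
  refine false_of_pairing_relations p1 p2 p3 p4 p5 p6 p7 p8 hH ?_
  -- The coefficient of `m²` is nonzero: for `4 s² = c²` the right side of `hrel` would be a nonzero
  -- multiple of `c¹⁰`.
  have h41 : 4 * s x ^ 2 - c x ^ 2 ≠ 0 := by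
    intro h0
    have h1 : s x ^ 2 = 1 / 4 * c x ^ 2 := by linarith
    have h2 : s x ^ 4 = 1 / 16 * c x ^ 4 := by
      linear_combination (s x ^ 2 + 1 / 4 * c x ^ 2) * h1
    have h3 : s x ^ 6 = 1 / 64 * c x ^ 6 := by
      linear_combination s x ^ 2 * h2 + 1 / 16 * c x ^ 4 * h1
    have h4 := hrel x hx
    rw [h0, h1, h2, h3] at h4
    have : 0 < c x ^ 10 := by positivity
    linarith
  have h1 := ((H.smooth_s x hx).differentiableAt (by simp)).hasFDerivAt
  have h2 := ((H.smooth_c x hx).differentiableAt (by simp)).hasFDerivAt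
  have h3 := ((hm x hx).differentiableAt (by simp)).hasFDerivAt
  let φ : ℝ × ℝ → ℝ := fun p => p.2 ^ 2 * (3 * p.1 ^ 2 - 2 * p.2 ^ 2) *
      (25 * p.1 ^ 6 - 104 * p.1 ^ 4 * p.2 ^ 2 + 42 * p.1 ^ 2 * p.2 ^ 4 - 4 * p.2 ^ 6)
  have hφ : DifferentiableAt ℝ φ (s x, c x) := by fun_prop
  have d1 := hφ.hasFDerivAt.comp x (h1.prodMk h2)
  have d2 := (((h1.pow 2).const_mul 4).sub (h2.pow 2)).const_mul 2 |>.mul (h3.pow 2)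
  have e : ((fun y => 2 * (4 * s y ^ 2 - c y ^ 2)) * fun y => m y ^ 2) =ᶠ[nhds x]
      φ ∘ fun y => (s y, c y) := by
    filter_upwards [H.isOpen.mem_nhds hx] with y hy using hrel y hy
  have d3 := (d1.congr_of_eventuallyEq e).unique d2
  -- Both `ds` and `dc` are multiples of `θ`, hence so is the differential of any function of `(s,
  -- c)`.
  obtain ⟨ρ, hρ⟩ : ∃ ρ, ∀ Y, 4 * (4 * s x ^ 2 - c x ^ 2) * m x * fderiv ℝ m x Y = ρ * θ x Y := by
    refine ⟨fderiv ℝ φ (s x, c x) (c x, -s x) - 20 * s x * c x * m x ^ 2, fun Y => ?_⟩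
    have h5 := DFunLike.congr_fun d3 Y
    have h6 : (fderiv ℝ s x Y, fderiv ℝ c x Y) = θ x Y • (c x, -s x) := by
      rw [H.deriv_s x hx, H.deriv_c x hx]
      ext <;> simp [mul_comm]
    have h7 : fderiv ℝ φ (s x, c x) (fderiv ℝ s x Y, fderiv ℝ c x Y) =
        θ x Y * fderiv ℝ φ (s x, c x) (c x, -s x) := by
      rw [h6, map_smul, smul_eq_mul]
    simp at h5
    rw [h7] at h5
    simp [H.deriv_s x hx, H.deriv_c x hx] at h5
    linear_combination -h5
  have k3 := hρ (X 3)
  have k4 := hρ (X 4)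
  rw [hm' x hx] at k3 k4
  simp [hX.apply_η, hX.apply_κ₂, hX.apply_γ₂] at k3 k4
  have hK : 4 * (4 * s x ^ 2 - c x ^ 2) * m x * slope (s x) (c x) ≠ 0 :=
    mul_ne_zero (mul_ne_zero (mul_ne_zero (by norm_num) h41) (hmx x hx)) (hf x hx)
  apply mul_left_cancel₀ hK
  -- Cross-multiplying the two proportionalities eliminates `ρ`.
  linear_combination -θ x (X 4) * k3 + θ x (X 3) * k4

/-- If `m` vanishes on an open set then `dm = 0`; its value at `X 4` gives `s c χ(X 4) = -1`. The
`(2, 4)` component of `d²μ = 0` then forces `slope` to vanish. -/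
theorem false_of_eq_zero (H : HopfForms U s c μ η κ₁ κ₂ γ₁ γ₂ θ χ e₁ e₂) {m n : V → ℝ}
    (hm : ∀ x ∈ U, ContDiffAt ℝ ∞ m x)
    (hμ : ∀ x ∈ U, ∀ Y, fderiv ℝ μ x Y = m x * η x Y + slope (s x) (c x) * κ₁ x Y)
    (hm' : ∀ x ∈ U, ∀ Y, fderiv ℝ m x Y = n x * η x Y +
        slope (s x) (c x) * ((-(s x * c x)) * χ x Y - μ x * κ₂ x Y - γ₂ x Y))
    (hmx : ∀ x ∈ U, m x = 0) (hf : ∀ x ∈ U, slope (s x) (c x) ≠ 0) {x : V} (hx : x ∈ U) :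
    False := by
  obtain ⟨X, hX⟩ := H.coframe x hx
  obtain ⟨-, r24, -, -, -⟩ := H.closed_relations hm hμ hx hX
  have hs := H.s_pos x hx
  have hc := H.c_pos x hx
  have hm0 : fderiv ℝ m x = 0 := by
    have e : m =ᶠ[nhds x] fun _ => 0 := by
      filter_upwards [H.isOpen.mem_nhds hx] with y hy using hmx y hy
    rw [e.fderiv_eq]
    simp
  have h4 := hm' x hx (X 4)
  rw [hm0] at h4
  simp [hX.apply_η, hX.apply_κ₂, hX.apply_γ₂, hf x hx] at h4
  have hb : s x * c x * χ x (X 4) = -1 := by linarith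
  have hf' := hf x hx
  rw [ne_eq, H.slope_eq_zero_iff hx] at hf'
  rw [hb, hmx x hx] at r24
  have : (3 * s x ^ 2 - 2 * c x ^ 2) * (s x ^ 2 + c x ^ 2) = 0 := by linarith
  rcases mul_eq_zero.1 this with h | h
  · exact hf' h
  · have := H.sq_add_sq x hx
    linarith

/-! ### The exceptional constant angle, with `tan² = 2/3`. -/

theorem constant_of_slope_eq_zero (H : HopfForms U s c μ η κ₁ κ₂ γ₁ γ₂ θ χ e₁ e₂) {m : V → ℝ}
    (hm : ∀ x ∈ U, ContDiffAt ℝ ∞ m x)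
    (hμ : ∀ x ∈ U, ∀ Y, fderiv ℝ μ x Y = m x * η x Y + slope (s x) (c x) * κ₁ x Y)
    (hf : ∀ x ∈ U, slope (s x) (c x) = 0) :
    (∀ y ∈ U, s y ^ 2 = 2 / 5) ∧ (∀ y ∈ U, c y ^ 2 = 3 / 5) ∧
      (∀ y ∈ U, ∀ Y, θ y Y = 0) ∧ ∀ y ∈ U, ∀ Y, fderiv ℝ μ y Y = 0 := by
  have hs2 : ∀ y ∈ U, s y ^ 2 = 2 / 5 := fun y hy => by
    have := (H.slope_eq_zero_iff hy).1 (hf y hy)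
    have := H.sq_add_sq y hy
    linarith
  have hc2 : ∀ y ∈ U, c y ^ 2 = 3 / 5 := fun y hy => by
    have := H.sq_add_sq y hy
    linarith [hs2 y hy]
  have hθ : ∀ y ∈ U, ∀ Y, θ y Y = 0 := fun y hy Y => by
    have h1 := ((H.smooth_s y hy).differentiableAt (by simp)).hasFDerivAt
    have e : (s ^ 2) =ᶠ[nhds y] fun _ => 2 / 5 := by
      filter_upwards [H.isOpen.mem_nhds hy] with z hz using hs2 z hz
    have h2 := DFunLike.congr_fun ((h1.pow 2).unique
      ((hasFDerivAt_const (2 / 5 : ℝ) y).congr_of_eventuallyEq e)) Y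
    simp [H.deriv_s y hy, (H.s_pos y hy).ne', (H.c_pos y hy).ne'] at h2
    exact h2
  -- With `θ = 0` and `3 s² = 2 c²` the two relations read `m (b + 2) = 0` and `m (b - 2) = 0` for
  -- `b = s c χ(X 4)`.
  have hm0 : ∀ y ∈ U, m y = 0 := fun y hy => by
    obtain ⟨X, hX⟩ := H.coframe y hy
    obtain ⟨-, -, r14, r23, -⟩ := H.closed_relations hm hμ hy hX
    have e4 : c y ^ 4 = 9 / 25 := by linear_combination (c y ^ 2 + 3 / 5) * hc2 y hy
    rw [hθ y hy, hs2 y hy, hc2 y hy] at r23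
    rw [hθ y hy, hθ y hy, hs2 y hy, hc2 y hy, e4] at r14
    linarith
  have hμ0 : ∀ y ∈ U, ∀ Y, fderiv ℝ μ y Y = 0 := fun y hy Y => by
    rw [hμ y hy, hm0 y hy, hf y hy]
    simp
  exact ⟨hs2, hc2, hθ, hμ0⟩

/-- Since `dμ = 0` and `θ = 0`, the equation for `d(μη)` becomes purely algebraic. Together with the
symmetry relations it expresses the remaining values of `χ`, and that of `e₂` at `X 4`, through `μ`.
-/
theorem entries_of_slope_eq_zero (H : HopfForms U s c μ η κ₁ κ₂ γ₁ γ₂ θ χ e₁ e₂) {m : V → ℝ}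
    (hm : ∀ x ∈ U, ContDiffAt ℝ ∞ m x)
    (hμ : ∀ x ∈ U, ∀ Y, fderiv ℝ μ x Y = m x * η x Y + slope (s x) (c x) * κ₁ x Y)
    (hf : ∀ x ∈ U, slope (s x) (c x) = 0) :
    ∀ y ∈ U, ∀ X, IsDualFrame (η y) (κ₁ y) (κ₂ y) (γ₁ y) (γ₂ y) X → μ y ≠ 0 ∧
      4 / 5 - μ y ^ 2 ≠ 0 ∧ s y * c y * χ y (X 4) * (4 / 5 - μ y ^ 2) = 4 / 5 ∧
      s y * c y * χ y (X 2) * μ y = 2 * (6 / 5 - s y * c y * χ y (X 4)) ∧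
      χ y (X 1) = 0 ∧ χ y (X 3) = 0 ∧
      c y * e₂ y (X 4) = μ y * (s y * c y * χ y (X 4) + 2) / 2 := by
  obtain ⟨hs2, hc2, hθ, hμ0⟩ := H.constant_of_slope_eq_zero hm hμ hf
  intro y hy X hX
  have hs := H.s_pos y hy
  have hc := H.c_pos y hy
  obtain ⟨i12, i13, i14, i23, i24, i34⟩ := H.symm_relations hy hX
  simp only [hθ y hy] at i12 i13 i14
  have h := fun i j => H.ext_μη y hy (X i) (X j)
  simp only [extD_mul (H.smooth_μ y hy) (H.smooth_η y hy), H.ext_η y hy, wedge, hμ0 y hy,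
    hθ y hy, hX.apply_η, hX.apply_κ₁, hX.apply_κ₂, hX.apply_γ₁, hX.apply_γ₂] at h
  have h12 := h 1 2
  have h13 := h 1 3
  have h14 := h 1 4
  have h23 := h 2 3
  have h24 := h 2 4
  have h34 := h 3 4
  simp at h12 h13 h14 h23 h24 h34
  have hs4 : s y ^ 4 = 4 / 25 := by linear_combination (s y ^ 2 + 2 / 5) * hs2 y hy
  have hc4 : c y ^ 4 = 9 / 25 := by linear_combination (c y ^ 2 + 3 / 5) * hc2 y hy
  have k1 : χ y (X 1) = 0 := by
    have : s y * c y * χ y (X 1) = 0 := by linarith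
    exact (mul_eq_zero.1 this).resolve_left (by positivity)
  set b := s y * c y * χ y (X 4) with hb
  set g := s y * c y * χ y (X 2) with hg
  set q := s y * c y * χ y (X 3) with hq
  set u1 := c y * e₁ y (X 1) with hu1
  set v1 := c y * e₂ y (X 1) with hv1
  set u2 := c y * e₁ y (X 2) with hu2
  set v2 := c y * e₂ y (X 2) with hv2
  set u3 := c y * e₁ y (X 3) with hu3
  set v3 := c y * e₂ y (X 3) with hv3
  set u4 := c y * e₁ y (X 4) with hu4
  set v4 := c y * e₂ y (X 4) with hv4
  have g12 : μ y * g = 2 * (u1 * v2 - u2 * v1) + 2 / 5 := by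
    rw [hs4, hc4] at h12
    have e : s y ^ 2 * c y ^ 2 = 6 / 25 := by rw [hs2 y hy, hc2 y hy]; norm_num
    linear_combination h12 + 6 * e
  have g13 : μ y * (q + v1) = 2 * (u1 * v3 - u3 * v1) := by linear_combination h13
  have g14 : μ y * (b + u1 + 1) = 2 * (u1 * v4 - u4 * v1) := by linear_combination h14
  have g23 : μ y * (1 + v2) = 2 * (u2 * v3 - u3 * v2) := by linear_combination h23
  have g24 : μ y * u2 = 2 * (u2 * v4 - u4 * v2) := by linear_combination h24
  have g34 : μ y * (u3 - v4) = 2 * (u3 * v4 - u4 * v3) - 4 / 5 := by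
    linear_combination h34 - 2 * hs2 y hy
  have a1 : u1 = 1 := by linarith
  have a2 : v1 = 0 := by linarith
  have a3 : u2 = q := by linarith
  have a4 : v2 = 1 - b := by linarith
  have a5 : u4 = -v3 := by linarith
  rw [a1, a2, a3, a4] at g12
  rw [a1, a2] at g13 
  rw [a1, a2] at g14
  rw [a3, a4] at g23
  rw [a3, a4, a5] at g24
  rw [a5] at g34
  have b3 : v3 = μ y * q / 2 := by linarith
  have b4 : v4 = μ y * (b + 2) / 2 := by linarith
  rw [b3, b4] at g24
  rw [b3, b4] at g34
  rw [b3] at g23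
  have hμq : μ y * q = 0 := by linear_combination -1 / 2 * g24
  -- For `μ = 0` both `v3` and `v4` vanish, and `g34` becomes `0 = -4/5`.
  have hμy : μ y ≠ 0 := fun h0 => by
    rw [h0] at g34
    norm_num at g34
  have q0 : q = 0 := (mul_eq_zero.1 hμq).resolve_left hμy
  rw [q0] at g23 g34 g12
  have hbμ : μ y ^ 2 * b = 4 / 5 * (b - 1) := by
    linear_combination (1 - b) * g34 + μ y * (b + 1) / 2 * g23
  refine ⟨hμy, fun h0 => ?_, by linear_combination -hbμ, by linear_combination g12, k1, ?_, b4⟩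
  · have : (4 / 5 : ℝ) = 0 := by linear_combination hbμ + b * h0
    norm_num at this
  · exact (mul_eq_zero.1 (hq ▸ q0 : s y * c y * χ y (X 3) = 0)).resolve_left (by positivity)

/-- The values of `χ` on the dual frame determine it. The point of this form is that the
coefficients are functions of `μ` only, hence locally constant, so it can be differentiated. -/
theorem chi_of_slope_eq_zero (H : HopfForms U s c μ η κ₁ κ₂ γ₁ γ₂ θ χ e₁ e₂) {m : V → ℝ}
    (hm : ∀ x ∈ U, ContDiffAt ℝ ∞ m x)
    (hμ : ∀ x ∈ U, ∀ Y, fderiv ℝ μ x Y = m x * η x Y + slope (s x) (c x) * κ₁ x Y)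
    (hf : ∀ x ∈ U, slope (s x) (c x) = 0) :
    ∀ y ∈ U, ∀ Y, s y * c y * χ y Y =
      2 * (6 / 5 - 4 / 5 / (4 / 5 - μ y ^ 2)) / μ y * κ₂ y Y +
        4 / 5 / (4 / 5 - μ y ^ 2) * γ₂ y Y := by
  have hd := H.entries_of_slope_eq_zero hm hμ hf
  intro y hy Y
  obtain ⟨X, hX⟩ := H.coframe y hy
  obtain ⟨d1, d2, d3, d4, d5, d6, -⟩ := hd y hy X hX
  obtain ⟨-, d0, -, -⟩ := H.eq_zero_of_dual hy hX
  have d3' := eq_div_of_mul_eq d2 d3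
  have d4' := eq_div_of_mul_eq d1 d4
  rw [d3'] at d4'
  have hl := H.linear_χ y hy
  conv_lhs => rw [hX.expand Y]
  simp only [hl.map_add, hl.map_smul, d0, d5, d6, smul_eq_mul]
  linear_combination κ₂ y Y * d4' + γ₂ y Y * d3'

/-- Two components of the differential of the preceding expression: `dχ` on one side, constant
coefficients times `dκ₂` and `dγ₂` on the other. -/
theorem closed_chi_of_slope_eq_zero (H : HopfForms U s c μ η κ₁ κ₂ γ₁ γ₂ θ χ e₁ e₂) {m : V → ℝ}
    (hm : ∀ x ∈ U, ContDiffAt ℝ ∞ m x)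
    (hμ : ∀ x ∈ U, ∀ Y, fderiv ℝ μ x Y = m x * η x Y + slope (s x) (c x) * κ₁ x Y)
    (hf : ∀ x ∈ U, slope (s x) (c x) = 0)
    {x : V} (hx : x ∈ U)
    {X : Fin 5 → V} (hX : IsDualFrame (η x) (κ₁ x) (κ₂ x) (γ₁ x) (γ₂ x) X) :
    s x * c x * (-(2 * (3 * c x ^ 2 - 2 * s x ^ 2)) +
        2 * (e₁ x (X 1) * e₂ x (X 2) - e₁ x (X 2) * e₂ x (X 1))) =
      -(s x * c x * χ x (X 2) * ((s x ^ 2 - c x ^ 2) * χ x (X 2))) +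
        s x * c x * χ x (X 4) * (s x * e₁ x (X 1) + s x * e₂ x (X 2)) ∧
    s x * c x * (2 * (e₁ x (X 1) * e₂ x (X 4) - e₁ x (X 4) * e₂ x (X 1))) =
      s x * c x * χ x (X 2) * (-((s x ^ 2 - c x ^ 2) * χ x (X 4)) - s x * e₁ x (X 1)) +
        s x * c x * χ x (X 4) * (s x * e₂ x (X 4)) := by
  obtain ⟨hs2, hc2, hθ, hμ0⟩ := H.constant_of_slope_eq_zero hm hμ hf
  have hd := H.entries_of_slope_eq_zero hm hμ hf
  have hχ := H.chi_of_slope_eq_zero hm hμ hf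
  obtain ⟨d1, d2, d3, d4, d5, d6, d7⟩ := hd x hx X hX
  have hs := H.s_pos x hx
  have hc := H.c_pos x hx
  have cB : ContDiffAt ℝ ∞ (fun z : ℝ => 4 / 5 / (4 / 5 - z ^ 2)) (μ x) :=
    contDiffAt_const.div (contDiffAt_const.sub (contDiffAt_id.pow 2)) d2
  have cS : ContDiffAt ℝ ∞ (fun z : ℝ => 2 * (6 / 5 - 4 / 5 / (4 / 5 - z ^ 2)) / z) (μ x) :=
    (contDiffAt_const.mul (contDiffAt_const.sub cB)).div contDiffAt_id d1
  -- Every smooth function of `μ` has zero differential because `dμ = 0`.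
  have dz : ∀ F : ℝ → ℝ, ContDiffAt ℝ ∞ F (μ x) → ∀ Y, fderiv ℝ (fun y => F (μ y)) x Y = 0 := by
    intro F hF Y
    have h1 := (hF.differentiableAt (by simp)).hasFDerivAt.comp x
      ((H.smooth_μ x hx).differentiableAt (by simp)).hasFDerivAt
    have h2 : HasFDerivAt (fun y => F (μ y)) _ x := h1
    rw [h2.fderiv]
    simp [hμ0 x hx]
  have cB' : ContDiffAt ℝ ∞ (fun y => 4 / 5 / (4 / 5 - μ y ^ 2)) x := by
    have := ContDiffAt.comp x cB (H.smooth_μ x hx)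
    exact this
  have cS' : ContDiffAt ℝ ∞ (fun y => 2 * (6 / 5 - 4 / 5 / (4 / 5 - μ y ^ 2)) / μ y) x := by
    have := ContDiffAt.comp x cS (H.smooth_μ x hx)
    exact this
  have zB := dz _ cB
  have zS := dz _ cS
  have csc : ContDiffAt ℝ ∞ (fun y => s y * c y) x := (H.smooth_s x hx).mul (H.smooth_c x hx)
  have zsc : ∀ Y, fderiv ℝ (fun y => s y * c y) x Y = 0 := fun Y => by
    have h1 := ((H.smooth_s x hx).differentiableAt (by simp)).hasFDerivAt
    have h2 := ((H.smooth_c x hx).differentiableAt (by simp)).hasFDerivAt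
    have h4 : HasFDerivAt (fun y => s y * c y) _ x := h1.mul h2
    rw [h4.fderiv]
    simp [H.deriv_s x hx, H.deriv_c x hx, hθ x hx]
  have h := fun i j => extD_congr H.isOpen hx hχ (X i) (X j)
  have d3' := eq_div_of_mul_eq d2 d3
  have d4' := eq_div_of_mul_eq d1 d4
  simp only [extD_mul csc (H.smooth_χ x hx), extD_add (SmoothFormAt.mul cS' (H.smooth_κ₂ x hx))
    (SmoothFormAt.mul cB' (H.smooth_γ₂ x hx)), extD_mul cS' (H.smooth_κ₂ x hx),
    extD_mul cB' (H.smooth_γ₂ x hx), zB, zS, zsc, H.ext_χ x hx, H.ext_κ₂ x hx, H.ext_γ₂ x hx,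
    hθ x hx, wedge, hX.apply_η, hX.apply_κ₁, hX.apply_κ₂, hX.apply_γ₁, hX.apply_γ₂, ← d3'] at h
  have h12 := h 1 2
  have h14 := h 1 4
  simp [d5] at h12 h14
  rw [← d4'] at h12 h14
  exact ⟨h12, h14⟩

theorem false_of_slope_eq_zero (H : HopfForms U s c μ η κ₁ κ₂ γ₁ γ₂ θ χ e₁ e₂) {m : V → ℝ}
    (hm : ∀ x ∈ U, ContDiffAt ℝ ∞ m x)
    (hμ : ∀ x ∈ U, ∀ Y, fderiv ℝ μ x Y = m x * η x Y + slope (s x) (c x) * κ₁ x Y)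
    (hf : ∀ x ∈ U, slope (s x) (c x) = 0) {x : V} (hx : x ∈ U) :
    False := by
  obtain ⟨hs2, hc2, hθ, -⟩ := H.constant_of_slope_eq_zero hm hμ hf
  obtain ⟨X, hX⟩ := H.coframe x hx
  obtain ⟨d1, d2, d3, d4, d5, d6, d7⟩ := H.entries_of_slope_eq_zero hm hμ hf x hx X hX
  obtain ⟨h12, h14⟩ := H.closed_chi_of_slope_eq_zero hm hμ hf hx hX
  obtain ⟨i12, i13, i14, i23, i24, i34⟩ := H.symm_relations hx hX
  simp only [hθ x hx] at i12 i13 i14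
  have a1 : c x * e₁ x (X 1) = 1 := by linarith
  have a2 : c x * e₂ x (X 1) = 0 := by linarith
  have a4 : c x * e₂ x (X 2) = 1 - s x * c x * χ x (X 4) := by linarith
  set b := s x * c x * χ x (X 4) with hb
  set g := s x * c x * χ x (X 2) with hg
  have f12 : 2 / 5 * (-6 / 5 + 2 * (1 - b)) = g ^ 2 / 5 + b * (2 / 5) * (2 - b) := by
    have e : s x ^ 2 * (c x ^ 2 * (-(2 * (3 * c x ^ 2 - 2 * s x ^ 2))) +
        2 * (c x * e₁ x (X 1) * (c x * e₂ x (X 2)) - c x * e₁ x (X 2) * (c x * e₂ x (X 1)))) =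
        g * (c x ^ 2 - s x ^ 2) * g + b * s x ^ 2 * (c x * e₁ x (X 1) + c x * e₂ x (X 2)) := by
      linear_combination s x * c x * h12 - g * (c x ^ 2 - s x ^ 2) * hg
    rw [a1, a2, a4, hs2 x hx, hc2 x hx] at e
    linear_combination e
  have f14 : 2 / 5 * (μ x * (b + 2)) = g * (b / 5 - 2 / 5) + b * (2 / 5) * (μ x * (b + 2) / 2) := by
    have e : s x ^ 2 * (2 * (c x * e₁ x (X 1) * (c x * e₂ x (X 4)) -
        c x * e₁ x (X 4) * (c x * e₂ x (X 1)))) =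
        g * ((c x ^ 2 - s x ^ 2) * b - s x ^ 2 * (c x * e₁ x (X 1))) +
          b * s x ^ 2 * (c x * e₂ x (X 4)) := by
      linear_combination s x * c x * h14 - g * (c x ^ 2 - s x ^ 2) * hb
    rw [a1, a2, d7, hs2 x hx, hc2 x hx] at e
    linear_combination e
  have hfac : (b - 2) * (g + μ x * (b + 2)) = 0 := by linear_combination -5 * f14
  -- For `b = 2` the left side of `f12` is negative and the right side is `g² / 5`. Otherwise `g =
  -- -μ (b + 2)`, and `d3`, `d4` leave besides `b = 2` only `b = 2/3`, for which `d3` gives `μ² =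
  -- -2/5`.
  rcases mul_eq_zero.1 hfac with h2 | h2
  · have hb2 : b = 2 := by linarith
    rw [hb2] at f12
    nlinarith [sq_nonneg g]
  · have h3 : (b - 2) * (3 * b - 2) = 0 := by
      linear_combination -5 / 2 * (b * (μ x * h2 - d4) + (b + 2) * d3)
    rcases mul_eq_zero.1 h3 with h4 | h4
    · have hb2 : b = 2 := by linarith
      rw [hb2] at f12
      nlinarith [sq_nonneg g]
    · have hb3 : b = 2 / 3 := by linarith
      rw [hb3] at d3
      nlinarith [sq_nonneg (μ x)]

/-- No hypersurface with Hopf structure vector has an adapted frame with angle in `(0, π / 2)`. -/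
theorem false_of_mem (H : HopfForms U s c μ η κ₁ κ₂ γ₁ γ₂ θ χ e₁ e₂) {x : V} (hx : x ∈ U) :
    False := by
  obtain ⟨m, hm, hμ⟩ := H.exists_deriv_μ
  obtain ⟨n, hn, hm'⟩ := H.exists_deriv_m hm hμ
  -- Nonvanishing is an open condition, so each alternative holds on a nonempty open set and can be
  -- differentiated there.
  by_cases h1 : ∃ y ∈ U, slope (s y) (c y) ≠ 0
  · obtain ⟨y, hy, hfy⟩ := h1
    have ev1 := (H.smooth_slope hy).continuousAt.eventually_ne hfy
    obtain ⟨W, hW, hWo, hyW⟩ := eventually_nhds_iff.1 (ev1.and (H.isOpen.mem_nhds hy))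
    have H1 := H.mono hWo fun z hz => (hW z hz).2
    by_cases h2 : ∃ z ∈ W, m z ≠ 0
    · obtain ⟨z, hz, hmz⟩ := h2
      have ev2 := (hm z (hW z hz).2).continuousAt.eventually_ne hmz
      obtain ⟨W', hW', hWo', hzW⟩ := eventually_nhds_iff.1 (ev2.and (hWo.mem_nhds hz))
      have hU : ∀ w ∈ W', w ∈ U := fun w hw => (hW w (hW' w hw).2).2
      exact (H1.mono hWo' fun w hw => (hW' w hw).2).false_of_ne_zero
        (fun w hw => hm w (hU w hw)) (fun w hw => hn w (hU w hw)) (fun w hw => hμ w (hU w hw))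
        (fun w hw => hm' w (hU w hw)) (fun w hw => (hW' w hw).1)
        (fun w hw => (hW w (hW' w hw).2).1) hzW
    · push Not at h2
      exact H1.false_of_eq_zero (fun w hw => hm w (hW w hw).2) (fun w hw => hμ w (hW w hw).2)
        (fun w hw => hm' w (hW w hw).2) h2 (fun w hw => (hW w hw).1) hyW
  · push Not at h1
    exact H.false_of_slope_eq_zero hm hμ h1 hx

end HopfForms


/-! ### Quaternionic Hermitian algebra of `ℂ⁴`. -/

namespace CP3

theorem quatJ_add (u v : C4) : quatJ (u + v) = quatJ u + quatJ v := by
  funext i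
  fin_cases i <;> simp [quatJ] <;> ring

theorem quatJ_smul (a : ℂ) (u : C4) : quatJ (a • u) = star a • quatJ u := by
  funext i
  fin_cases i <;> simp [quatJ]

theorem quatJ_real_smul (a : ℝ) (u : C4) : quatJ (a • u) = a • quatJ u := by
  funext i
  fin_cases i <;> simp [quatJ]

theorem herm_quatJ_comm (u v : C4) : herm (quatJ u) v = -herm (quatJ v) u := by
  simp [herm, quatJ, Fin.sum_univ_four]
  ring

theorem herm_quatJ_quatJ' (u v : C4) : herm (quatJ u) (quatJ v) = star (herm u v) := by
  simp [herm, quatJ, Fin.sum_univ_four]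
  ring

theorem herm_left_quatJ (u v : C4) : herm u (quatJ v) = -star (herm (quatJ u) v) := by
  simp [herm, quatJ, Fin.sum_univ_four]
  ring

/-- The Hermitian product as a real bilinear map. -/
noncomputable def hermL : C4 →L[ℝ] C4 →L[ℝ] ℂ :=
  LinearMap.toContinuousBilinearMap (LinearMap.mk₂ ℝ herm herm_add_left
    (fun a u v => by
      have := herm_smul_left u v a
      simpa using this)
    herm_add_right (fun a u v => by simpa using herm_real_smul_right u v a))

@[simp] theorem hermL_apply (u v : C4) : hermL u v = herm u v := rfl

/-- Multiplication by `j` as a real linear map. -/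
noncomputable def quatJL : C4 →L[ℝ] C4 :=
  LinearMap.toContinuousLinearMap
    { toFun := quatJ, map_add' := quatJ_add, map_smul' := quatJ_real_smul }

@[simp] theorem quatJL_apply (u : C4) : quatJL u = quatJ u := rfl

/-- The expansion of the Hermitian product in the frame `p, j p, r, j r`. -/
theorem herm_expand {p r : C4} (hp : herm p p = 1) (hr : herm r r = 2) (hpr : herm p r = 0)
    (hjpr : herm (quatJ p) r = 0) (u v : C4) :
    herm u v = star (herm p u) * herm p v + star (herm (quatJ p) u) * herm (quatJ p) v +
      1 / 2 * (star (herm r u) * herm r v + star (herm (quatJ r) u) * herm (quatJ r) v) := by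
  let e : Fin 4 → C4 := ![p, quatJ p, r, quatJ r]
  let w : Fin 4 → ℂ := ![1, 1, 1 / 2, 1 / 2]
  let R : Matrix (Fin 4) (Fin 4) ℂ := Matrix.of fun i k => star (e i k)
  let C : Matrix (Fin 4) (Fin 4) ℂ := Matrix.of fun k i => e i k * w i
  have hrp : herm r p = 0 := by rw [← star_herm, hpr, star_zero]
  have hrjp : herm r (quatJ p) = 0 := by rw [← star_herm, hjpr, star_zero]
  have hjrp : herm (quatJ r) p = 0 := by rw [herm_quatJ_comm, hjpr, neg_zero]
  have hpjr : herm p (quatJ r) = 0 := by rw [← star_herm, hjrp, star_zero]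
  have h1 : R * C = 1 := by
    have : ∀ i j, (R * C) i j = herm (e i) (e j) * w j := fun i j => by
      simp only [R, C, Matrix.mul_apply, Matrix.of_apply, herm, Finset.sum_mul]
      exact Finset.sum_congr rfl fun k _ => by ring
    ext i j
    rw [this]
    fin_cases i <;> fin_cases j <;>
      simp [e, w, hp, hr, hpr, hjpr, hrp, hrjp, hjrp, hpjr, herm_quatJ_right, herm_quatJ_left,
        herm_quatJ_quatJ']
  -- `h1` is orthogonality of the frame; commuting the square matrices turns it into completeness.
  have h2 : C * R = 1 := mul_eq_one_comm.1 h1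
  have h3 : ∀ k l, ∑ i, e i k * w i * star (e i l) = if k = l then 1 else 0 := fun k l => by
    have := congrFun (congrFun h2 k) l
    simpa [Matrix.mul_apply, R, C, Matrix.one_apply] using this
  have h4 : herm u v = ∑ i, w i * (star (herm (e i) u) * herm (e i) v) := by
    have : ∀ i, w i * (star (herm (e i) u) * herm (e i) v) =
        ∑ k, ∑ l, star (u l) * v k * (e i l * w i * star (e i k)) := fun i => by
      rw [star_herm]
      simp only [herm, Finset.sum_mul, Finset.mul_sum]
      exact Finset.sum_congr rfl fun k _ => Finset.sum_congr rfl fun l _ => by ring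
    simp only [this]
    rw [Finset.sum_comm]
    simp only [herm]
    refine Finset.sum_congr rfl fun k _ => ?_
    rw [Finset.sum_comm]
    simp only [← Finset.mul_sum, h3]
    simp
  rw [h4, Fin.sum_univ_four]
  simp [e, w]
  ring

theorem herm_quatJ_expand {p r : C4} (hp : herm p p = 1) (hr : herm r r = 2) (hpr : herm p r = 0)
    (hjpr : herm (quatJ p) r = 0) (u v : C4) :
    herm (quatJ u) v = -herm (quatJ p) u * herm p v + herm p u * herm (quatJ p) v +
      1 / 2 * (-herm (quatJ r) u * herm r v + herm r u * herm (quatJ r) v) := by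
  rw [herm_expand hp hr hpr hjpr (quatJ u) v]
  rw [herm_left_quatJ p, herm_quatJ_quatJ' p u, herm_left_quatJ r, herm_quatJ_quatJ' r u]
  simp only [star_neg, star_star]

/-! ### The complex-valued forms `h(u, dv)` and their differentials. -/

section Forms

variable {V : Type*} [NormedAddCommGroup V] [NormedSpace ℝ V]

theorem fderiv_herm {u v : V → C4} {x : V} (hu : DifferentiableAt ℝ u x)
    (hv : DifferentiableAt ℝ v x) (X : V) : fderiv ℝ (fun y => herm (u y) (v y)) x X =
      herm (fderiv ℝ u x X) (v x) + herm (u x) (fderiv ℝ v x X) := by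
  have h := hermL.hasFDerivAt_of_bilinear hu.hasFDerivAt hv.hasFDerivAt
  have h' : HasFDerivAt (fun y => herm (u y) (v y)) _ x := h
  rw [h'.fderiv]
  simp [add_comm]

theorem contDiffAt_herm {u v : V → C4} {x : V} (hu : ContDiffAt ℝ ∞ u x)
    (hv : ContDiffAt ℝ ∞ v x) : ContDiffAt ℝ ∞ (fun y => herm (u y) (v y)) x :=
  (hermL.contDiff.contDiffAt.comp x hu).clm_apply hv

theorem contDiffAt_quatJ {u : V → C4} {x : V} (hu : ContDiffAt ℝ ∞ u x) :
    ContDiffAt ℝ ∞ (fun y => quatJ (u y)) x :=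
  quatJL.contDiff.contDiffAt.comp x hu

theorem fderiv_quatJ {u : V → C4} {x : V} (hu : DifferentiableAt ℝ u x) (X : V) :
    fderiv ℝ (fun y => quatJ (u y)) x X = quatJ (fderiv ℝ u x X) := by
  have h : HasFDerivAt (fun y => quatJ (u y)) _ x := quatJL.hasFDerivAt.comp x hu.hasFDerivAt
  rw [h.fderiv]
  rfl

/-- The complex valued 1-form `h(u, dv)`. -/
noncomputable def hermForm (u v : V → C4) (x X : V) : ℂ := herm (u x) (fderiv ℝ v x X)

theorem contDiffAt_fderiv_apply {v : V → C4} {x : V} (hv : ContDiffAt ℝ ∞ v x) (Y : V) :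
    ContDiffAt ℝ ∞ (fun y => fderiv ℝ v y Y) x :=
  (hv.fderiv_right (m := ∞) (by simp)).clm_apply contDiffAt_const

theorem fderiv_fderiv_symm {W : Type*} [NormedAddCommGroup W] [NormedSpace ℝ W] {v : V → W} {x : V}
    (hv : ContDiffAt ℝ ∞ v x) (X Y : V) :
    fderiv ℝ (fun y => fderiv ℝ v y Y) x X = fderiv ℝ (fun y => fderiv ℝ v y X) x Y := by
  have hd : DifferentiableAt ℝ (fderiv ℝ v) x :=
    (hv.fderiv_right (m := ∞) (by simp)).differentiableAt (by simp)
  have e : ∀ X Y : V, fderiv ℝ (fun y => fderiv ℝ v y Y) x X = fderiv ℝ (fderiv ℝ v) x X Y := by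
    intro X Y
    rw [fderiv_clm_apply hd (differentiableAt_const _)]
    simp
  rw [e, e]
  exact (hv.isSymmSndFDerivAt (by simp; exact WithTop.coe_le_coe.2 le_top)).eq X Y

theorem contDiffAt_hermForm {u v : V → C4} {x : V} (hu : ContDiffAt ℝ ∞ u x)
    (hv : ContDiffAt ℝ ∞ v x) (Y : V) : ContDiffAt ℝ ∞ (fun y => hermForm u v y Y) x :=
  contDiffAt_herm hu (contDiffAt_fderiv_apply hv Y)

theorem smoothFormAt_re {u v : V → C4} {x : V} (hu : ContDiffAt ℝ ∞ u x)
    (hv : ContDiffAt ℝ ∞ v x) : SmoothFormAt (fun y Y => (hermForm u v y Y).re) x := fun Y =>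
  Complex.reCLM.contDiff.contDiffAt.comp x (contDiffAt_hermForm hu hv Y)

theorem smoothFormAt_im {u v : V → C4} {x : V} (hu : ContDiffAt ℝ ∞ u x)
    (hv : ContDiffAt ℝ ∞ v x) : SmoothFormAt (fun y Y => (hermForm u v y Y).im) x := fun Y =>
  Complex.imCLM.contDiff.contDiffAt.comp x (contDiffAt_hermForm hu hv Y)

theorem fderiv_hermForm {u v : V → C4} {x : V} (hu : ContDiffAt ℝ ∞ u x)
    (hv : ContDiffAt ℝ ∞ v x) (X Y : V) : fderiv ℝ (fun y => hermForm u v y Y) x X =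
      herm (fderiv ℝ u x X) (fderiv ℝ v x Y) + herm (u x) (fderiv ℝ (fun y => fderiv ℝ v y Y) x X) :=
  fderiv_herm (hu.differentiableAt (by simp))
    ((contDiffAt_fderiv_apply hv Y).differentiableAt (by simp)) X

/-- The second derivatives of `v` are symmetric and cancel, so only products of first derivatives of
`u` and `v` remain. -/
theorem extD_re {u v : V → C4} {x : V} (hu : ContDiffAt ℝ ∞ u x)
    (hv : ContDiffAt ℝ ∞ v x) (X Y : V) : extD (fun y Y => (hermForm u v y Y).re) x X Y =
      (herm (fderiv ℝ u x X) (fderiv ℝ v x Y)).re - (herm (fderiv ℝ u x Y) (fderiv ℝ v x X)).re := by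
  have e : ∀ X Y, fderiv ℝ (fun y => (hermForm u v y Y).re) x X =
      (fderiv ℝ (fun y => hermForm u v y Y) x X).re := fun X Y => by
    have h : HasFDerivAt (fun y => (hermForm u v y Y).re) _ x := Complex.reCLM.hasFDerivAt.comp x
      ((contDiffAt_hermForm hu hv Y).differentiableAt (by simp)).hasFDerivAt
    rw [h.fderiv]
    rfl
  rw [extD, e, e, fderiv_hermForm hu hv, fderiv_hermForm hu hv, fderiv_fderiv_symm hv X Y]
  simp

theorem extD_im {u v : V → C4} {x : V} (hu : ContDiffAt ℝ ∞ u x)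
    (hv : ContDiffAt ℝ ∞ v x) (X Y : V) : extD (fun y Y => (hermForm u v y Y).im) x X Y =
      (herm (fderiv ℝ u x X) (fderiv ℝ v x Y)).im - (herm (fderiv ℝ u x Y) (fderiv ℝ v x X)).im := by
  have e : ∀ X Y, fderiv ℝ (fun y => (hermForm u v y Y).im) x X =
      (fderiv ℝ (fun y => hermForm u v y Y) x X).im := fun X Y => by
    have h : HasFDerivAt (fun y => (hermForm u v y Y).im) _ x := Complex.imCLM.hasFDerivAt.comp x
      ((contDiffAt_hermForm hu hv Y).differentiableAt (by simp)).hasFDerivAt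
    rw [h.fderiv]
    rfl
  rw [extD, e, e, fderiv_hermForm hu hv, fderiv_hermForm hu hv, fderiv_fderiv_symm hv X Y]
  simp

end Forms

end CP3


/-! ### Adapted moving frames and their structure equations. -/

namespace CP3

variable {V : Type*} [NormedAddCommGroup V] [NormedSpace ℝ V]

/-- A smooth moving frame `p, j p, r, j r` of `ℂ⁴` along a hypersurface with lift `p` to `S⁷`,
adapted to the normal vector with lift `s j p + (c / 2) r`. -/
structure AdaptedFrame (U : Set V) (p r : V → C4) (s c : V → ℝ) : Prop where
  isOpen : IsOpen U
  smooth_p : ∀ x ∈ U, ContDiffAt ℝ ∞ p x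
  smooth_r : ∀ x ∈ U, ContDiffAt ℝ ∞ r x
  smooth_s : ∀ x ∈ U, ContDiffAt ℝ ∞ s x
  smooth_c : ∀ x ∈ U, ContDiffAt ℝ ∞ c x
  s_pos : ∀ x ∈ U, 0 < s x
  c_pos : ∀ x ∈ U, 0 < c x
  sq_add_sq : ∀ x ∈ U, s x ^ 2 + c x ^ 2 = 1
  herm_p : ∀ x ∈ U, herm (p x) (p x) = 1
  herm_r : ∀ x ∈ U, herm (r x) (r x) = 2
  herm_p_r : ∀ x ∈ U, herm (p x) (r x) = 0
  herm_jp_r : ∀ x ∈ U, herm (quatJ (p x)) (r x) = 0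
  normal : ∀ x ∈ U, ∀ X, s x * (hermForm (fun y => quatJ (p y)) p x X).re +
    c x * (hermForm r p x X).re = 0

section Defs

variable (p r : V → C4) (s c : V → ℝ)

/-- The form dual to the structure vector. -/
noncomputable def formEta (x X : V) : ℝ :=
  c x * (hermForm r p x X).im - s x * (hermForm (fun y => quatJ (p y)) p x X).im

noncomputable def formKappa₁ (x X : V) : ℝ :=
  c x * (hermForm (fun y => quatJ (p y)) p x X).re - s x * (hermForm r p x X).re

noncomputable def formKappa₂ (x X : V) : ℝ :=
  -(c x * (hermForm (fun y => quatJ (p y)) p x X).im + s x * (hermForm r p x X).im)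

noncomputable def formGamma₁ (x X : V) : ℝ := (hermForm (fun y => quatJ (r y)) p x X).re

noncomputable def formGamma₂ (x X : V) : ℝ := (hermForm (fun y => quatJ (r y)) p x X).im

/-- The differential of the angle with cosine `c` and sine `s`. -/
noncomputable def formTheta (x X : V) : ℝ := c x * fderiv ℝ s x X - s x * fderiv ℝ c x X

noncomputable def formChi (x X : V) : ℝ :=
  3 * (hermForm p p x X).im - 1 / 2 * (hermForm r r x X).im

noncomputable def formE₁ (x X : V) : ℝ := 1 / 2 * (hermForm (fun y => quatJ (r y)) r x X).re

noncomputable def formE₂ (x X : V) : ℝ := -(1 / 2 * (hermForm (fun y => quatJ (r y)) r x X).im)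

/-- The form `X ↦ α(X, ξ)` with `ξ` the structure vector. -/
noncomputable def formOmega (x X : V) : ℝ :=
  (c x ^ 2 - 2 * s x ^ 2) * (hermForm p p x X).im - 1 / 2 * c x ^ 2 * (hermForm r r x X).im

end Defs

namespace AdaptedFrame

variable {U : Set V} {p r : V → C4} {s c : V → ℝ}

/-- Differentiating `s² + c² = 1` shows that `(ds, dc)` is a multiple of `(c, -s)`. -/
theorem fderiv_s (F : AdaptedFrame U p r s c) {x : V} (hx : x ∈ U) (X : V) :
    fderiv ℝ s x X = c x * formTheta s c x X ∧ fderiv ℝ c x X = -s x * formTheta s c x X := by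
  have h1 := ((F.smooth_s x hx).differentiableAt (by simp)).hasFDerivAt
  have h2 := ((F.smooth_c x hx).differentiableAt (by simp)).hasFDerivAt
  have e : (s ^ 2 + c ^ 2) =ᶠ[nhds x] fun _ => 1 := by
    filter_upwards [F.isOpen.mem_nhds hx] with z hz using F.sq_add_sq z hz
  have h := DFunLike.congr_fun (((h1.pow 2).add (h2.pow 2)).unique
    ((hasFDerivAt_const (1 : ℝ) x).congr_of_eventuallyEq e)) X
  simp at h
  have hsc := F.sq_add_sq x hx
  constructor
  · unfold formTheta
    linear_combination -fderiv ℝ s x X * hsc + s x / 2 * h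
  · unfold formTheta
    linear_combination -fderiv ℝ c x X * hsc + c x / 2 * h

/-- Leibniz rule for a constant Hermitian product: the connection matrix of the frame is
skew-Hermitian. -/
theorem hermForm_add_eq (F : AdaptedFrame U p r s c) {x : V} (hx : x ∈ U) {u v : V → C4}
    (hu : ContDiffAt ℝ ∞ u x) (hv : ContDiffAt ℝ ∞ v x) (a : ℂ)
    (h : ∀ y ∈ U, herm (u y) (v y) = a) (X : V) :
    hermForm u v x X = -star (hermForm v u x X) := by
  have h1 := fderiv_herm (hu.differentiableAt (by simp)) (hv.differentiableAt (by simp)) X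
  have e : (fun y => herm (u y) (v y)) =ᶠ[nhds x] fun _ => a := by
    filter_upwards [F.isOpen.mem_nhds hx] with z hz using h z hz
  rw [e.fderiv_eq] at h1
  simp only [hermForm, star_herm]
  simp at h1
  linear_combination -h1

/-- The components of `dp` and `dr` in the adapted frame. -/
theorem values (F : AdaptedFrame U p r s c) {x : V} (hx : x ∈ U) (X : V) :
    herm (p x) (fderiv ℝ p x X) =
      ⟨0, (c x ^ 2 * formChi p r x X - formOmega p r s c x X) / 2⟩ ∧
    herm (quatJ (p x)) (fderiv ℝ p x X) = ⟨c x * formKappa₁ p r s c x X,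
      -(s x * formEta p r s c x X + c x * formKappa₂ p r s c x X)⟩ ∧
    herm (r x) (fderiv ℝ p x X) = ⟨-(s x * formKappa₁ p r s c x X),
      c x * formEta p r s c x X - s x * formKappa₂ p r s c x X⟩ ∧
    herm (quatJ (r x)) (fderiv ℝ p x X) = ⟨formGamma₁ p r x X, formGamma₂ p r x X⟩ ∧
    herm (p x) (fderiv ℝ r x X) = ⟨s x * formKappa₁ p r s c x X,
      c x * formEta p r s c x X - s x * formKappa₂ p r s c x X⟩ ∧
    herm (quatJ (p x)) (fderiv ℝ r x X) = ⟨formGamma₁ p r x X, formGamma₂ p r x X⟩ ∧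
    herm (r x) (fderiv ℝ r x X) =
      ⟨0, 3 * (c x ^ 2 * formChi p r x X - formOmega p r s c x X) - 2 * formChi p r x X⟩ ∧
    herm (quatJ (r x)) (fderiv ℝ r x X) = ⟨2 * formE₁ r x X, -2 * formE₂ r x X⟩ := by
  have hp := F.smooth_p x hx
  have hr := F.smooth_r x hx
  -- The normal equation makes the real parts of `h(jp, dp)` and `h(r, dp)` proportional to `c` and
  -- `-s`; the common factor is `κ₁`.
  have hn := F.normal x hx X
  have hsc := F.sq_add_sq x hx
  have h1 := F.hermForm_add_eq hx hp hp 1 F.herm_p X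
  have h2 := F.hermForm_add_eq hx hr hr 2 F.herm_r X
  have h3 := F.hermForm_add_eq hx hp hr 0 F.herm_p_r X
  have h4 := F.hermForm_add_eq hx (contDiffAt_quatJ hp) hr 0 F.herm_jp_r X
  -- Consequently the `jp` component of `dr` equals the `jr` component of `dp`.
  have e4 : hermForm r (fun y => quatJ (p y)) x X =
      -star (hermForm (fun y => quatJ (r y)) p x X) := by
    simp only [hermForm]
    rw [fderiv_quatJ (hp.differentiableAt (by simp)), herm_left_quatJ]
  rw [e4, star_neg, star_star, neg_neg] at h4
  have h1' := congrArg Complex.re h1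
  have h2' := congrArg Complex.re h2
  have h3' := congrArg Complex.re h3
  have h3'' := congrArg Complex.im h3
  simp at h1' h2' h3' h3''
  simp only [hermForm] at *
  refine ⟨Complex.ext ?_ ?_, Complex.ext ?_ ?_, Complex.ext ?_ ?_, Complex.ext ?_ ?_,
    Complex.ext ?_ ?_, Complex.ext ?_ ?_, Complex.ext ?_ ?_, Complex.ext ?_ ?_⟩ <;>
    simp only [formEta, formKappa₁, formKappa₂, formGamma₁, formGamma₂, formChi, formE₁, formE₂,
      formOmega, hermForm, h4]
  · linear_combination 1 / 2 * h1'
  · linear_combination -(herm (p x) (fderiv ℝ p x X)).im * hsc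
  · linear_combination -(herm (quatJ (p x)) (fderiv ℝ p x X)).re * hsc + s x * hn
  · linear_combination -(herm (quatJ (p x)) (fderiv ℝ p x X)).im * hsc
  · linear_combination -(herm (r x) (fderiv ℝ p x X)).re * hsc + c x * hn
  · linear_combination -(herm (r x) (fderiv ℝ p x X)).im * hsc
  · linear_combination h3' - c x * hn + (herm (r x) (fderiv ℝ p x X)).re * hsc
  · linear_combination h3'' - (herm (r x) (fderiv ℝ p x X)).im * hsc
  · linear_combination 1 / 2 * h2'
  · linear_combination -6 * (herm (p x) (fderiv ℝ p x X)).im * hsc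
  · ring
  · ring

theorem smooth_forms (F : AdaptedFrame U p r s c) {x : V} (hx : x ∈ U) :
    SmoothFormAt (formEta p r s c) x ∧ SmoothFormAt (formKappa₁ p r s c) x ∧
    SmoothFormAt (formKappa₂ p r s c) x ∧ SmoothFormAt (formGamma₂ p r) x ∧
    SmoothFormAt (formChi p r) x ∧ SmoothFormAt (formOmega p r s c) x := by
  have hp := F.smooth_p x hx
  have hr := F.smooth_r x hx
  have hs := F.smooth_s x hx
  have hc := F.smooth_c x hx
  have hjp := contDiffAt_quatJ hp
  have hjr := contDiffAt_quatJ hr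
  refine ⟨?_, ?_, ?_, ?_, ?_, ?_⟩
  · exact (SmoothFormAt.mul hc (smoothFormAt_im hr hp)).sub
      (SmoothFormAt.mul hs (smoothFormAt_im hjp hp))
  · exact (SmoothFormAt.mul hc (smoothFormAt_re hjp hp)).sub
      (SmoothFormAt.mul hs (smoothFormAt_re hr hp))
  · exact ((SmoothFormAt.mul hc (smoothFormAt_im hjp hp)).add
      (SmoothFormAt.mul hs (smoothFormAt_im hr hp))).neg
  · exact smoothFormAt_im hjr hp
  · exact (SmoothFormAt.mul contDiffAt_const (smoothFormAt_im hp hp)).sub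
      (SmoothFormAt.mul contDiffAt_const (smoothFormAt_im hr hr))
  · exact (SmoothFormAt.mul ((hc.pow 2).sub (contDiffAt_const.mul (hs.pow 2)))
      (smoothFormAt_im hp hp)).sub
      (SmoothFormAt.mul (contDiffAt_const.mul (hc.pow 2)) (smoothFormAt_im hr hr))

/-- As for the other structure equations, `d h(u, dv)` is expanded by completeness of `p, jp, r, jr`
into the components given by `values`; what is left is a polynomial identity modulo `s² + c² = 1`.
-/
theorem ext_eta (F : AdaptedFrame U p r s c) {x : V} (hx : x ∈ U) (X Y : V) :
    extD (formEta p r s c) x X Y = wedge (formTheta s c x) (formKappa₂ p r s c x) X Y -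
      s x * c x * wedge (formChi p r x) (formKappa₁ p r s c x) X Y +
      c x * wedge (formE₁ r x) (formGamma₂ p r x) X Y +
      c x * wedge (formE₂ r x) (formGamma₁ p r x) X Y +
      wedge (formKappa₁ p r s c x) (formGamma₂ p r x) X Y +
      wedge (formKappa₂ p r s c x) (formGamma₁ p r x) X Y := by
  have hp := F.smooth_p x hx
  have hr := F.smooth_r x hx
  have hs := F.smooth_s x hx
  have hc := F.smooth_c x hx
  have hjp := contDiffAt_quatJ hp
  have hE := herm_expand (F.herm_p x hx) (F.herm_r x hx) (F.herm_p_r x hx) (F.herm_jp_r x hx)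
  have hJ := herm_quatJ_expand (F.herm_p x hx) (F.herm_r x hx) (F.herm_p_r x hx) (F.herm_jp_r x hx)
  obtain ⟨x1, x2, x3, x4, x5, x6, x7, x8⟩ := F.values hx X
  obtain ⟨y1, y2, y3, y4, y5, y6, y7, y8⟩ := F.values hx Y
  have s2 := F.sq_add_sq x hx
  have e : formEta p r s c = fun y Y => c y * (hermForm r p y Y).im -
    s y * (hermForm (fun y => quatJ (p y)) p y Y).im := rfl
  rw [e, extD_sub (SmoothFormAt.mul hc (smoothFormAt_im hr hp)) (SmoothFormAt.mul hs (smoothFormAt_im hjp hp)),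
    extD_mul hc (smoothFormAt_im hr hp), extD_mul hs (smoothFormAt_im hjp hp), extD_im hjp hp, extD_im hr hp, fderiv_quatJ (hp.differentiableAt (by simp)), fderiv_quatJ (hp.differentiableAt (by simp)), hE (fderiv ℝ r x X), hE (fderiv ℝ r x Y), hJ (fderiv ℝ p x X), hJ (fderiv ℝ p x Y)]
  simp only [hermForm, x1, x2, x3, x4, x5, x6, x7, x8, y1, y2, y3, y4, y5, y6, y7, y8,
    wedge, F.fderiv_s hx]
  simp
  grind

/-- The exterior derivative of the normal equation, which expresses the symmetry of the second
fundamental form. Under the Hopf condition the last term disappears, since `ω` is a multiple of `η`.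
-/
theorem ext_normal (F : AdaptedFrame U p r s c) {x : V} (hx : x ∈ U) (X Y : V) :
    wedge (formTheta s c x) (formKappa₁ p r s c x) X Y +
      s x * c x * wedge (formChi p r x) (formKappa₂ p r s c x) X Y +
      c x * wedge (formE₁ r x) (formGamma₁ p r x) X Y -
      c x * wedge (formE₂ r x) (formGamma₂ p r x) X Y -
      wedge (formKappa₁ p r s c x) (formGamma₁ p r x) X Y +
      wedge (formKappa₂ p r s c x) (formGamma₂ p r x) X Y -
      wedge (formOmega p r s c x) (formEta p r s c x) X Y = 0 := by
  have hp := F.smooth_p x hx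
  have hr := F.smooth_r x hx
  have hs := F.smooth_s x hx
  have hc := F.smooth_c x hx
  have hjp := contDiffAt_quatJ hp
  have hE := herm_expand (F.herm_p x hx) (F.herm_r x hx) (F.herm_p_r x hx) (F.herm_jp_r x hx)
  have hJ := herm_quatJ_expand (F.herm_p x hx) (F.herm_r x hx) (F.herm_p_r x hx) (F.herm_jp_r x hx)
  obtain ⟨x1, x2, x3, x4, x5, x6, x7, x8⟩ := F.values hx X
  obtain ⟨y1, y2, y3, y4, y5, y6, y7, y8⟩ := F.values hx Y
  have s2 := F.sq_add_sq x hx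
  have e := extD_congr F.isOpen hx F.normal X Y
  have e0 : extD (fun (_ _ : V) => (0 : ℝ)) x X Y = 0 := by simp [extD]
  rw [e0, extD_add (SmoothFormAt.mul hs (smoothFormAt_re hjp hp)) (SmoothFormAt.mul hc (smoothFormAt_re hr hp)),
    extD_mul hs (smoothFormAt_re hjp hp), extD_mul hc (smoothFormAt_re hr hp), extD_re hjp hp, extD_re hr hp, fderiv_quatJ (hp.differentiableAt (by simp)), fderiv_quatJ (hp.differentiableAt (by simp)), hE (fderiv ℝ r x X), hE (fderiv ℝ r x Y), hJ (fderiv ℝ p x X), hJ (fderiv ℝ p x Y)] at e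
  simp only [hermForm, x1, x2, x3, x4, x5, x6, x7, x8, y1, y2, y3, y4, y5, y6, y7, y8,
    wedge, F.fderiv_s hx] at e ⊢
  simp at e
  grind

theorem ext_kappa₁ (F : AdaptedFrame U p r s c) {x : V} (hx : x ∈ U) (X Y : V) :
    extD (formKappa₁ p r s c) x X Y = s x * c x * wedge (formChi p r x) (formEta p r s c x) X Y -
      wedge (formOmega p r s c x) (formKappa₂ p r s c x) X Y -
      (s x ^ 2 - c x ^ 2) * wedge (formChi p r x) (formKappa₂ p r s c x) X Y -
      s x * wedge (formE₁ r x) (formGamma₁ p r x) X Y +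
      s x * wedge (formE₂ r x) (formGamma₂ p r x) X Y -
      wedge (formEta p r s c x) (formGamma₂ p r x) X Y := by
  have hp := F.smooth_p x hx
  have hr := F.smooth_r x hx
  have hs := F.smooth_s x hx
  have hc := F.smooth_c x hx
  have hjp := contDiffAt_quatJ hp
  have hE := herm_expand (F.herm_p x hx) (F.herm_r x hx) (F.herm_p_r x hx) (F.herm_jp_r x hx)
  have hJ := herm_quatJ_expand (F.herm_p x hx) (F.herm_r x hx) (F.herm_p_r x hx) (F.herm_jp_r x hx)
  obtain ⟨x1, x2, x3, x4, x5, x6, x7, x8⟩ := F.values hx X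
  obtain ⟨y1, y2, y3, y4, y5, y6, y7, y8⟩ := F.values hx Y
  have s2 := F.sq_add_sq x hx
  have e : formKappa₁ p r s c = fun y Y => c y * (hermForm (fun y => quatJ (p y)) p y Y).re -
    s y * (hermForm r p y Y).re := rfl
  rw [e, extD_sub (SmoothFormAt.mul hc (smoothFormAt_re hjp hp)) (SmoothFormAt.mul hs (smoothFormAt_re hr hp)),
    extD_mul hc (smoothFormAt_re hjp hp), extD_mul hs (smoothFormAt_re hr hp), extD_re hjp hp, extD_re hr hp, fderiv_quatJ (hp.differentiableAt (by simp)), fderiv_quatJ (hp.differentiableAt (by simp)), hE (fderiv ℝ r x X), hE (fderiv ℝ r x Y), hJ (fderiv ℝ p x X), hJ (fderiv ℝ p x Y)]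
  simp only [hermForm, x1, x2, x3, x4, x5, x6, x7, x8, y1, y2, y3, y4, y5, y6, y7, y8,
    wedge, F.fderiv_s hx]
  simp
  grind

theorem ext_kappa₂ (F : AdaptedFrame U p r s c) {x : V} (hx : x ∈ U) (X Y : V) :
    extD (formKappa₂ p r s c) x X Y = -(wedge (formTheta s c x) (formEta p r s c x) X Y) +
      wedge (formOmega p r s c x) (formKappa₁ p r s c x) X Y +
      (s x ^ 2 - c x ^ 2) * wedge (formChi p r x) (formKappa₁ p r s c x) X Y -
      s x * wedge (formE₁ r x) (formGamma₂ p r x) X Y -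
      s x * wedge (formE₂ r x) (formGamma₁ p r x) X Y -
      wedge (formEta p r s c x) (formGamma₁ p r x) X Y := by
  have hp := F.smooth_p x hx
  have hr := F.smooth_r x hx
  have hs := F.smooth_s x hx
  have hc := F.smooth_c x hx
  have hjp := contDiffAt_quatJ hp
  have hE := herm_expand (F.herm_p x hx) (F.herm_r x hx) (F.herm_p_r x hx) (F.herm_jp_r x hx)
  have hJ := herm_quatJ_expand (F.herm_p x hx) (F.herm_r x hx) (F.herm_p_r x hx) (F.herm_jp_r x hx)
  obtain ⟨x1, x2, x3, x4, x5, x6, x7, x8⟩ := F.values hx X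
  obtain ⟨y1, y2, y3, y4, y5, y6, y7, y8⟩ := F.values hx Y
  have s2 := F.sq_add_sq x hx
  have e : formKappa₂ p r s c = fun y Y => -(c y * (hermForm (fun y => quatJ (p y)) p y Y).im +
    s y * (hermForm r p y Y).im) := rfl
  rw [e, extD_neg, extD_add (SmoothFormAt.mul hc (smoothFormAt_im hjp hp)) (SmoothFormAt.mul hs (smoothFormAt_im hr hp)),
    extD_mul hc (smoothFormAt_im hjp hp), extD_mul hs (smoothFormAt_im hr hp), extD_im hjp hp, extD_im hr hp, fderiv_quatJ (hp.differentiableAt (by simp)), fderiv_quatJ (hp.differentiableAt (by simp)), hE (fderiv ℝ r x X), hE (fderiv ℝ r x Y), hJ (fderiv ℝ p x X), hJ (fderiv ℝ p x Y)]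
  simp only [hermForm, x1, x2, x3, x4, x5, x6, x7, x8, y1, y2, y3, y4, y5, y6, y7, y8,
    wedge, F.fderiv_s hx]
  simp
  grind

theorem ext_gamma₂ (F : AdaptedFrame U p r s c) {x : V} (hx : x ∈ U) (X Y : V) :
    extD (formGamma₂ p r) x X Y = -(2 * wedge (formOmega p r s c x) (formGamma₁ p r x) X Y) +
      (c x ^ 2 - s x ^ 2) * wedge (formChi p r x) (formGamma₁ p r x) X Y -
      c x * wedge (formE₁ r x) (formEta p r s c x) X Y +
      s x * wedge (formE₁ r x) (formKappa₂ p r s c x) X Y -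
      s x * wedge (formE₂ r x) (formKappa₁ p r s c x) X Y +
      wedge (formEta p r s c x) (formKappa₁ p r s c x) X Y := by
  have hp := F.smooth_p x hx
  have hr := F.smooth_r x hx
  have hjr := contDiffAt_quatJ hr
  have hJ := herm_quatJ_expand (F.herm_p x hx) (F.herm_r x hx) (F.herm_p_r x hx) (F.herm_jp_r x hx)
  obtain ⟨x1, x2, x3, x4, x5, x6, x7, x8⟩ := F.values hx X
  obtain ⟨y1, y2, y3, y4, y5, y6, y7, y8⟩ := F.values hx Y
  have s2 := F.sq_add_sq x hx
  have e : formGamma₂ p r = fun y Y => (hermForm (fun y => quatJ (r y)) p y Y).im := rfl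
  rw [e, extD_im hjr hp, fderiv_quatJ (hr.differentiableAt (by simp)), fderiv_quatJ (hr.differentiableAt (by simp)), hJ (fderiv ℝ r x X), hJ (fderiv ℝ r x Y)]
  simp only [x1, x2, x3, x4, x5, x6, x7, x8, y1, y2, y3, y4, y5, y6, y7, y8,
    wedge]
  simp
  grind

theorem ext_chi (F : AdaptedFrame U p r s c) {x : V} (hx : x ∈ U) (X Y : V) :
    extD (formChi p r) x X Y = -(2 * (3 * c x ^ 2 - 2 * s x ^ 2) * wedge (formKappa₁ p r s c x) (formKappa₂ p r s c x) X Y) +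
      10 * s x * c x * wedge (formEta p r s c x) (formKappa₁ p r s c x) X Y +
      2 * wedge (formGamma₁ p r x) (formGamma₂ p r x) X Y +
      2 * wedge (formE₁ r x) (formE₂ r x) X Y := by
  have hp := F.smooth_p x hx
  have hr := F.smooth_r x hx
  have hE := herm_expand (F.herm_p x hx) (F.herm_r x hx) (F.herm_p_r x hx) (F.herm_jp_r x hx)
  obtain ⟨x1, x2, x3, x4, x5, x6, x7, x8⟩ := F.values hx X
  obtain ⟨y1, y2, y3, y4, y5, y6, y7, y8⟩ := F.values hx Y
  have s2 := F.sq_add_sq x hx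
  have e : formChi p r = fun y Y => 3 * (hermForm p p y Y).im - 1 / 2 * (hermForm r r y Y).im := rfl
  rw [e, extD_sub (SmoothFormAt.mul contDiffAt_const (smoothFormAt_im hp hp)) (SmoothFormAt.mul contDiffAt_const (smoothFormAt_im hr hr)),
    extD_mul contDiffAt_const (smoothFormAt_im hp hp), extD_mul contDiffAt_const (smoothFormAt_im hr hr), extD_im hp hp, extD_im hr hr, hE (fderiv ℝ p x X), hE (fderiv ℝ p x Y),
    hE (fderiv ℝ r x X), hE (fderiv ℝ r x Y)]
  simp only [hermForm, x1, x2, x3, x4, x5, x6, x7, x8, y1, y2, y3, y4, y5, y6, y7, y8,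
    wedge]
  simp
  grind

/-- This plays the role of the Codazzi equation for the structure vector; under the Hopf condition
it is the equation for `d(μη)`. -/
theorem ext_omega (F : AdaptedFrame U p r s c) {x : V} (hx : x ∈ U) (X Y : V) :
    extD (formOmega p r s c) x X Y = -(2 * s x * c x * wedge (formTheta s c x) (formChi p r x) X Y) +
      2 * c x ^ 2 * wedge (formE₁ r x) (formE₂ r x) X Y +
      2 * s x * c x * (2 * c x ^ 2 - 3 * s x ^ 2) * wedge (formEta p r s c x) (formKappa₁ p r s c x) X Y +
      2 * (-c x ^ 4 + 3 * s x ^ 2 * c x ^ 2 - s x ^ 4) * wedge (formKappa₁ p r s c x) (formKappa₂ p r s c x) X Y -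
      2 * s x ^ 2 * wedge (formGamma₁ p r x) (formGamma₂ p r x) X Y := by
  have hp := F.smooth_p x hx
  have hr := F.smooth_r x hx
  have hs := F.smooth_s x hx
  have hc := F.smooth_c x hx
  have hE := herm_expand (F.herm_p x hx) (F.herm_r x hx) (F.herm_p_r x hx) (F.herm_jp_r x hx)
  obtain ⟨x1, x2, x3, x4, x5, x6, x7, x8⟩ := F.values hx X
  obtain ⟨y1, y2, y3, y4, y5, y6, y7, y8⟩ := F.values hx Y
  have s2 := F.sq_add_sq x hx
  have e : formOmega p r s c = fun y Y => (c y ^ 2 - 2 * s y ^ 2) * (hermForm p p y Y).im -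
    1 / 2 * c y ^ 2 * (hermForm r r y Y).im := rfl
  have h1 : ContDiffAt ℝ ∞ (fun y => c y ^ 2 - 2 * s y ^ 2) x := by fun_prop
  have h2 : ContDiffAt ℝ ∞ (fun y => 1 / 2 * c y ^ 2) x := by fun_prop
  have g1 : ∀ Z, fderiv ℝ (fun y => c y ^ 2 - 2 * s y ^ 2) x Z =
      -6 * s x * c x * formTheta s c x Z := fun Z => by
    have d1 := (hs.differentiableAt (by simp)).hasFDerivAt
    have d2 := (hc.differentiableAt (by simp)).hasFDerivAt
    have d : HasFDerivAt (fun y => c y ^ 2 - 2 * s y ^ 2) _ x :=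
      (d2.pow 2).sub ((d1.pow 2).const_mul 2)
    rw [d.fderiv]
    simp [F.fderiv_s hx]
    ring
  have g2 : ∀ Z, fderiv ℝ (fun y => 1 / 2 * c y ^ 2) x Z =
      -(s x * c x * formTheta s c x Z) := fun Z => by
    have d2 := (hc.differentiableAt (by simp)).hasFDerivAt
    have d : HasFDerivAt (fun y => 1 / 2 * c y ^ 2) _ x := (d2.pow 2).const_mul _
    rw [d.fderiv]
    simp [F.fderiv_s hx]
    ring
  rw [e, extD_sub (SmoothFormAt.mul h1 (smoothFormAt_im hp hp)) (SmoothFormAt.mul h2 (smoothFormAt_im hr hr)),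
    extD_mul h1 (smoothFormAt_im hp hp), extD_mul h2 (smoothFormAt_im hr hr), extD_im hp hp, extD_im hr hr, hE (fderiv ℝ p x X), hE (fderiv ℝ p x Y),
    hE (fderiv ℝ r x X), hE (fderiv ℝ r x Y)]
  simp only [hermForm, x1, x2, x3, x4, x5, x6, x7, x8, y1, y2, y3, y4, y5, y6, y7, y8,
    wedge, g1, g2]
  simp
  grind

end AdaptedFrame

end CP3


/-! ### From an adapted frame to the exterior differential system. -/

namespace CP3

variable {V : Type*} [NormedAddCommGroup V] [NormedSpace ℝ V]

namespace AdaptedFrame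

variable {U : Set V} {p r : V → C4} {s c : V → ℝ}

/-- By `values`, the five forms determine the components of `dp` transversal to the fibre, so by the
immersion hypothesis they have no common kernel; the dimension is five. -/
theorem exists_dualFrame (F : AdaptedFrame U p r s c) (hV : Module.finrank ℝ V = 5) {x : V}
    (hx : x ∈ U) (himm : ∀ X, herm (quatJ (p x)) (fderiv ℝ p x X) = 0 →
      herm (r x) (fderiv ℝ p x X) = 0 → herm (quatJ (r x)) (fderiv ℝ p x X) = 0 → X = 0) :
    ∃ X : Fin 5 → V, IsDualFrame (formEta p r s c x) (formKappa₁ p r s c x)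
      (formKappa₂ p r s c x) (formGamma₁ p r x) (formGamma₂ p r x) X := by
  have : FiniteDimensional ℝ V := Module.finite_of_finrank_pos (by omega)
  have hlin : ∀ (u v : V → C4) (X Y : V), hermForm u v x (X + Y) =
      hermForm u v x X + hermForm u v x Y := fun u v X Y => by
    simp [hermForm, herm_add_right]
  have hsmul : ∀ (u v : V → C4) (a : ℝ) (X : V), hermForm u v x (a • X) =
      a * hermForm u v x X := fun u v a X => by
    simp [hermForm, herm_real_smul_right]
  let Φ : V →ₗ[ℝ] (Fin 5 → ℝ) :=
    { toFun := fun X => ![formEta p r s c x X, formKappa₁ p r s c x X, formKappa₂ p r s c x X,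
        formGamma₁ p r x X, formGamma₂ p r x X]
      map_add' := fun X Y => by
        funext i
        fin_cases i <;> simp [formEta, formKappa₁, formKappa₂, formGamma₁, formGamma₂, hlin] <;>
          ring
      map_smul' := fun a X => by
        funext i
        fin_cases i <;> simp [formEta, formKappa₁, formKappa₂, formGamma₁, formGamma₂, hsmul] <;>
          ring }
  have hinj : Function.Injective Φ := by
    rw [← LinearMap.ker_eq_bot, LinearMap.ker_eq_bot']
    intro X hX
    have h := fun i => congrFun hX i
    have h0 : formEta p r s c x X = 0 := h 0
    have h1 : formKappa₁ p r s c x X = 0 := h 1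
    have h2 : formKappa₂ p r s c x X = 0 := h 2
    have h3 : formGamma₁ p r x X = 0 := h 3
    have h4 : formGamma₂ p r x X = 0 := h 4
    obtain ⟨-, e2, e3, e4, -⟩ := F.values hx X
    refine himm X ?_ ?_ ?_
    · rw [e2, h0, h1, h2]; apply Complex.ext <;> simp
    · rw [e3, h0, h1, h2]; apply Complex.ext <;> simp
    · rw [e4, h3, h4]; rfl
  let e := LinearEquiv.ofInjectiveOfFinrankEq Φ hinj (by simp [hV])
  have he : ∀ X, e X = Φ X := fun X => rfl
  let X : Fin 5 → V := fun i => e.symm (Pi.single i 1)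
  have hX : ∀ i, Φ (X i) = Pi.single i 1 := fun i => by rw [← he, e.apply_symm_apply]
  have hXj : ∀ i j, Φ (X i) j = if i = j then 1 else 0 := fun i j => by
    rw [hX, Pi.single_apply]
    simp [eq_comm]
  refine ⟨X, ?_, fun i => hXj i 0, fun i => hXj i 1, fun i => hXj i 2, fun i => hXj i 3,
    fun i => hXj i 4⟩
  intro Y
  apply hinj
  funext j
  simp only [map_add, map_smul, Pi.add_apply, Pi.smul_apply, hXj]
  fin_cases j <;> simp [Φ]

/-- A hypersurface whose normal has nonzero components in both distributions is not Hopf. -/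
theorem false_of_hopf (F : AdaptedFrame U p r s c) (hV : Module.finrank ℝ V = 5)
    (himm : ∀ x ∈ U, ∀ X, herm (quatJ (p x)) (fderiv ℝ p x X) = 0 →
      herm (r x) (fderiv ℝ p x X) = 0 → herm (quatJ (r x)) (fderiv ℝ p x X) = 0 → X = 0)
    (hopf : ∀ x ∈ U, ∃ μ : ℝ, ∀ X, formOmega p r s c x X = μ * formEta p r s c x X)
    {x : V} (hx : x ∈ U) : False := by
  have hcf := fun x hx => F.exists_dualFrame hV hx (himm x hx)
  -- The eigenvalue is given only pointwise; its smoothness comes from `ω = μ η` with `η` nowhere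
  -- zero.
  obtain ⟨μ, hμ, hω⟩ := exists_smooth_coeff (σ := formOmega p r s c) (η := formEta p r s c)
    (φ := fun _ _ => 0) F.isOpen (fun x hx => (F.smooth_forms hx).2.2.2.2.2)
    (fun x hx => (F.smooth_forms hx).1) (fun x hx Y => contDiffAt_const)
    (fun x hx => by
      obtain ⟨X, hX⟩ := hcf x hx
      exact ⟨X 0, by simp [hX.apply_η]⟩)
    (fun x hx => by simpa using hopf x hx)
  simp only [add_zero] at hω
  have hω' : ∀ x ∈ U, ∀ (a : V → ℝ) (X Y : V), wedge (formOmega p r s c x) a X Y =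
      μ x * wedge (formEta p r s c x) a X Y := fun x hx a X Y => by
    simp only [wedge, hω x hx]
    ring
  have H : HopfForms U s c μ (formEta p r s c) (formKappa₁ p r s c) (formKappa₂ p r s c)
      (formGamma₁ p r) (formGamma₂ p r) (formTheta s c) (formChi p r) (formE₁ r) (formE₂ r) :=
    { isOpen := F.isOpen
      smooth_s := F.smooth_s
      smooth_c := F.smooth_c
      smooth_μ := hμ
      smooth_η := fun x hx => (F.smooth_forms hx).1
      smooth_κ₁ := fun x hx => (F.smooth_forms hx).2.1
      smooth_κ₂ := fun x hx => (F.smooth_forms hx).2.2.1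
      smooth_γ₂ := fun x hx => (F.smooth_forms hx).2.2.2.1
      smooth_χ := fun x hx => (F.smooth_forms hx).2.2.2.2.1
      s_pos := F.s_pos
      c_pos := F.c_pos
      sq_add_sq := F.sq_add_sq
      deriv_s := fun x hx X => (F.fderiv_s hx X).1
      deriv_c := fun x hx X => (F.fderiv_s hx X).2
      coframe := hcf
      linear_χ := fun x hx => by
        constructor
        · intro X Y
          simp [formChi, hermForm, herm_add_right]
          ring
        · intro a X
          simp [formChi, hermForm, herm_real_smul_right]
          ring
      normal := fun x hx X Y => by
        have h := F.ext_normal hx X Y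
        rw [hω' x hx] at h
        simp only [wedge] at h ⊢
        linear_combination h
      ext_η := fun x hx X Y => F.ext_eta hx X Y
      ext_μη := fun x hx X Y => by
        rw [← extD_congr F.isOpen hx hω, F.ext_omega hx]
        ring
      ext_κ₁ := fun x hx X Y => by
        rw [F.ext_kappa₁ hx, hω' x hx]
        ring
      ext_κ₂ := fun x hx X Y => by
        rw [F.ext_kappa₂ hx, hω' x hx]
        ring
      ext_γ₂ := fun x hx X Y => by
        rw [F.ext_gamma₂ hx, hω' x hx]
        ring
      ext_χ := fun x hx X Y => by
        rw [F.ext_chi hx]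
        ring }
  exact H.false_of_mem hx

end AdaptedFrame

end CP3


/-! ### The second fundamental form as a variation of the induced metric. -/

section SecondVariation

variable {E W W' : Type*} [NormedAddCommGroup E] [NormedSpace ℝ E] [NormedAddCommGroup W]
  [NormedSpace ℝ W] [NormedAddCommGroup W'] [NormedSpace ℝ W']

/-- The derivative at `t = 0` of the metric induced by `F + t N` from the metric `g`. -/
noncomputable def metricVariation (g : W → W → W → ℝ) (F N : E → W) (x X Y : E) : ℝ :=
  g (F x) (fderiv ℝ F x Y) (fderiv ℝ N x X) + g (F x) (fderiv ℝ F x X) (fderiv ℝ N x Y) +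
    fderiv ℝ (fun w => g w (fderiv ℝ F x X) (fderiv ℝ F x Y)) (F x) (N x)

theorem fderiv_bilin_apply {g : W → W →L[ℝ] W →L[ℝ] ℝ} {w : W} (hg : DifferentiableAt ℝ g w)
    (u v n : W) : fderiv ℝ (fun w => g w u v) w n = fderiv ℝ g w n u v := by
  have h := ((hg.hasFDerivAt.clm_apply (hasFDerivAt_const u w)).clm_apply (hasFDerivAt_const v w))
  rw [h.fderiv]
  simp

theorem fderiv_bilin_comp {g : W → W →L[ℝ] W →L[ℝ] ℝ} {F A B : E → W} {x : E}
    (hg : DifferentiableAt ℝ g (F x)) (hF : DifferentiableAt ℝ F x) (hA : DifferentiableAt ℝ A x)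
    (hB : DifferentiableAt ℝ B x) (X : E) : fderiv ℝ (fun y => g (F y) (A y) (B y)) x X =
      fderiv ℝ g (F x) (fderiv ℝ F x X) (A x) (B x) + g (F x) (fderiv ℝ A x X) (B x) +
        g (F x) (A x) (fderiv ℝ B x X) := by
  have h : HasFDerivAt (fun y => g (F y)) ((fderiv ℝ g (F x)).comp (fderiv ℝ F x)) x :=
    HasFDerivAt.comp (g := g) x hg.hasFDerivAt hF.hasFDerivAt
  have h' : HasFDerivAt (fun y => g (F y) (A y) (B y)) _ x :=
    (h.clm_apply hA.hasFDerivAt).clm_apply hB.hasFDerivAt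
  rw [h'.fderiv]
  simp
  ring

/-- The second fundamental form is minus one half of the derivative of the induced metrics. -/
theorem bilin_second_deriv_eq {g : W → W →L[ℝ] W →L[ℝ] ℝ} {F N : E → W} {x : E}
    (hg : DifferentiableAt ℝ g (F x)) (hF : ContDiffAt ℝ ∞ F x) (hN : DifferentiableAt ℝ N x)
    (hn : ∀ᶠ y in nhds x, ∀ Y, g (F y) (fderiv ℝ F y Y) (N y) = 0) (X Y : E) :
    g (F x) (fderiv ℝ (fun y => fderiv ℝ F y Y) x X) (N x) +
      1 / 2 * (fderiv ℝ (fun w => g w (fderiv ℝ F x Y) (N x)) (F x) (fderiv ℝ F x X) +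
        fderiv ℝ (fun w => g w (fderiv ℝ F x X) (N x)) (F x) (fderiv ℝ F x Y) -
        fderiv ℝ (fun w => g w (fderiv ℝ F x X) (fderiv ℝ F x Y)) (F x) (N x)) =
      -1 / 2 * metricVariation (fun w u v => g w u v) F N x X Y := by
  have hd : ∀ Y, DifferentiableAt ℝ (fun y => fderiv ℝ F y Y) x := fun Y =>
    ((hF.fderiv_right (m := ∞) (by simp)).clm_apply contDiffAt_const).differentiableAt (by simp)
  have h : ∀ X Y, fderiv ℝ (fun y => g (F y) (fderiv ℝ F y Y) (N y)) x X = 0 := fun X Y => by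
    have e : (fun y => g (F y) (fderiv ℝ F y Y) (N y)) =ᶠ[nhds x] fun _ => 0 := by
      filter_upwards [hn] with y hy using hy Y
    rw [e.fderiv_eq]
    simp
  -- The identity is half the sum of the derivatives of `g(dF Y, N) = 0` along `X` and of `g(dF X,
  -- N) = 0` along `Y`.
  have h1 := h X Y
  have h2 := h Y X
  rw [fderiv_bilin_comp hg (hF.differentiableAt (by simp)) (hd _) hN] at h1 h2
  rw [CP3.fderiv_fderiv_symm hF Y X] at h2
  simp only [metricVariation, fderiv_bilin_apply hg]
  linear_combination 1 / 2 * h1 + 1 / 2 * h2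

/-- The variation of the induced metric is natural. -/
theorem metricVariation_comp {g : W → W →L[ℝ] W →L[ℝ] ℝ} {G : W' → W' → W' → ℝ} {π : W' → W}
    {P n : E → W'} {x : E} (hg : DifferentiableAt ℝ g (π (P x))) (hgs : ∀ u v, g (π (P x)) u v = g (π (P x)) v u)
    (hπ : ContDiffAt ℝ ∞ π (P x))
    (hP : DifferentiableAt ℝ P x) (hn : DifferentiableAt ℝ n x)
    (hG : ∀ᶠ z in nhds (P x), ∀ u v, G z u v = g (π z) (fderiv ℝ π z u) (fderiv ℝ π z v))
    (X Y : E) :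
    metricVariation (fun w u v => g w u v) (fun y => π (P y)) (fun y => fderiv ℝ π (P y) (n y))
      x X Y = metricVariation G P n x X Y := by
  have hπ' : DifferentiableAt ℝ (fderiv ℝ π) (P x) :=
    (hπ.fderiv_right (m := ∞) (by simp)).differentiableAt (by simp)
  have hd : ∀ u, DifferentiableAt ℝ (fun z => fderiv ℝ π z u) (P x) := fun u =>
    hπ'.clm_apply (differentiableAt_const u)
  have e1 : ∀ X, fderiv ℝ (fun y => π (P y)) x X = fderiv ℝ π (P x) (fderiv ℝ P x X) := fun X => by
    have h : HasFDerivAt (fun y => π (P y)) _ x :=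
      (hπ.differentiableAt (by simp)).hasFDerivAt.comp x hP.hasFDerivAt
    rw [h.fderiv]
    rfl
  have e2 : ∀ X, fderiv ℝ (fun y => fderiv ℝ π (P y) (n y)) x X =
      fderiv ℝ (fderiv ℝ π) (P x) (fderiv ℝ P x X) (n x) +
        fderiv ℝ π (P x) (fderiv ℝ n x X) := fun X => by
    have h : HasFDerivAt (fun y => fderiv ℝ π (P y) (n y)) _ x :=
      (hπ'.hasFDerivAt.comp x hP.hasFDerivAt).clm_apply hn.hasFDerivAt
    rw [h.fderiv]
    simp [add_comm]
  have e3 : ∀ u m, fderiv ℝ (fun z => fderiv ℝ π z u) (P x) m = fderiv ℝ (fderiv ℝ π) (P x) m u :=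
    fun u m => by
      rw [fderiv_clm_apply hπ' (differentiableAt_const _)]
      simp
  have e4 : ∀ u v m, fderiv ℝ (fun z => G z u v) (P x) m =
      fderiv ℝ g (π (P x)) (fderiv ℝ π (P x) m) (fderiv ℝ π (P x) u) (fderiv ℝ π (P x) v) +
        g (π (P x)) (fderiv ℝ (fderiv ℝ π) (P x) m u) (fderiv ℝ π (P x) v) +
        g (π (P x)) (fderiv ℝ π (P x) u) (fderiv ℝ (fderiv ℝ π) (P x) m v) := fun u v m => by
    have e : (fun z => G z u v) =ᶠ[nhds (P x)]
        fun z => g (π z) (fderiv ℝ π z u) (fderiv ℝ π z v) := by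
      filter_upwards [hG] with z hz using hz u v
    rw [e.fderiv_eq, fderiv_bilin_comp hg (hπ.differentiableAt (by simp)) (hd _) (hd _), e3, e3]
  have hs : ∀ u v, fderiv ℝ (fderiv ℝ π) (P x) u v = fderiv ℝ (fderiv ℝ π) (P x) v u :=
    (hπ.isSymmSndFDerivAt (by simp; exact WithTop.coe_le_coe.2 le_top)).eq
  have hGx := hG.self_of_nhds
  simp only [metricVariation, fderiv_bilin_apply hg, e1, e2, e4, hGx, map_add]
  -- The second derivatives of `π` arising from `dN` and from the pulled-back metric agree by their
  -- symmetry.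
  rw [hs (fderiv ℝ P x X) (n x), hs (fderiv ℝ P x Y) (n x),
    hgs (fderiv ℝ π (P x) (fderiv ℝ P x Y)) (fderiv ℝ (fderiv ℝ π) (P x) (n x) (fderiv ℝ P x X))]
  ring

end SecondVariation

/-! ### The pullback of the metric to `ℂ⁴ ∖ {0}`. -/

namespace CP3

/-- The pullback of the nearly Kähler metric to `ℂ⁴ ∖ {0}`. -/
noncomputable def conicMetric (z u v : C4) : ℝ :=
  ((herm (lift1 z u) (lift1 z v)).re + 2 * (herm (lift2 z u) (lift2 z v)).re) / (herm z z).re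

theorem chartMetric_eq_conicMetric (k : Fin 4) (w X Y : C3) :
    chartMetric k w X Y = conicMetric (affineLift k w) (tangentLift k X) (tangentLift k Y) :=
  chartMetric_eq k w X Y

theorem lift1_self (z : C4) (a : ℂ) : lift1 z (a • z) = 0 := by
  simp [lift1, herm_smul_right, herm_quatJ_left]

theorem lift2_self (z : C4) (a : ℂ) : lift2 z (a • z) = 0 := by
  by_cases hz : herm z z = 0
  · have : z = 0 := herm_self_eq_zero (by rw [hz]; rfl)
    simp [this, lift2, lift1, horiz, herm]
  · rw [lift2, lift1_self, horiz, herm_smul_right, mul_div_cancel_right₀ _ hz, sub_self, sub_zero]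

theorem lift1_smul_smul {a : ℂ} (ha : a ≠ 0) (z u : C4) :
    lift1 (a • z) (a • u) = a • lift1 z u := by
  have ha' : (starRingEnd ℂ) a ≠ 0 := by simpa using ha
  simp only [lift1, quatJ_smul, herm_smul_left, herm_smul_right, smul_smul]
  congr 1
  simp
  field_simp

theorem lift2_smul_smul {a : ℂ} (ha : a ≠ 0) (z u : C4) :
    lift2 (a • z) (a • u) = a • lift2 z u := by
  have ha' : (starRingEnd ℂ) a ≠ 0 := by simpa using ha
  simp only [lift2, horiz, lift1_smul_smul ha, herm_smul_left, herm_smul_right, smul_smul, smul_sub]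
  congr 3
  simp
  field_simp

theorem conicMetric_smul {a : ℂ} (ha : a ≠ 0) (z u v : C4) :
    conicMetric (a • z) (a • u) (a • v) = conicMetric z u v := by
  have e : ∀ u v : C4, (herm (a • u) (a • v)).re = ‖a‖ ^ 2 * (herm u v).re := fun u v => by
    rw [herm_smul_left, herm_smul_right, ← mul_assoc, Complex.star_def,
      ← Complex.normSq_eq_conj_mul_self, Complex.normSq_eq_norm_sq, Complex.re_ofReal_mul]
  have hn : ‖a‖ ^ 2 ≠ 0 := by simpa using ha
  simp only [conicMetric, lift1_smul_smul ha, lift2_smul_smul ha, e]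
  rw [show ∀ A B : ℝ, ‖a‖ ^ 2 * A + 2 * (‖a‖ ^ 2 * B) = ‖a‖ ^ 2 * (A + 2 * B) from
    fun A B => by ring, mul_div_mul_left _ _ hn]

/-- The pullback is degenerate exactly along the fibre direction `ℂ z`, so lifts matter only modulo
multiples of `z`. -/
theorem conicMetric_add_left_self (z u v : C4) (a : ℂ) :
    conicMetric z (u + a • z) v = conicMetric z u v := by
  simp [conicMetric, lift1_add, lift2_add, lift1_self, lift2_self]

theorem conicMetric_add_right_self (z u v : C4) (a : ℂ) :
    conicMetric z u (v + a • z) = conicMetric z u v := by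
  simp [conicMetric, lift1_add, lift2_add, lift1_self, lift2_self]

theorem contDiffAt_affineCoord (k : Fin 4) {z : C4} (hz : z k ≠ 0) :
    ContDiffAt ℝ ∞ (affineCoord k) z := by
  refine contDiffAt_pi.2 fun i => ?_
  exact (contDiff_apply ℝ ℂ _).contDiffAt.mul ((contDiff_apply ℝ ℂ _).contDiffAt.inv hz)

theorem affineLift_affineCoord (k : Fin 4) {z : C4} (hz : z k ≠ 0) :
    affineLift k (affineCoord k z) = (z k)⁻¹ • z := by
  funext j
  rcases Fin.eq_self_or_eq_succAbove k j with rfl | ⟨i, rfl⟩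
  · simp [hz]
  · simp [affineCoord, div_eq_inv_mul]

theorem tangentLift_fderiv_affineCoord (k : Fin 4) {z : C4} (hz : z k ≠ 0) (u : C4) :
    tangentLift k (fderiv ℝ (affineCoord k) z u) =
      (z k)⁻¹ • u + (-(u k) * (z k)⁻¹ ^ 2) • z := by
  have hd := (contDiffAt_affineCoord k hz).differentiableAt (by simp)
  funext j
  rcases Fin.eq_self_or_eq_succAbove k j with rfl | ⟨i, rfl⟩
  · simp
    field_simp
    ring
  · rw [tangentLift_succAbove]
    have h1 : HasFDerivAt (fun z : C4 => z (k.succAbove i)) (ContinuousLinearMap.proj (R := ℝ) (φ := fun _ => ℂ) (k.succAbove i)) z :=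
      (ContinuousLinearMap.proj (R := ℝ) (φ := fun _ => ℂ) (k.succAbove i)).hasFDerivAt
    have h2 : HasFDerivAt (fun z : C4 => z k) (ContinuousLinearMap.proj (R := ℝ) (φ := fun _ => ℂ) k) z :=
      (ContinuousLinearMap.proj (R := ℝ) (φ := fun _ => ℂ) k).hasFDerivAt
    have h3 := h1.mul ((hasFDerivAt_inv' (𝕜 := ℝ) hz).comp z h2)
    have h4 : HasFDerivAt (fun z => affineCoord k z i) _ z := h3
    have h5 := hasFDerivAt_pi'.1 hd.hasFDerivAt i
    have h6 := DFunLike.congr_fun (h5.unique h4) u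
    simp at h6
    rw [h6]
    simp
    ring

/-- The metric `conicMetric` is the pullback of the nearly Kähler metric. -/
theorem conicMetric_eq_chartMetric (k : Fin 4) {z : C4} (hz : z k ≠ 0) (u v : C4) :
    conicMetric z u v = chartMetric k (affineCoord k z) (fderiv ℝ (affineCoord k) z u)
      (fderiv ℝ (affineCoord k) z v) := by
  have hz' : (z k)⁻¹ ≠ 0 := inv_ne_zero hz
  have e : ∀ u : C4, tangentLift k (fderiv ℝ (affineCoord k) z u) =
      (z k)⁻¹ • u + (-(u k) * (z k)⁻¹) • ((z k)⁻¹ • z) := fun u => by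
    rw [tangentLift_fderiv_affineCoord k hz, smul_smul]
    ring_nf
  rw [chartMetric_eq_conicMetric, affineLift_affineCoord k hz, e, e, conicMetric_add_left_self,
    conicMetric_add_right_self, conicMetric_smul hz']

end CP3


/-! ### Derivative of the pulled-back metric and the form `α(ξ, ·)`. -/

namespace CP3

theorem herm_sub_left (z z' v : C4) : herm (z - z') v = herm z v - herm z' v := by
  simp [herm, sub_mul, Finset.sum_sub_distrib]

/-- An expression in Hermitian products over powers of `|z|²`, suited to differentiation in the base
point. -/
theorem conicMetric_expand (z u v : C4) : conicMetric z u v =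
    2 * (herm u v).re / (herm z z).re - (2 * (star (herm z u) * herm z v).re +
      (star (herm (quatJ z) u) * herm (quatJ z) v).re) / (herm z z).re ^ 2 := by
  by_cases hz : herm z z = 0
  · simp [conicMetric, hz]
  have hd := herm_self z
  set d := (herm z z).re with hdd
  have hd0 : (d : ℂ) ≠ 0 := by rwa [← hd]
  have hd1 : d ≠ 0 := by exact_mod_cast hd0
  have hs : star (d : ℂ) = d := by simp
  have huz := star_herm z u
  have huj := star_herm (quatJ z) u
  have e1 : herm (lift1 z u) (lift1 z v) =
      star (herm (quatJ z) u) * herm (quatJ z) v / d := by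
    simp only [lift1, herm_smul_left, herm_smul_right, herm_quatJ_quatJ, hd, star_div₀, hs]
    field_simp
  have e2 : herm (lift2 z u) (lift2 z v) = herm u v - star (herm z u) * herm z v / d -
      star (herm (quatJ z) u) * herm (quatJ z) v / d := by
    simp only [lift2, horiz, lift1, herm_smul_left, herm_smul_right, herm_quatJ_quatJ, hd,
      star_div₀, hs, herm_sub_left, herm_sub_right, herm_quatJ_left, herm_quatJ_right, ← huz, ← huj]
    field_simp
    ring
  rw [conicMetric, e1, e2, ← hdd]
  simp only [Complex.sub_re, Complex.div_ofReal_re]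
  field_simp
  ring

theorem conicMetric_of_unit {p : C4} (hp : herm p p = 1) (u v : C4) : conicMetric p u v =
    2 * (herm u v).re - (2 * (star (herm p u) * herm p v).re +
      (star (herm (quatJ p) u) * herm (quatJ p) v).re) := by
  rw [conicMetric_expand, hp]
  simp

theorem conicMetric_comm (z u v : C4) : conicMetric z u v = conicMetric z v u := by
  rw [conicMetric_expand, conicMetric_expand, ← star_herm u v]
  simp
  ring

theorem contDiffAt_conicMetric {z : C4} (hz : z ≠ 0) (u v : C4) :
    ContDiffAt ℝ ∞ (fun z => conicMetric z u v) z := by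
  have hre : ∀ {f : C4 → ℂ}, ContDiffAt ℝ ∞ f z → ContDiffAt ℝ ∞ (fun w => (f w).re) z := fun hf =>
    Complex.reCLM.contDiff.contDiffAt.comp z hf
  have hst : ∀ {f : C4 → ℂ}, ContDiffAt ℝ ∞ f z → ContDiffAt ℝ ∞ (fun w => star (f w)) z :=
    fun hf => Complex.conjCLE.contDiff.contDiffAt.comp z hf
  have h0 : ContDiffAt ℝ ∞ (fun z : C4 => z) z := contDiffAt_id
  have hu : ∀ u, ContDiffAt ℝ ∞ (fun z => herm z u) z := fun u =>
    contDiffAt_herm h0 contDiffAt_const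
  have hj : ∀ u, ContDiffAt ℝ ∞ (fun z => herm (quatJ z) u) z := fun u =>
    contDiffAt_herm (contDiffAt_quatJ h0) contDiffAt_const
  have hd := hre (contDiffAt_herm h0 h0)
  have hne : (herm z z).re ≠ 0 := fun h => hz (herm_self_eq_zero h)
  simp only [conicMetric_expand]
  exact (contDiffAt_const.div hd hne).sub (((contDiffAt_const.mul (hre ((hst (hu u)).mul (hu v)))).add
    (hre ((hst (hj u)).mul (hj v)))).div (hd.pow 2) (pow_ne_zero 2 hne))

/-- The derivative of the metric in a horizontal direction at a point of `S⁷`. -/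
theorem fderiv_conicMetric {p n : C4} (hp : herm p p = 1) (hn : herm p n = 0) (u v : C4) :
    fderiv ℝ (fun z => conicMetric z u v) p n =
      -(2 * (star (herm n u) * herm p v + star (herm p u) * herm n v).re +
        (star (herm (quatJ n) u) * herm (quatJ p) v +
          star (herm (quatJ p) u) * herm (quatJ n) v).re) := by
  have hp0 : p ≠ 0 := by
    rintro rfl
    simp [herm] at hp
  have hn' : herm n p = 0 := by rw [← star_herm, hn, star_zero]
  have h1 := ((contDiffAt_conicMetric hp0 u v).differentiableAt (by simp)).hasFDerivAt
  have h2 : HasDerivAt (fun t : ℝ => p + t • n) n 0 := by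
    simpa using ((hasDerivAt_id (0 : ℝ)).smul_const n).const_add p
  have h3 : HasDerivAt (fun t : ℝ => conicMetric (p + t • n) u v)
      (fderiv ℝ (fun z => conicMetric z u v) p n) 0 := by
    have h1' : HasFDerivAt (fun z => conicMetric z u v)
      (fderiv ℝ (fun z => conicMetric z u v) p) (p + (0 : ℝ) • n) := by simpa using h1
    exact h1'.comp_hasDerivAt (0 : ℝ) h2
  have hl : ∀ (a b w : C4) (t : ℝ), herm (a + t • b) w = herm a w + t * herm b w :=
    fun a b w t => by
      have := herm_smul_left b w (t : ℂ)
      rw [herm_add_left]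
      congr 1
      simpa using this
  have hq : ∀ t : ℝ, quatJ (p + t • n) = quatJ p + t • quatJ n := fun t => by
    rw [quatJ_add, quatJ_real_smul]
  -- Since `n` is orthogonal to `p`, the squared length has no first order term, and the
  -- denominators do not contribute to the derivative.
  have hd : ∀ t : ℝ, (herm (p + t • n) (p + t • n)).re = 1 + t ^ 2 * (herm n n).re := fun t => by
    rw [hl, herm_add_right, herm_add_right, herm_real_smul_right, herm_real_smul_right, hp, hn, hn']
    simp
    ring
  let q : ℝ → ℝ := fun t => (2 * (star (herm p u + t * herm n u) * (herm p v + t * herm n v)).re +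
    (star (herm (quatJ p) u + t * herm (quatJ n) u) *
      (herm (quatJ p) v + t * herm (quatJ n) v)).re)
  have hqd : HasDerivAt q (2 * (star (herm n u) * herm p v + star (herm p u) * herm n v).re +
        (star (herm (quatJ n) u) * herm (quatJ p) v +
          star (herm (quatJ p) u) * herm (quatJ n) v).re) 0 := by
    have hq2 : ∀ a b a' b' : ℂ, HasDerivAt
        (fun t : ℝ => (star (a + t * b) * (a' + t * b')).re)
        (star b * a' + star a * b').re 0 := fun a b a' b' => by
      have e : (fun t : ℝ => (star (a + t * b) * (a' + t * b')).re) =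
          fun t : ℝ => (star a * a').re + t * (star b * a' + star a * b').re +
            t ^ 2 * (star b * b').re := by
        funext t
        simp
        ring
      rw [e]
      have := (((hasDerivAt_id (0 : ℝ)).mul_const (star b * a' + star a * b').re).const_add
        ((star a * a').re)).fun_add (((hasDerivAt_id (0 : ℝ)).pow 2).mul_const (star b * b').re)
      simpa using this
    exact ((hq2 _ _ _ _).const_mul 2).add (hq2 _ _ _ _)
  have hD : HasDerivAt (fun t : ℝ => 1 + t ^ 2 * (herm n n).re) 0 0 := by
    simpa using (((hasDerivAt_id (0 : ℝ)).pow 2).mul_const (herm n n).re).const_add 1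
  have h4 : HasDerivAt (fun t : ℝ => conicMetric (p + t • n) u v)
      (-(2 * (star (herm n u) * herm p v + star (herm p u) * herm n v).re +
        (star (herm (quatJ n) u) * herm (quatJ p) v +
          star (herm (quatJ p) u) * herm (quatJ n) v).re)) 0 := by
    have e : (fun t : ℝ => conicMetric (p + t • n) u v) = fun t =>
        2 * (herm u v).re / (1 + t ^ 2 * (herm n n).re) -
          q t / (1 + t ^ 2 * (herm n n).re) ^ 2 := by
      funext t
      rw [conicMetric_expand, hd, hq, hl, hl, hl, hl]
    rw [e]
    have := ((hasDerivAt_const (0 : ℝ) (2 * (herm u v).re)).fun_div hD (by simp)).fun_sub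
      (hqd.fun_div (hD.fun_pow 2) (by simp))
    simpa using this
  exact h3.unique h4

variable {V : Type*} [NormedAddCommGroup V] [NormedSpace ℝ V]

/-- Along an adapted frame the second fundamental form of the structure vector is `formOmega`. -/
theorem AdaptedFrame.second_form {U : Set V} {p r : V → C4} {s c : V → ℝ}
    (F : AdaptedFrame U p r s c) {x : V} (hx : x ∈ U) {ξ : V} {a : ℂ}
    (hξ : fderiv ℝ p x ξ = Complex.I • ((c x / 2 : ℝ) • r x) -
      Complex.I • (s x • quatJ (p x)) + a • p x) (Y : V) :
    conicMetric (p x) (fderiv ℝ p x ξ) (fderiv ℝ p x Y) = formEta p r s c x Y ∧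
    metricVariation conicMetric p (fun y => s y • quatJ (p y) + (c y / 2) • r y) x ξ Y =
      -2 * formOmega p r s c x Y := by
  have hp := F.smooth_p x hx
  have hr := F.smooth_r x hx
  have hs := F.smooth_s x hx
  have hc := F.smooth_c x hx
  have hjp := contDiffAt_quatJ hp
  have hpp := F.herm_p x hx
  have hrr := F.herm_r x hx
  have hpr := F.herm_p_r x hx
  have hjpr := F.herm_jp_r x hx
  have hE := herm_expand hpp hrr hpr hjpr
  have hJ := herm_quatJ_expand hpp hrr hpr hjpr
  have s2 := F.sq_add_sq x hx
  -- The symmetry relation with `ξ` in one slot trades the values of `θ, χ, e₁, e₂` at `ξ` for those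
  -- of `ω`.
  have hN := F.ext_normal hx ξ Y
  obtain ⟨y1, y2, y3, y4, y5, y6, y7, y8⟩ := F.values hx Y
  obtain ⟨x1, x2, x3, x4, x5, x6, x7, x8⟩ := F.values hx ξ
  have hrp : herm (r x) (p x) = 0 := by rw [← star_herm, hpr, star_zero]
  have hrjp : herm (r x) (quatJ (p x)) = 0 := by rw [← star_herm, hjpr, star_zero]
  have hjrp : herm (quatJ (r x)) (p x) = 0 := by rw [herm_quatJ_comm, hjpr, neg_zero]
  have hjrjp : herm (quatJ (r x)) (quatJ (p x)) = 0 := by rw [herm_quatJ_quatJ', hrp, star_zero]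
  have hjj : herm (quatJ (p x)) (quatJ (p x)) = 1 := by rw [herm_quatJ_quatJ', hpp, star_one]
  have hcr : ∀ (z v : C4) (b : ℝ), herm z (b • v) = b * herm z v := fun z v b =>
    herm_real_smul_right z v b
  have ξ2 : herm (quatJ (p x)) (fderiv ℝ p x ξ) = ⟨0, -s x⟩ := by
    rw [hξ]
    simp only [herm_add_right, herm_sub_right, herm_smul_right, hcr, hjj, hjpr, herm_quatJ_left]
    apply Complex.ext <;> simp
  have ξ3 : herm (r x) (fderiv ℝ p x ξ) = ⟨0, c x⟩ := by
    rw [hξ]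
    simp only [herm_add_right, herm_sub_right, herm_smul_right, hcr, hrr, hrjp, hrp]
    apply Complex.ext <;> simp
  have ξ4 : herm (quatJ (r x)) (fderiv ℝ p x ξ) = 0 := by
    rw [hξ]
    simp only [herm_add_right, herm_sub_right, herm_smul_right, hcr, herm_quatJ_left, hjrjp, hjrp]
    simp
  rw [ξ2] at x2
  rw [ξ3] at x3
  rw [ξ4] at x4
  rw [Complex.ext_iff] at x2 x3 x4
  simp at x2 x3 x4
  -- The vector `ξ` is the first one of the dual frame: `η` is 1 on it and the other four forms
  -- vanish.
  have k1 : formKappa₁ p r s c x ξ = 0 := x2.1.resolve_left (F.c_pos x hx).ne'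
  have et : formEta p r s c x ξ = 1 := by
    linear_combination (1 - formEta p r s c x ξ) * s2 + s x * x2.2 - c x * x3.2
  have k2 : formKappa₂ p r s c x ξ = 0 := by
    linear_combination (- formKappa₂ p r s c x ξ) * s2 + c x * x2.2 + s x * x3.2
  have g1 : formGamma₁ p r x ξ = 0 := x4.1.symm
  have g2 : formGamma₂ p r x ξ = 0 := x4.2.symm
  have hNd : ∀ X, fderiv ℝ (fun y => s y • quatJ (p y) + (c y / 2) • r y) x X =
      (c x * formTheta s c x X) • quatJ (p x) + s x • quatJ (fderiv ℝ p x X) +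
        (-(s x * formTheta s c x X) / 2) • r x + (c x / 2) • fderiv ℝ r x X := fun X => by
    have d1 := (hs.differentiableAt (by simp)).hasFDerivAt
    have d2 := (hc.differentiableAt (by simp)).hasFDerivAt
    have d3 := (hjp.differentiableAt (by simp)).hasFDerivAt
    have d4 := (hr.differentiableAt (by simp)).hasFDerivAt
    have d5 := (d1.fun_smul d3).fun_add ((d2.mul_const (1 / 2)).fun_smul d4)
    have e : (fun y => s y • quatJ (p y) + (c y / 2) • r y) =
        fun y => s y • quatJ (p y) + (c y * (1 / 2)) • r y := by
      funext y
      rw [mul_one_div]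
    rw [e, d5.fderiv]
    simp only [add_apply, smul_apply, ContinuousLinearMap.smulRight_apply, smul_eq_mul,
      fderiv_quatJ (hp.differentiableAt (by simp)), F.fderiv_s hx]
    module
  set n := s x • quatJ (p x) + (c x / 2) • r x with hn
  have hpn : herm (p x) n = 0 := by
    simp [hn, herm_add_right, hcr, herm_quatJ_right, hpr]
  have hjpn : herm (quatJ (p x)) n = s x := by
    simp [hn, herm_add_right, hcr, hjj, hjpr]
  have hrn : herm (r x) n = c x := by
    simp [hn, herm_add_right, hcr, hrjp, hrr]
  have hjrn : herm (quatJ (r x)) n = 0 := by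
    simp [hn, herm_add_right, hcr, hjrjp, herm_quatJ_left]
  constructor
  · rw [conicMetric_of_unit hpp, hE (fderiv ℝ p x ξ)]
    simp only [x1, ξ2, ξ3, ξ4, y1, y2, y3, y4]
    simp
    grind
  · rw [metricVariation, fderiv_conicMetric hpp hpn, conicMetric_of_unit hpp,
      conicMetric_of_unit hpp, hNd, hNd, hE (fderiv ℝ p x ξ), hE (fderiv ℝ p x Y),
      hE n, hE n, hJ n, hJ n]
    simp only [herm_add_right, hcr, herm_left_quatJ (p x), herm_left_quatJ (r x),
      herm_quatJ_quatJ', hpn, hjpn, hrn, hjrn, hpr,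
      hpp, hrr, hjpr, hjrp, herm_quatJ_left, hjrjp,
      y1, y2, y3, y4, y5, y6, y7, y8, x1, ξ2, ξ3, ξ4, x5, x6, x7, x8]
    simp [wedge, k1, k2, g1, g2, et] at hN ⊢
    grind

end CP3


/-! ### Lifts to `S⁷` and change of coordinates. -/

namespace CP3

/-- The nearly Kähler metric in a chart as a continuous bilinear form. -/
noncomputable def chartMetricL (k : Fin 4) (w : C3) : C3 →L[ℝ] C3 →L[ℝ] ℝ :=
  LinearMap.toContinuousBilinearMap (chartMetricForm k w)

@[simp] theorem chartMetricL_apply (k : Fin 4) (w X Y : C3) :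
    chartMetricL k w X Y = chartMetric k w X Y := rfl

theorem differentiable_chartMetricL (k : Fin 4) : Differentiable ℝ (chartMetricL k) := by
  have h : ContDiff ℝ 1 (chartMetricL k) := by
    refine contDiff_clm_apply_iff.2 fun X => contDiff_clm_apply_iff.2 fun Y => ?_
    exact contDiff_chartMetric k X Y
  exact h.differentiable one_ne_zero

theorem fderiv_affineCoord (k : Fin 4) {z : C4} (hz : z k ≠ 0) (u : C4) :
    fderiv ℝ (affineCoord k) z u = dproj k (affineCoord k z) ((z k)⁻¹ • u) := by
  funext i
  have h := congrFun (tangentLift_fderiv_affineCoord k hz u) (k.succAbove i)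
  rw [tangentLift_succAbove] at h
  rw [h]
  simp [dproj, affineCoord]
  field_simp
  ring

theorem dproj_smul_self (k : Fin 4) {z : C4} (hz : z k ≠ 0) (a : ℂ) :
    dproj k (affineCoord k z) (a • z) = 0 := by
  funext i
  simp only [dproj, affineCoord, Pi.smul_apply, smul_eq_mul, Pi.zero_apply]
  field_simp
  ring

/-- The structure vector `J N` in terms of lifts. -/
theorem exists_of_fderiv_eq_chartJ (k : Fin 4) {p n v : C4} (hk : p k ≠ 0) (hp : herm p p = 1)
    (hpn : herm p n = 0) (h : fderiv ℝ (affineCoord k) p v =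
      chartJ k (affineCoord k p) (fderiv ℝ (affineCoord k) p n)) :
    ∃ a : ℂ, v = Complex.I • (n - herm (quatJ p) n • quatJ p) -
      Complex.I • (herm (quatJ p) n • quatJ p) + a • p := by
  have hk' : (p k)⁻¹ ≠ 0 := inv_ne_zero hk
  rw [chartJ, chartP_eq, chartJ1, affineLift_affineCoord k hk, fderiv_affineCoord k hk] at h
  have h1 := congrArg (tangentLift k) h
  rw [tangentLift_dproj, tangentLift_dproj, tangentLift_dproj, affineLift_affineCoord k hk,
    tangentLift_fderiv_affineCoord k hk] at h1
  -- Normalizing the lift in the affine chart only adds multiples of `p`, which `lift1` and `lift2`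
  -- annihilate.
  have e : ∃ b : ℂ, (Complex.I • ((p k)⁻¹ • n + (-(n k) * (p k)⁻¹ ^ 2) • p) -
      (Complex.I • ((p k)⁻¹ • n + (-(n k) * (p k)⁻¹ ^ 2) • p)) k • (p k)⁻¹ • p) =
      (p k)⁻¹ • (Complex.I • n) + b • ((p k)⁻¹ • p) := by
    refine ⟨p k * (Complex.I * (-(n k) * (p k)⁻¹ ^ 2) -
      ((Complex.I • ((p k)⁻¹ • n + (-(n k) * (p k)⁻¹ ^ 2) • p)) k * (p k)⁻¹)), ?_⟩
    funext i
    simp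
    field_simp
    ring
  obtain ⟨b, hb⟩ := e
  rw [hb, lift2_add, lift1_add, lift2_self, lift1_self, add_zero, add_zero,
    lift1_smul_smul hk', lift2_smul_smul hk', ← smul_sub] at h1
  have e1 : lift1 p (Complex.I • n) = Complex.I • (herm (quatJ p) n • quatJ p) := by
    simp [lift1, hp, herm_smul_right, smul_smul]
  have e2 : lift2 p (Complex.I • n) = Complex.I • (n - herm (quatJ p) n • quatJ p) := by
    rw [lift2, e1, horiz, herm_smul_right, hpn]
    simp [smul_sub]
  rw [e1, e2] at h1
  set m := Complex.I • (n - herm (quatJ p) n • quatJ p) -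
      Complex.I • (herm (quatJ p) n • quatJ p)
  refine ⟨(p k)⁻¹ * v k - (p k)⁻¹ * m k, ?_⟩
  have h2 := congrArg (fun u => p k • u) h1
  simp only [smul_sub, smul_smul, mul_inv_cancel₀ hk, one_smul] at h2
  have h3 : v = m - (p k * (((p k)⁻¹ • m) k * (p k)⁻¹)) • p +
      (p k * (((p k)⁻¹ • v) k * (p k)⁻¹)) • p := by
    rw [← h2]
    abel
  rw [h3]
  funext i
  simp
  field_simp
  ring

variable {M : Type*} [TopologicalSpace M] [ChartedSpace (EuclideanSpace ℝ (Fin 5)) M]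

/-- A local lift to `S⁷` of a map to `ℂP³`, read in the preferred chart at `x₀`. -/
structure LocalLift (f : M → CP3) (x₀ : M) (U : Set (EuclideanSpace ℝ (Fin 5)))
    (p : EuclideanSpace ℝ (Fin 5) → C4) : Prop where
  isOpen : IsOpen U
  subset : U ⊆ (extChartAt (𝓡 5) x₀).target
  smooth_p : ∀ y ∈ U, ContDiffAt ℝ ∞ p y
  herm_p : ∀ y ∈ U, herm (p y) (p y) = 1
  mk_p : ∀ y ∈ U, ∀ h : p y ≠ 0, mk ⟨p y, h⟩ = f ((extChartAt (𝓡 5) x₀).symm y)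

theorem LocalLift.ne_zero {f : M → CP3} {x₀ : M} {U : Set (EuclideanSpace ℝ (Fin 5))}
    {p : EuclideanSpace ℝ (Fin 5) → C4} (H : LocalLift f x₀ U p)
    {y : EuclideanSpace ℝ (Fin 5)} (hy : y ∈ U) : p y ≠ 0 := fun h => by
  have := H.herm_p y hy
  simp [h, herm] at this

theorem mfderiv_apply_eq {f : M → CP3} (hf : IsHypersurface f) (q : M)
    (X : EuclideanSpace ℝ (Fin 5)) : @Eq C3 (mfderiv (𝓡 5) 𝓘(ℝ, C3) f q X)
      (fderiv ℝ (localMap f q) (extChartAt (𝓡 5) q q) X) := by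
  have h1 := ((hf.contMDiff q).mdifferentiableAt (by simp)).mfderiv
  have h2 : fderivWithin ℝ (localMap f q) (Set.range (𝓡 5)) (extChartAt (𝓡 5) q q) =
      fderiv ℝ (localMap f q) (extChartAt (𝓡 5) q q) := by
    rw [ModelWithCorners.range_eq_univ, fderivWithin_univ]
  exact DFunLike.congr_fun (h1.trans h2) X

theorem contDiffAt_localMap {f : M → CP3} (hf : IsHypersurface f) (q : M) :
    ContDiffAt ℝ ∞ (localMap f q) (extChartAt (𝓡 5) q q) := by
  have h := (contMDiffAt_iff.1 (hf.contMDiff q)).2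
  rw [ModelWithCorners.range_eq_univ, contDiffWithinAt_univ] at h
  exact h

theorem fderiv_comp_affineCoord {k : Fin 4} {E : Type*} [NormedAddCommGroup E] [NormedSpace ℝ E]
    {F : E → C3} {p : E → C4} {T : E → E} {u y : E}
    (he : F =ᶠ[nhds u] fun u => affineCoord k (p (T u))) (hTu : T u = y) (hk : p y k ≠ 0)
    (hp : ContDiffAt ℝ ∞ p y) (hT : DifferentiableAt ℝ T u) (X : E) :
    fderiv ℝ F u X = fderiv ℝ (affineCoord k) (p y) (fderiv ℝ p y (fderiv ℝ T u X)) := by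
  subst hTu
  have h1 : HasFDerivAt (fun u => p (T u)) _ u :=
    (hp.differentiableAt (by simp)).hasFDerivAt.comp u hT.hasFDerivAt
  have h : HasFDerivAt (fun u => affineCoord k (p (T u))) _ u :=
    HasFDerivAt.comp (g := affineCoord k) u
      ((contDiffAt_affineCoord k hk).differentiableAt (by simp)).hasFDerivAt h1
  rw [he.fderiv_eq, h.fderiv]
  rfl

/-- The differential of `f` factors through that of `T`, so the latter is injective, hence
surjective by equality of dimensions. This lets every direction in the chart at `x₀` be pulled back
to the preferred chart at `q`. -/
theorem LocalLift.surjective_transition {f : M → CP3} (hf : IsHypersurface f) {x₀ : M}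
    {U : Set (EuclideanSpace ℝ (Fin 5))} {p : EuclideanSpace ℝ (Fin 5) → C4}
    (H : LocalLift f x₀ U p) {y : EuclideanSpace ℝ (Fin 5)} (hy : y ∈ U) {q : M}
    {T : EuclideanSpace ℝ (Fin 5) → EuclideanSpace ℝ (Fin 5)}
    (hk : p y (chartIndex (f q)) ≠ 0)
    (hTy : T (extChartAt (𝓡 5) q q) = y) (hT : ContDiffAt ℝ ∞ T (extChartAt (𝓡 5) q q))
    (he : localMap f q =ᶠ[nhds (extChartAt (𝓡 5) q q)]
        fun u => affineCoord (chartIndex (f q)) (p (T u))) :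
    Function.Surjective (fderiv ℝ T (extChartAt (𝓡 5) q q)) := by
  have hinj : Function.Injective (fderiv ℝ T (extChartAt (𝓡 5) q q)) := by
    intro X Y hXY
    refine hf.injective_mfderiv q ((mfderiv_apply_eq hf q X).trans
      (Eq.trans ?_ (mfderiv_apply_eq hf q Y).symm))
    rw [fderiv_comp_affineCoord he hTy hk (H.smooth_p _ hy) (hT.differentiableAt (by simp)),
      fderiv_comp_affineCoord he hTy hk (H.smooth_p _ hy) (hT.differentiableAt (by simp)), hXY]
  exact LinearMap.surjective_of_injective
    (f := (fderiv ℝ T (extChartAt (𝓡 5) q q)).toLinearMap) hinj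

variable [IsManifold (𝓡 5) ∞ M]

/-- The map in preferred coordinates in terms of a local lift. -/
theorem LocalLift.exists_transition {f : M → CP3} {x₀ : M}
    {U : Set (EuclideanSpace ℝ (Fin 5))} {p : EuclideanSpace ℝ (Fin 5) → C4}
    (H : LocalLift f x₀ U p) {y : EuclideanSpace ℝ (Fin 5)} (hy : y ∈ U) {q : M}
    (hq : (extChartAt (𝓡 5) x₀).symm y = q) :
    p y (chartIndex (f q)) ≠ 0 ∧
    ∃ T : EuclideanSpace ℝ (Fin 5) → EuclideanSpace ℝ (Fin 5),
      T (extChartAt (𝓡 5) q q) = y ∧ ContDiffAt ℝ ∞ T (extChartAt (𝓡 5) q q) ∧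
      localMap f q =ᶠ[nhds (extChartAt (𝓡 5) q q)]
        fun u => affineCoord (chartIndex (f q)) (p (T u)) := by
  have hyt := H.subset hy
  have hqs : q ∈ (extChartAt (𝓡 5) x₀).source := by
    rw [← hq]
    exact (extChartAt (𝓡 5) x₀).map_target hyt
  have hTy : extChartAt (𝓡 5) x₀ ((extChartAt (𝓡 5) q).symm (extChartAt (𝓡 5) q q)) = y := by
    rw [extChartAt_to_inv, ← hq]
    exact (extChartAt (𝓡 5) x₀).right_inv hyt
  have hT : ContDiffAt ℝ ∞ (extChartAt (𝓡 5) x₀ ∘ (extChartAt (𝓡 5) q).symm)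
      (extChartAt (𝓡 5) q q) := by
    have h := contDiffWithinAt_ext_coord_change (I := 𝓡 5) (n := ∞) x₀ q
      (y := extChartAt (𝓡 5) q q) (by
        rw [PartialEquiv.trans_source]
        refine ⟨mem_extChartAt_target q, ?_⟩
        simpa using hqs)
    rwa [ModelWithCorners.range_eq_univ, contDiffWithinAt_univ] at h
  refine ⟨?_, _, hTy, hT, ?_⟩
  · rw [← mk_mem_affinePiece _ ⟨p y, H.ne_zero hy⟩, H.mk_p y hy, hq]
    exact Classical.choose_spec (exists_mem_affinePiece (f q))
  · have h1 : ∀ᶠ u in nhds (extChartAt (𝓡 5) q q),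
        (extChartAt (𝓡 5) x₀ ∘ (extChartAt (𝓡 5) q).symm) u ∈ U := by
      apply hT.continuousAt.eventually_mem
      rw [Function.comp_apply, hTy]
      exact H.isOpen.mem_nhds hy
    have h2 : ∀ᶠ u in nhds (extChartAt (𝓡 5) q q),
        (extChartAt (𝓡 5) q).symm u ∈ (extChartAt (𝓡 5) x₀).source := by
      apply (continuousAt_extChartAt_symm (I := 𝓡 5) q).eventually_mem
      rw [extChartAt_to_inv]
      exact (isOpen_extChartAt_source (I := 𝓡 5) x₀).mem_nhds hqs
    filter_upwards [h1, h2] with u hu hu'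
    have h3 := H.mk_p _ hu (H.ne_zero hu)
    simp only [Function.comp_apply] at h3
    rw [(extChartAt (𝓡 5) x₀).left_inv hu'] at h3
    have h4 : localMap f q u = coord (chartIndex (f q)) (f ((extChartAt (𝓡 5) q).symm u)) := rfl
    rw [h4, ← h3]
    rfl

/-- If `dp X` lies in the fibre direction, its projection, which is the differential of `f` on `X`,
is zero. -/
theorem LocalLift.immersion {f : M → CP3} (hf : IsHypersurface f) {x₀ : M}
    {U : Set (EuclideanSpace ℝ (Fin 5))} {p : EuclideanSpace ℝ (Fin 5) → C4}
    (H : LocalLift f x₀ U p) {y : EuclideanSpace ℝ (Fin 5)} (hy : y ∈ U)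
    {X : EuclideanSpace ℝ (Fin 5)} {a : ℂ} (hX : fderiv ℝ p y X = a • p y) : X = 0 := by
  obtain ⟨q, hq⟩ : ∃ q, (extChartAt (𝓡 5) x₀).symm y = q := ⟨_, rfl⟩
  obtain ⟨hk, T, hTy, hT, he⟩ := H.exists_transition hy hq
  obtain ⟨X, rfl⟩ := H.surjective_transition hf hy hk hTy hT he X
  have h1 := fderiv_comp_affineCoord he hTy hk (H.smooth_p _ hy) (hT.differentiableAt (by simp)) X
  rw [hX, fderiv_affineCoord _ hk] at h1
  have h3 : X = 0 := by
    refine hf.injective_mfderiv q ((mfderiv_apply_eq hf q X).trans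
      (Eq.trans ?_ (map_zero (mfderiv (𝓡 5) 𝓘(ℝ, C3) f q)).symm))
    rw [h1, smul_smul]
    exact dproj_smul_self _ hk _
  rw [h3, map_zero]

end CP3


/-! ### The Hopf condition for a lifted normal field. -/

namespace CP3

variable {M : Type*} [TopologicalSpace M] [ChartedSpace (EuclideanSpace ℝ (Fin 5)) M]

/-- A local lift together with a horizontal lift `n` of a unit normal field. -/
structure NormalLift (f : M → CP3) (x₀ : M) (U : Set (EuclideanSpace ℝ (Fin 5)))
    (p n : EuclideanSpace ℝ (Fin 5) → C4) : Prop extends LocalLift f x₀ U p where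
  smooth_n : ∀ y ∈ U, ContDiffAt ℝ ∞ n y
  herm_p_n : ∀ y ∈ U, herm (p y) (n y) = 0
  unit_n : ∀ y ∈ U, conicMetric (p y) (n y) (n y) = 1
  normal_n : ∀ y ∈ U, ∀ Y, conicMetric (p y) (fderiv ℝ p y Y) (n y) = 0

theorem metricVariation_congr {E W : Type*} [NormedAddCommGroup E] [NormedSpace ℝ E]
    [NormedAddCommGroup W] [NormedSpace ℝ W] {g : W → W → W → ℝ} {F F' N : E → W} {x : E}
    (h : F =ᶠ[nhds x] F') (X Y : E) :
    metricVariation g F N x X Y = metricVariation g F' N x X Y := by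
  rw [metricVariation, metricVariation, h.fderiv_eq, h.eq_of_nhds]

theorem metricVariation_comp_right {E E' W : Type*} [NormedAddCommGroup E] [NormedSpace ℝ E]
    [NormedAddCommGroup E'] [NormedSpace ℝ E']
    [NormedAddCommGroup W] [NormedSpace ℝ W] (g : W → W → W → ℝ) {F N : E → W} {T : E' → E}
    {x : E'} {y : E} (hT : T x = y) (hd : DifferentiableAt ℝ T x) (hF : DifferentiableAt ℝ F y)
    (hN : DifferentiableAt ℝ N y) (X Y : E') :
    metricVariation g (fun u => F (T u)) (fun u => N (T u)) x X Y =
      metricVariation g F N y (fderiv ℝ T x X) (fderiv ℝ T x Y) := by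
  subst hT
  have h1 : HasFDerivAt (fun u => F (T u)) _ x := hF.hasFDerivAt.comp x hd.hasFDerivAt
  have h2 : HasFDerivAt (fun u => N (T u)) _ x := hN.hasFDerivAt.comp x hd.hasFDerivAt
  rw [metricVariation, metricVariation, h1.fderiv, h2.fderiv]
  rfl

theorem coord_eq_of_mk {k : Fin 4} {z : C4} {h : z ≠ 0} {q : CP3} (hz : mk ⟨z, h⟩ = q) :
    coord k q = affineCoord k z := by
  rw [← hz]
  rfl

/-- The second fundamental form as a variation of the induced metric. -/
theorem secondFundamentalForm_eq {f : M → CP3} (hf : IsHypersurface f) (q : M)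
    {N : EuclideanSpace ℝ (Fin 5) → C3}
    (hN : DifferentiableAt ℝ N (extChartAt (𝓡 5) q q))
    (hn : ∀ᶠ u in nhds (extChartAt (𝓡 5) q q), ∀ Y, chartMetric (chartIndex (f q))
      (localMap f q u) (fderiv ℝ (localMap f q) u Y) (N u) = 0) (X Y : EuclideanSpace ℝ (Fin 5)) :
    secondFundamentalForm f q (N (extChartAt (𝓡 5) q q)) X Y =
      -1 / 2 * metricVariation (chartMetric (chartIndex (f q))) (localMap f q) N
        (extChartAt (𝓡 5) q q) X Y := by
  have hw : localMap f q (extChartAt (𝓡 5) q q) = coord (chartIndex (f q)) (f q) := by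
    have : localMap f q (extChartAt (𝓡 5) q q) = coord (chartIndex (f q))
        (f ((extChartAt (𝓡 5) q).symm (extChartAt (𝓡 5) q q))) := rfl
    rw [this, extChartAt_to_inv]
  have h := bilin_second_deriv_eq (g := chartMetricL (chartIndex (f q))) (F := localMap f q) (N := N)
    (differentiable_chartMetricL _ _) (contDiffAt_localMap hf q) hN hn X Y
  have e : secondFundamentalForm f q (N (extChartAt (𝓡 5) q q)) X Y =
      chartMetric (chartIndex (f q)) (coord (chartIndex (f q)) (f q))
      (fderiv ℝ (fun y => fderiv ℝ (localMap f q) y Y) (extChartAt (𝓡 5) q q) X +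
        christoffel (chartIndex (f q)) (localMap f q (extChartAt (𝓡 5) q q))
          (fderiv ℝ (localMap f q) (extChartAt (𝓡 5) q q) X)
          (fderiv ℝ (localMap f q) (extChartAt (𝓡 5) q q) Y)) (N (extChartAt (𝓡 5) q q)) := rfl
  rw [e, ← hw, chartMetric_symm, chartMetric_add_right, chartMetric_symm, chartMetric_symm _ _ (N _),
    chartMetric_christoffel]
  exact h

/-- The Hopf condition in preferred coordinates. -/
theorem IsHopf.exists_localMap {f : M → CP3} (hf : IsHypersurface f) (hHopf : IsHopf f) (q : M)
    (N : C3) (h1 : chartMetric (chartIndex (f q)) (coord (chartIndex (f q)) (f q)) N N = 1)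
    (h2 : ∀ X, chartMetric (chartIndex (f q)) (coord (chartIndex (f q)) (f q))
      (fderiv ℝ (localMap f q) (extChartAt (𝓡 5) q q) X) N = 0) :
    ∃ (ξ : EuclideanSpace ℝ (Fin 5)) (μ : ℝ),
      fderiv ℝ (localMap f q) (extChartAt (𝓡 5) q q) ξ =
        chartJ (chartIndex (f q)) (coord (chartIndex (f q)) (f q)) N ∧
      ∀ Y : EuclideanSpace ℝ (Fin 5), secondFundamentalForm f q N ξ Y =
        μ * chartMetric (chartIndex (f q)) (coord (chartIndex (f q)) (f q))
          (fderiv ℝ (localMap f q) (extChartAt (𝓡 5) q q) ξ)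
          (fderiv ℝ (localMap f q) (extChartAt (𝓡 5) q q) Y) := by
  have hm : ∀ X Y : EuclideanSpace ℝ (Fin 5), metric (f q) (mfderiv (𝓡 5) 𝓘(ℝ, C3) f q X)
      (mfderiv (𝓡 5) 𝓘(ℝ, C3) f q Y) = chartMetric (chartIndex (f q))
        (coord (chartIndex (f q)) (f q)) (fderiv ℝ (localMap f q) (extChartAt (𝓡 5) q q) X)
          (fderiv ℝ (localMap f q) (extChartAt (𝓡 5) q q) Y) := fun X Y => by
    rw [← mfderiv_apply_eq hf q X, ← mfderiv_apply_eq hf q Y]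
    rfl
  have hunit : IsUnitNormal f q N := by
    refine ⟨h1, fun X => (Eq.trans ?_ (h2 X))⟩
    exact congrArg (fun v => chartMetric (chartIndex (f q)) (coord (chartIndex (f q)) (f q)) v N)
      (mfderiv_apply_eq hf q X)
  obtain ⟨A, ξ, μ, hA, hξ, hev⟩ := hHopf q N hunit
  refine ⟨ξ, μ, (mfderiv_apply_eq hf q ξ).symm.trans hξ, fun Y => ?_⟩
  have h := hA ξ Y
  rw [hev.apply_eq_smul] at h
  have e : fderiv ℝ (localMap f q) (extChartAt (𝓡 5) q q) (μ • ξ : EuclideanSpace ℝ (Fin 5)) =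
      μ • fderiv ℝ (localMap f q) (extChartAt (𝓡 5) q q) ξ := map_smul _ _ _
  refine h.symm.trans ((hm (μ • ξ : EuclideanSpace ℝ (Fin 5)) Y).trans ?_)
  rw [e, chartMetric_symm, chartMetric_smul_right, chartMetric_symm]

variable [IsManifold (𝓡 5) ∞ M]

/-- The Hopf condition in terms of lifts. -/
theorem NormalLift.hopf {f : M → CP3} (hf : IsHypersurface f) (hHopf : IsHopf f) {x₀ : M}
    {U : Set (EuclideanSpace ℝ (Fin 5))} {p n : EuclideanSpace ℝ (Fin 5) → C4}
    (H : NormalLift f x₀ U p n) {y : EuclideanSpace ℝ (Fin 5)} (hy : y ∈ U) :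
    ∃ (ξ : EuclideanSpace ℝ (Fin 5)) (μ : ℝ) (a : ℂ),
      fderiv ℝ p y ξ = Complex.I • (n y - herm (quatJ (p y)) (n y) • quatJ (p y)) -
        Complex.I • (herm (quatJ (p y)) (n y) • quatJ (p y)) + a • p y ∧
      ∀ Y, -1 / 2 * metricVariation conicMetric p n y ξ Y =
        μ * conicMetric (p y) (fderiv ℝ p y ξ) (fderiv ℝ p y Y) := by
  obtain ⟨q, hq⟩ : ∃ q, (extChartAt (𝓡 5) x₀).symm y = q := ⟨_, rfl⟩
  -- The shape operator at `q` is expressed in the charts preferred at `q` and `f q`, the lift in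
  -- the chart at `x₀`; `T` is the coordinate change between them.
  obtain ⟨hk, T, hTy, hT, he⟩ := H.exists_transition hy hq
  have hsurj := H.surjective_transition hf hy hk hTy hT he
  have hw : coord (chartIndex (f q)) (f q) = affineCoord (chartIndex (f q)) (p y) :=
    coord_eq_of_mk ((H.mk_p y hy (H.ne_zero hy)).trans (by rw [hq]))
  set k := chartIndex (f q) with hkdef
  set x := extChartAt (𝓡 5) q q with hx
  have hTd := hT.differentiableAt (by simp)
  have hpy := H.smooth_p y hy
  have hny := H.smooth_n y hy
  have hder : ∀ X, fderiv ℝ (localMap f q) x X =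
      fderiv ℝ (affineCoord k) (p y) (fderiv ℝ p y (fderiv ℝ T x X)) := fun X =>
    fderiv_comp_affineCoord he hTy hk hpy hTd X
  let N : EuclideanSpace ℝ (Fin 5) → C3 := fun u => fderiv ℝ (affineCoord k) (p (T u)) (n (T u))
  have hNx : N x = fderiv ℝ (affineCoord k) (p y) (n y) := by simp only [N, hTy]
  obtain ⟨ξ, μ, hξ, hμ⟩ := hHopf.exists_localMap hf q (N x) (by
      rw [← hkdef, hw, hNx, ← conicMetric_eq_chartMetric k hk]
      exact H.unit_n y hy) (fun X => by
      rw [← hkdef, hw, hNx, ← hx, hder, ← conicMetric_eq_chartMetric k hk]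
      exact H.normal_n y hy _)
  have hpT : ContDiffAt ℝ ∞ (fun u => p (T u)) x := by
    rw [← hTy] at hpy
    exact hpy.comp x hT
  have hnT : ContDiffAt ℝ ∞ (fun u => n (T u)) x := by
    rw [← hTy] at hny
    exact hny.comp x hT
  have hkT : p (T x) k ≠ 0 := by rwa [hTy]
  have hNd : DifferentiableAt ℝ N x := by
    have h1 : ContDiffAt ℝ ∞ (fderiv ℝ (affineCoord k)) (p (T x)) :=
      (contDiffAt_affineCoord k hkT).fderiv_right (m := ∞) (by simp)
    have h2 : ContDiffAt ℝ ∞ (fun u => fderiv ℝ (affineCoord k) (p (T u))) x :=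
      ContDiffAt.comp (g := fderiv ℝ (affineCoord k)) x h1 hpT
    exact (h2.clm_apply hnT).differentiableAt (by simp)
  have hTU : ∀ᶠ u in nhds x, T u ∈ U := hT.continuousAt.eventually_mem (by
    rw [hTy]
    exact H.isOpen.mem_nhds hy)
  have hTdd : ∀ᶠ u in nhds x, DifferentiableAt ℝ T u := by
    filter_upwards [(hT.of_le (m := 1) (by simp)).eventually (by simp)] with u hu
    exact hu.differentiableAt one_ne_zero
  have hkk : ∀ᶠ u in nhds x, p (T u) k ≠ 0 := by
    have : ContinuousAt (fun u => p (T u) k) x := (continuous_apply k).continuousAt.comp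
      hpT.continuousAt
    exact this.eventually_ne hkT
  have hnor : ∀ᶠ u in nhds x, ∀ Y, chartMetric k
      (localMap f q u) (fderiv ℝ (localMap f q) u Y) (N u) = 0 := by
    filter_upwards [hTU, hTdd, hkk, eventually_eventually_nhds.2 he] with u h1 h2 h3 h4 Y
    have h4 : localMap f q =ᶠ[nhds u] fun u => affineCoord k (p (T u)) := h4
    rw [fderiv_comp_affineCoord h4 rfl h3 (H.smooth_p _ h1) h2, h4.eq_of_nhds,
      ← conicMetric_eq_chartMetric k h3]
    exact H.normal_n _ h1 _
  have hsff := fun Y => secondFundamentalForm_eq hf q hNd hnor ξ Y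
  -- Naturality of the variation is used twice: under the projection from `ℂ⁴` and under the
  -- reparametrization `T`.
  have hmv : ∀ Y, metricVariation (chartMetric k) (localMap f q) N x ξ Y =
      metricVariation conicMetric p n y (fderiv ℝ T x ξ) (fderiv ℝ T x Y) := fun Y => by
    rw [metricVariation_congr he]
    have hG : ∀ᶠ z in nhds (p (T x)), ∀ u v, conicMetric z u v = chartMetricL k (affineCoord k z)
        (fderiv ℝ (affineCoord k) z u) (fderiv ℝ (affineCoord k) z v) := by
      filter_upwards [(continuous_apply k).continuousAt.eventually_ne hkT] with z hz u v
      exact conicMetric_eq_chartMetric k hz u v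
    have h1 := metricVariation_comp (g := chartMetricL k) (G := conicMetric)
      (π := affineCoord k) (P := fun u => p (T u)) (n := fun u => n (T u)) (x := x)
      (differentiable_chartMetricL k _) (fun u v => chartMetric_symm k _ u v)
      (contDiffAt_affineCoord k hkT) (hpT.differentiableAt (by simp))
      (hnT.differentiableAt (by simp)) hG ξ Y
    rw [← metricVariation_comp_right conicMetric hTy hTd (hpy.differentiableAt (by simp))
      (hny.differentiableAt (by simp)), ← h1]
    rfl
  have hξ' : fderiv ℝ (affineCoord k) (p y) (fderiv ℝ p y (fderiv ℝ T x ξ)) =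
      chartJ k (affineCoord k (p y)) (fderiv ℝ (affineCoord k) (p y) (n y)) := by
    rw [← hder, ← hw, ← hNx]
    exact hξ
  obtain ⟨a, ha⟩ := exists_of_fderiv_eq_chartJ k hk (H.herm_p y hy) (H.herm_p_n y hy) hξ'
  refine ⟨fderiv ℝ T x ξ, μ, a, ha, fun Y => ?_⟩
  obtain ⟨Y, rfl⟩ := hsurj Y
  rw [← hmv, ← hsff, conicMetric_eq_chartMetric k hk, ← hder, ← hder, ← hw]
  exact hμ Y

end CP3


/-! ### Smooth extension of a unit normal to a normal lift. -/

namespace CP3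

theorem conicMetric_self_eq_zero {p n : C4} (h : conicMetric p n n = 0) (hp : herm p p = 1)
    (v : C4) : conicMetric p v n = 0 := by
  rw [conicMetric, hp] at h
  simp at h
  have h1 := herm_self_nonneg (lift1 p n)
  have h2 := herm_self_nonneg (lift2 p n)
  have e1 : lift1 p n = 0 := herm_self_eq_zero (by linarith)
  have e2 : lift2 p n = 0 := herm_self_eq_zero (by linarith)
  simp [conicMetric, e1, e2, herm]

theorem conicMetric_self_nonneg (p n : C4) : 0 ≤ conicMetric p n n := by
  have h1 := herm_self_nonneg (lift1 p n)
  have h2 := herm_self_nonneg (lift2 p n)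
  have h3 := herm_self_nonneg p
  rw [conicMetric]
  positivity

theorem conicMetric_add_left (p u v w : C4) :
    conicMetric p (u + v) w = conicMetric p u w + conicMetric p v w := by
  simp only [conicMetric, lift1_add, lift2_add, herm_add_left, Complex.add_re]
  ring

theorem conicMetric_smul_right (p u v : C4) (t : ℝ) :
    conicMetric p u (t • v) = t * conicMetric p u v := by
  simp only [conicMetric, lift1_smul, lift2_smul, herm_real_smul_right, Complex.re_ofReal_mul]
  ring

theorem conicMetric_smul_left (p u v : C4) (t : ℝ) :
    conicMetric p (t • u) v = t * conicMetric p u v := by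
  rw [conicMetric_comm, conicMetric_smul_right, conicMetric_comm]

/-- A tangent map, a normal vector and the fibre direction, put together. -/
noncomputable def frameMap (D : EuclideanSpace ℝ (Fin 5) →L[ℝ] C4) (n p : C4) :
    (EuclideanSpace ℝ (Fin 5) × ℝ × ℂ) →L[ℝ] C4 :=
  D.coprod ((ContinuousLinearMap.toSpanSingleton ℝ n).coprod
    ((ContinuousLinearMap.toSpanSingleton ℂ p).restrictScalars ℝ))

theorem frameMap_apply (D : EuclideanSpace ℝ (Fin 5) →L[ℝ] C4) (n p : C4)
    (X : EuclideanSpace ℝ (Fin 5)) (t : ℝ) (a : ℂ) :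
    frameMap D n p (X, t, a) = D X + (t • n + a • p) := by
  simp [frameMap]

/-- The tangent map, the normal vector and the fibre direction span `ℂ⁴`. -/
theorem exists_equiv_frameMap {D : EuclideanSpace ℝ (Fin 5) →L[ℝ] C4} {n p : C4}
    (himm : ∀ X (a : ℂ), D X = a • p → X = 0) (hp : herm p p = 1)
    (h1 : conicMetric p n n = 1) (h2 : ∀ X, conicMetric p (D X) n = 0) :
    ∃ e : (EuclideanSpace ℝ (Fin 5) × ℝ × ℂ) ≃L[ℝ] C4, (e : _ →L[ℝ] C4) = frameMap D n p := by
  have hinj : Function.Injective (frameMap D n p).toLinearMap := by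
    rw [← LinearMap.ker_eq_bot, LinearMap.ker_eq_bot']
    rintro ⟨X, t, a⟩ h
    have h' : D X + (t • n + a • p) = 0 := by
      rw [← frameMap_apply]
      exact h
    have h3 : conicMetric p (D X + t • n + a • p) n = t := by
      rw [conicMetric_add_left_self, conicMetric_add_left, conicMetric_smul_left, h1, h2]
      ring
    have ht : t = 0 := by
      rw [← h3, add_assoc, h']
      simp [conicMetric, lift1, lift2, horiz, herm]
    subst ht
    rw [zero_smul, zero_add] at h'
    have hX : X = 0 := himm X (-a) (by rw [neg_smul]; exact eq_neg_of_add_eq_zero_left h')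
    subst hX
    rw [map_zero, zero_add] at h'
    have ha : a = 0 := by
      have := congrArg (herm p) h'
      rw [herm_smul_right, hp] at this
      simpa [herm] using this
    rw [ha]
    rfl
  have hd : Module.finrank ℝ C4 = 8 := by
    rw [Module.finrank_pi_fintype]
    simp
  exact ⟨(LinearEquiv.ofInjectiveOfFinrankEq _ hinj (by simp [hd])).toContinuousLinearEquiv,
    ContinuousLinearMap.ext fun v => rfl⟩

/-- The vector representing a real linear form with respect to the real part of `herm`. -/
noncomputable def rieszVec (l : C4 →L[ℝ] ℝ) : C4 := fun i =>
  (l (Pi.single i 1) : ℂ) + (l (Pi.single i Complex.I) : ℂ) * Complex.I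

theorem herm_rieszVec (l : C4 →L[ℝ] ℝ) (v : C4) : (herm (rieszVec l) v).re = l v := by
  have hv : v = ∑ i, ((v i).re • (Pi.single i 1 : C4) + (v i).im • (Pi.single i Complex.I : C4)) := by
    funext j
    rw [Finset.sum_apply, Finset.sum_eq_single j]
    · simp [Complex.re_add_im]
    · intro i _ hij
      simp [hij.symm]
    · simp
  conv_rhs => rw [hv]
  simp only [herm, map_sum, map_add, map_smul, smul_eq_mul, Complex.re_sum]
  refine Finset.sum_congr rfl fun i _ => ?_
  simp [rieszVec]
  ring

theorem herm_rieszVec_eq_zero {l : C4 →L[ℝ] ℝ} {v : C4} (h : ∀ a : ℂ, l (a • v) = 0) :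
    herm (rieszVec l) v = 0 := by
  have h1 := h 1
  have h2 := h Complex.I
  rw [← herm_rieszVec, herm_smul_right] at h1 h2
  apply Complex.ext
  · simpa using h1
  · simpa using h2

/-- Raising the index of a linear form that vanishes on the fibre direction. -/
noncomputable def sharp (p : C4) (l : C4 →L[ℝ] ℝ) : C4 :=
  (1 / 2 : ℝ) • (rieszVec l + herm (quatJ p) (rieszVec l) • quatJ p)

/-- On horizontal vectors the metric is twice the Euclidean one except along `jp`, where the factor
is 1. Hence `sharp` halves the Euclidean gradient but restores its `jp` component. -/
theorem sharp_spec {p : C4} (hp : herm p p = 1) {l : C4 →L[ℝ] ℝ} (h : ∀ a : ℂ, l (a • p) = 0) :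
    herm p (sharp p l) = 0 ∧ herm (quatJ p) (sharp p l) = herm (quatJ p) (rieszVec l) ∧
      ∀ v, conicMetric p v (sharp p l) = l v := by
  have h0 : herm p (rieszVec l) = 0 := by
    rw [← star_herm, herm_rieszVec_eq_zero h, star_zero]
  have h1 : herm p (sharp p l) = 0 := by
    rw [sharp, herm_real_smul_right, herm_add_right, herm_smul_right, h0, herm_quatJ_right]
    simp
  have h2 : herm (quatJ p) (sharp p l) = herm (quatJ p) (rieszVec l) := by
    rw [sharp, herm_real_smul_right, herm_add_right, herm_smul_right, herm_quatJ_quatJ, hp]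
    push_cast
    ring
  refine ⟨h1, h2, fun v => ?_⟩
  rw [conicMetric_of_unit hp, h1, h2, sharp, herm_real_smul_right, herm_add_right, herm_smul_right,
    ← herm_rieszVec, ← star_herm v (rieszVec l), star_herm (quatJ p) v]
  simp
  ring

variable {M : Type*} [TopologicalSpace M] [ChartedSpace (EuclideanSpace ℝ (Fin 5)) M]

theorem LocalLift.mono {f : M → CP3} {x₀ : M} {U U' : Set (EuclideanSpace ℝ (Fin 5))}
    {p : EuclideanSpace ℝ (Fin 5) → C4} (H : LocalLift f x₀ U p) (ho : IsOpen U') (hs : U' ⊆ U) :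
    LocalLift f x₀ U' p :=
  ⟨ho, hs.trans H.subset, fun y hy => H.smooth_p y (hs hy), fun y hy => H.herm_p y (hs hy),
    fun y hy => H.mk_p y (hs hy)⟩

theorem NormalLift.mono {f : M → CP3} {x₀ : M} {U U' : Set (EuclideanSpace ℝ (Fin 5))}
    {p n : EuclideanSpace ℝ (Fin 5) → C4} (H : NormalLift f x₀ U p n) (ho : IsOpen U')
    (hs : U' ⊆ U) : NormalLift f x₀ U' p n :=
  ⟨H.toLocalLift.mono ho hs, fun y hy => H.smooth_n y (hs hy), fun y hy => H.herm_p_n y (hs hy),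
    fun y hy => H.unit_n y (hs hy), fun y hy => H.normal_n y (hs hy)⟩

theorem herm_smul_smul (a : ℂ) (u v : C4) : herm (a • u) (a • v) = (‖a‖ ^ 2 : ℝ) * herm u v := by
  rw [herm_smul_left, herm_smul_right, ← mul_assoc, Complex.star_def,
    ← Complex.normSq_eq_conj_mul_self, Complex.normSq_eq_norm_sq]

variable [IsManifold (𝓡 5) ∞ M]

theorem exists_normalLift {f : M → CP3} (hf : IsHypersurface f) {x₀ : M}
    {U : Set (EuclideanSpace ℝ (Fin 5))} {p : EuclideanSpace ℝ (Fin 5) → C4}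
    (H : LocalLift f x₀ U p) {y₀ : EuclideanSpace ℝ (Fin 5)} (hy₀ : y₀ ∈ U) {n₀ : C4}
    (h1 : conicMetric (p y₀) n₀ n₀ = 1)
    (h2 : ∀ X, conicMetric (p y₀) (fderiv ℝ p y₀ X) n₀ = 0)
    (h3 : herm (quatJ (p y₀)) n₀ ≠ 0) :
    ∃ (U' : Set (EuclideanSpace ℝ (Fin 5))) (n : EuclideanSpace ℝ (Fin 5) → C4),
      NormalLift f x₀ U' p n ∧ y₀ ∈ U' ∧ herm (quatJ (p y₀)) (n y₀) ≠ 0 := by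
  let Φ : EuclideanSpace ℝ (Fin 5) → (EuclideanSpace ℝ (Fin 5) × ℝ × ℂ) →L[ℝ] C4 :=
    fun y => frameMap (fderiv ℝ p y) n₀ (p y)
  have hΦ : ContDiffOn ℝ ∞ Φ U := by
    rw [contDiffOn_clm_apply]
    rintro ⟨X, t, a⟩ y hy
    simp only [Φ, frameMap_apply]
    exact ((contDiffAt_fderiv_apply (H.smooth_p y hy) X).add
      (contDiffAt_const.add ((contDiffAt_const (c := a)).smul (H.smooth_p y hy)))).contDiffWithinAt
  -- Here `ℂ⁴ = dp(TM) ⊕ ℝ n₀ ⊕ ℂ p`. This holds at `y₀` and is an open condition, although `n₀` is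
  -- kept fixed and is normal only at `y₀`.
  let U' := U ∩ Φ ⁻¹' Set.range ((↑) : ((EuclideanSpace ℝ (Fin 5) × ℝ × ℂ) ≃L[ℝ] C4) → _)
  have hU' : IsOpen U' := hΦ.continuousOn.isOpen_inter_preimage H.isOpen ContinuousLinearEquiv.isOpen
  have hy₀' : y₀ ∈ U' :=
    ⟨hy₀, exists_equiv_frameMap (fun X a h => H.immersion hf hy₀ h) (H.herm_p y₀ hy₀) h1 h2⟩
  -- The coefficient of `n₀` in that decomposition. Its kernel is the tangent space plus the fibre
  -- direction, so its metric gradient is normal.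
  let l : EuclideanSpace ℝ (Fin 5) → C4 →L[ℝ] ℝ := fun y =>
    ((ContinuousLinearMap.fst ℝ ℝ ℂ).comp
      (ContinuousLinearMap.snd ℝ (EuclideanSpace ℝ (Fin 5)) (ℝ × ℂ))).comp (Φ y).inverse
  have hl : ∀ y ∈ U', ∀ (X : EuclideanSpace ℝ (Fin 5)) (t : ℝ) (a : ℂ), l y (fderiv ℝ p y X + (t • n₀ + a • p y)) = t := by
    rintro y ⟨hy, e, he⟩ X t a
    have he' : (e : _ →L[ℝ] C4) = Φ y := he
    have : fderiv ℝ p y X + (t • n₀ + a • p y) = e (X, t, a) := by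
      rw [← frameMap_apply]
      exact (DFunLike.congr_fun he' (X, t, a)).symm
    rw [this]
    simp only [l, ← he', ContinuousLinearMap.inverse_equiv]
    simp
  have hlp : ∀ y ∈ U', ∀ a : ℂ, l y (a • p y) = 0 := fun y hy a => by
    simpa using hl y hy 0 0 a
  have hls : ∀ y ∈ U', ∀ v, ContDiffAt ℝ ∞ (fun y => l y v) y := by
    rintro y ⟨hy, e, he⟩ v
    have he' : (e : _ →L[ℝ] C4) = Φ y := he
    have h4 : ContDiffAt ℝ ∞ (fun y => (Φ y).inverse) y := by
      refine ContDiffAt.comp (g := ContinuousLinearMap.inverse) y ?_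
        ((hΦ y hy).contDiffAt (H.isOpen.mem_nhds hy))
      rw [← he']
      exact contDiffAt_map_inverse e
    have h5 := h4.clm_apply (contDiffAt_const (c := v))
    exact h5.snd.fst
  let n' : EuclideanSpace ℝ (Fin 5) → C4 := fun y => sharp (p y) (l y)
  have hn' := fun y (hy : y ∈ U') => sharp_spec (H.herm_p y hy.1) (hlp y hy)
  have hrs : ∀ y ∈ U', ContDiffAt ℝ ∞ (fun y => rieszVec (l y)) y := fun y hy => by
    refine contDiffAt_pi.2 fun i => ?_
    have h4 := fun v => Complex.ofRealCLM.contDiff.contDiffAt.comp y (hls y hy v)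
    exact (h4 _).add ((h4 _).mul contDiffAt_const)
  have hns : ∀ y ∈ U', ContDiffAt ℝ ∞ n' y := fun y hy => by
    have hj := contDiffAt_quatJ (H.smooth_p y hy.1)
    exact ContDiffAt.smul (contDiffAt_const (c := (1 / 2 : ℝ))) ((hrs y hy).add
      ((contDiffAt_herm hj (hrs y hy)).smul hj))
  have hpos : ∀ y ∈ U', 0 < conicMetric (p y) (n' y) (n' y) := fun y hy => by
    refine lt_of_le_of_ne (conicMetric_self_nonneg _ _) fun h => ?_
    have h4 := conicMetric_self_eq_zero h.symm (H.herm_p y hy.1) n₀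
    rw [(hn' y hy).2.2] at h4
    have := hl y hy 0 1 0
    simp at this
    rw [this] at h4
    exact one_ne_zero h4
  have hcs : ∀ y ∈ U', ContDiffAt ℝ ∞ (fun y => conicMetric (p y) (n' y) (n' y)) y := fun y hy => by
    have h4 : (fun y => conicMetric (p y) (n' y) (n' y)) =ᶠ[nhds y] fun y =>
        2 * (herm (n' y) (n' y)).re - (star (herm (quatJ (p y)) (n' y)) *
          herm (quatJ (p y)) (n' y)).re := by
      filter_upwards [hU'.mem_nhds hy] with z hz
      rw [conicMetric_of_unit (H.herm_p z hz.1), (hn' z hz).1]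
      simp
    refine ContDiffAt.congr_of_eventuallyEq ?_ h4
    have hre : ∀ {f : EuclideanSpace ℝ (Fin 5) → ℂ}, ContDiffAt ℝ ∞ f y →
      ContDiffAt ℝ ∞ (fun w => (f w).re) y := fun hf => Complex.reCLM.contDiff.contDiffAt.comp y hf
    have hb := contDiffAt_herm (contDiffAt_quatJ (H.smooth_p y hy.1)) (hns y hy)
    exact (contDiffAt_const.mul (hre (contDiffAt_herm (hns y hy) (hns y hy)))).sub
      (hre ((Complex.conjCLE.contDiff.contDiffAt.comp y hb).mul hb))
  let n : EuclideanSpace ℝ (Fin 5) → C4 := fun y =>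
    (√(conicMetric (p y) (n' y) (n' y)))⁻¹ • n' y
  refine ⟨U', n, ⟨H.mono hU' Set.inter_subset_left, fun y hy => ?_, fun y hy => ?_, fun y hy => ?_,
    fun y hy Y => ?_⟩, hy₀', ?_⟩
  · exact (((hcs y hy).sqrt (hpos y hy).ne').inv (Real.sqrt_ne_zero'.2 (hpos y hy))).smul (hns y hy)
  · simp only [n]
    rw [herm_real_smul_right, (hn' y hy).1, mul_zero]
  · simp only [n]
    rw [conicMetric_smul_left, conicMetric_smul_right]
    have := Real.sq_sqrt (hpos y hy).le
    have h0 := Real.sqrt_ne_zero'.2 (hpos y hy)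
    field_simp
    exact this.symm
  · simp only [n]
    rw [conicMetric_smul_right, (hn' y hy).2.2 (fderiv ℝ p y Y)]
    have := hl y hy Y 0 0
    simp at this
    rw [this, mul_zero]
  · simp only [n]
    rw [herm_real_smul_right, (hn' y₀ hy₀').2.1]
    have hq := Real.sqrt_ne_zero'.2 (hpos y₀ hy₀')
    refine mul_ne_zero (by exact_mod_cast inv_ne_zero hq) fun h0 => ?_
    set τ := herm (quatJ (p y₀)) n₀ with hτ
    have hp := H.herm_p y₀ hy₀
    -- If the new normal had no `jp` component at `y₀`, then `l` would vanish on `τ jp`, making `τ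
    -- jp` tangent modulo the fibre and thus orthogonal to `n₀`. But this product is `|τ|²`.
    have h4 : conicMetric (p y₀) (τ • quatJ (p y₀)) n₀ = 0 := by
      obtain ⟨-, e, he⟩ := hy₀'
      have he' : (e : _ →L[ℝ] C4) = Φ y₀ := he
      obtain ⟨⟨X, t, a⟩, hX⟩ := e.surjective (τ • quatJ (p y₀))
      have h5 : τ • quatJ (p y₀) = fderiv ℝ p y₀ X + (t • n₀ + a • p y₀) := by
        rw [← frameMap_apply, ← hX]
        exact DFunLike.congr_fun he' (X, t, a)
      have h6 := hl y₀ ⟨hy₀, e, he⟩ X t a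
      rw [← h5, ← herm_rieszVec, herm_smul_right, ← star_herm, h0] at h6
      simp at h6
      rw [h5, ← add_assoc, conicMetric_add_left_self, conicMetric_add_left, h2,
        conicMetric_smul_left, ← h6]
      simp
    rw [conicMetric_of_unit hp, herm_smul_left, herm_smul_right, herm_smul_right, herm_quatJ_quatJ,
      hp, ← hτ, herm_quatJ_right] at h4
    apply h3
    rw [← Complex.normSq_eq_zero, Complex.normSq_apply]
    simp at h4
    linarith

end CP3


/-! ### Change of phase, vertical normals, and the adapted frame. -/

namespace CP3

variable {M : Type*} [TopologicalSpace M] [ChartedSpace (EuclideanSpace ℝ (Fin 5)) M]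

theorem conicMetric_of_unit_horizontal {p n v : C4} (hp : herm p p = 1)
    (hn : herm p n = 0) : conicMetric p v n = 2 * (herm n v).re -
      (star (herm (quatJ p) n) * herm (quatJ p) v).re := by
  rw [conicMetric_comm, conicMetric_of_unit hp, hn]
  simp

/-- Multiplication of the lifts by a phase function. -/
theorem NormalLift.gauge {f : M → CP3} {x₀ : M} {U : Set (EuclideanSpace ℝ (Fin 5))}
    {p n : EuclideanSpace ℝ (Fin 5) → C4} (H : NormalLift f x₀ U p n)
    {σ : EuclideanSpace ℝ (Fin 5) → ℂ} (hσ : ∀ y ∈ U, ContDiffAt ℝ ∞ σ y)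
    (hσ1 : ∀ y ∈ U, ‖σ y‖ = 1) :
    NormalLift f x₀ U (fun y => σ y • p y) (fun y => σ y • n y) := by
  have h0 : ∀ y ∈ U, σ y ≠ 0 := fun y hy h => by
    have := hσ1 y hy
    simp [h] at this
  refine ⟨⟨H.isOpen, H.subset, fun y hy => (hσ y hy).smul (H.smooth_p y hy), fun y hy => ?_,
    fun y hy h => ?_⟩, fun y hy => (hσ y hy).smul (H.smooth_n y hy), fun y hy => ?_, fun y hy => ?_,
    fun y hy Y => ?_⟩
  · rw [herm_smul_smul, hσ1 y hy, H.herm_p y hy]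
    simp
  · rw [← H.mk_p y hy (H.ne_zero hy), mk_eq_mk_iff]
    exact ⟨σ y, rfl⟩
  · rw [herm_smul_smul, H.herm_p_n y hy, mul_zero]
  · rw [conicMetric_smul (h0 y hy), H.unit_n y hy]
  · have hd := ((hσ y hy).differentiableAt (by simp)).hasFDerivAt.fun_smul
      ((H.smooth_p y hy).differentiableAt (by simp)).hasFDerivAt
    rw [hd.fderiv]
    have e : (σ y • fderiv ℝ p y + (fderiv ℝ σ y).smulRight (p y)) Y =
        σ y • fderiv ℝ p y Y + (fderiv ℝ σ y Y * (σ y)⁻¹) • (σ y • p y) := by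
      rw [smul_smul, mul_assoc, inv_mul_cancel₀ (h0 y hy), mul_one]
      rfl
    rw [e, conicMetric_add_left_self, conicMetric_smul (h0 y hy), H.normal_n y hy]

theorem exists_ne_zero_of_herm_eq_zero (p q : C4) : ∃ u ≠ 0, herm p u = 0 ∧ herm q u = 0 := by
  let l : C4 →ₗ[ℂ] (Fin 2 → ℂ) :=
    { toFun := fun u => ![herm p u, herm q u]
      map_add' := fun u v => by
        funext i
        fin_cases i <;> simp [herm_add_right]
      map_smul' := fun a u => by
        funext i
        fin_cases i <;> simp [herm_smul_right] }
  obtain ⟨u, hu, h0⟩ := (Submodule.ne_bot_iff _).1 (LinearMap.ker_ne_bot_of_finrank_lt (f := l)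
    (by simp))
  exact ⟨u, h0, congrFun hu 0, congrFun hu 1⟩

variable [IsManifold (𝓡 5) ∞ M]

/-- By dimension, a vector orthogonal to the normal is tangent up to the fibre direction. -/
theorem NormalLift.exists_tangent {f : M → CP3} (hf : IsHypersurface f) {x₀ : M}
    {U : Set (EuclideanSpace ℝ (Fin 5))} {p n : EuclideanSpace ℝ (Fin 5) → C4}
    (H : NormalLift f x₀ U p n) {y : EuclideanSpace ℝ (Fin 5)} (hy : y ∈ U) {v : C4}
    (hv : conicMetric (p y) v (n y) = 0) : ∃ X, ∃ a : ℂ, fderiv ℝ p y X = v + a • p y := by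
  obtain ⟨e, he⟩ := exists_equiv_frameMap (fun X a h => H.immersion hf hy h) (H.herm_p y hy)
    (H.unit_n y hy) (H.normal_n y hy)
  obtain ⟨⟨X, t, a⟩, hX⟩ := e.surjective v
  have h1 : v = fderiv ℝ p y X + (t • n y + a • p y) := by
    rw [← frameMap_apply, ← hX]
    exact DFunLike.congr_fun he (X, t, a)
  have ht : t = 0 := by
    rw [h1, ← add_assoc, conicMetric_add_left_self, conicMetric_add_left, conicMetric_smul_left,
      H.unit_n y hy, H.normal_n y hy] at hv
    simpa using hv
  refine ⟨X, -a, ?_⟩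
  rw [h1, ht]
  module

/-- The normal of a hypersurface is not in `𝒟₁` on an open set. -/
theorem NormalLift.false_of_vertical {f : M → CP3} (hf : IsHypersurface f) {x₀ : M}
    {U : Set (EuclideanSpace ℝ (Fin 5))} {p n : EuclideanSpace ℝ (Fin 5) → C4}
    (H : NormalLift f x₀ U p n)
    (hn : ∀ y ∈ U, n y = herm (quatJ (p y)) (n y) • quatJ (p y))
    {y : EuclideanSpace ℝ (Fin 5)} (hy : y ∈ U) : False := by
  have hp := H.smooth_p y hy
  have hjp := contDiffAt_quatJ hp
  have hns := H.smooth_n y hy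
  have hw := contDiffAt_herm hjp hns
  have hpp := H.herm_p y hy
  set w : EuclideanSpace ℝ (Fin 5) → ℂ := fun y => herm (quatJ (p y)) (n y) with hwdef
  have hny : n y = w y • quatJ (p y) := hn y hy
  -- For vertical `n` the metric product with `n` reduces to the Euclidean one, so the normal
  -- equation is the vanishing of the form `Re h(n, dp)`.
  have hzero : ∀ z ∈ U, ∀ Y, (hermForm n p z Y).re = 0 := fun z hz Y => by
    have h := H.normal_n z hz Y
    have e : herm (n z) (fderiv ℝ p z Y) =
        star (herm (quatJ (p z)) (n z)) * herm (quatJ (p z)) (fderiv ℝ p z Y) := by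
      conv_lhs => rw [hn z hz]
      rw [herm_smul_left]
    rw [conicMetric_of_unit_horizontal (H.herm_p z hz) (H.herm_p_n z hz), ← e] at h
    rw [hermForm]
    linarith
  have hder : ∀ X, fderiv ℝ n y X =
      w y • quatJ (fderiv ℝ p y X) + fderiv ℝ w y X • quatJ (p y) := fun X => by
    have e : n =ᶠ[nhds y] fun y => w y • quatJ (p y) := by
      filter_upwards [H.isOpen.mem_nhds hy] with z hz using hn z hz
    have hd := (hw.differentiableAt (by simp)).hasFDerivAt.fun_smul
      (hjp.differentiableAt (by simp)).hasFDerivAt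
    rw [e.fderiv_eq, hd.fderiv, ← fderiv_quatJ (hp.differentiableAt (by simp))]
    rfl
  have hw1 : (star (w y) * w y).re = 1 := by
    have h := H.unit_n y hy
    rw [conicMetric_of_unit_horizontal hpp (H.herm_p_n y hy)] at h
    have e : herm (n y) (n y) = star (w y) * w y := by
      conv_lhs => arg 1; rw [hny]
      rw [herm_smul_left]
    rw [e] at h
    change 2 * _ - (star (w y) * w y).re = 1 at h
    linarith
  -- Take `u` in the lift of `𝒟₂`. Both `u` and `w ju` are then tangent modulo the fibre; on this
  -- pair the differential of `Re h(n, dp)` equals `2 |w|² |u|²` with `|w| = 1`, which contradicts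
  -- its vanishing.
  obtain ⟨u, hu0, hu1, hu2⟩ := exists_ne_zero_of_herm_eq_zero (p y) (quatJ (p y))
  have hG : ∀ v, herm (quatJ (p y)) v = 0 → conicMetric (p y) v (n y) = 0 := fun v hv => by
    rw [conicMetric_of_unit_horizontal hpp (H.herm_p_n y hy), hny, herm_smul_left, hv]
    simp
  have hv2 : herm (quatJ (p y)) (w y • quatJ u) = 0 := by
    rw [herm_smul_right, herm_quatJ_quatJ', hu1]
    simp
  obtain ⟨X, a, hX⟩ := H.exists_tangent hf hy (hG u hu2)
  obtain ⟨Y, b, hY⟩ := H.exists_tangent hf hy (hG _ hv2)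
  have h := extD_congr H.isOpen hy hzero X Y
  have e0 : extD (fun (_ _ : EuclideanSpace ℝ (Fin 5)) => (0 : ℝ)) y X Y = 0 := by simp [extD]
  have hpu : herm (quatJ u) (p y) = 0 := by rw [herm_quatJ_comm, hu2, neg_zero]
  have e1 : herm (quatJ (fderiv ℝ p y X)) (fderiv ℝ p y Y) = w y * herm u u := by
    rw [hX, hY, quatJ_add, quatJ_smul, herm_add_left, herm_add_right, herm_add_right,
      herm_smul_left, herm_smul_left, hv2, herm_smul_right (quatJ u) (quatJ u),
      herm_smul_right (quatJ u) (p y), herm_smul_right (quatJ (p y)) (p y), herm_quatJ_left, hpu,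
      herm_quatJ_quatJ]
    ring
  have hX2 : herm (quatJ (p y)) (fderiv ℝ p y X) = 0 := by
    rw [hX, herm_add_right, herm_smul_right, hu2, herm_quatJ_left]
    ring
  have hY2 : herm (quatJ (p y)) (fderiv ℝ p y Y) = 0 := by
    rw [hY, herm_add_right, herm_smul_right _ (p y), hv2, herm_quatJ_left]
    ring
  rw [e0, extD_re hns hp, hder, hder, herm_add_left, herm_add_left, herm_smul_left, herm_smul_left,
    herm_smul_left, herm_smul_left, hX2, hY2, herm_quatJ_comm (fderiv ℝ p y Y), e1,
    herm_self u] at h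
  apply hu0
  apply herm_self_eq_zero
  simp at h hw1
  linear_combination 1 / 2 * h - (herm u u).re * hw1

theorem metricVariation_congr_normal {E W : Type*} [NormedAddCommGroup E] [NormedSpace ℝ E]
    [NormedAddCommGroup W] [NormedSpace ℝ W] {g : W → W → W → ℝ} {F N N' : E → W} {x : E}
    (h : N =ᶠ[nhds x] N') (X Y : E) :
    metricVariation g F N x X Y = metricVariation g F N' x X Y := by
  rw [metricVariation, metricVariation, h.fderiv_eq, h.eq_of_nhds]

/-- A Hopf hypersurface has no normal with nonzero components in both distributions. -/
theorem NormalLift.false_of_real {f : M → CP3} (hf : IsHypersurface f) (hHopf : IsHopf f) {x₀ : M}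
    {U : Set (EuclideanSpace ℝ (Fin 5))} {p n : EuclideanSpace ℝ (Fin 5) → C4}
    (H : NormalLift f x₀ U p n) {s : EuclideanSpace ℝ (Fin 5) → ℝ}
    (hs : ∀ y ∈ U, herm (quatJ (p y)) (n y) = s y) (hs0 : ∀ y ∈ U, 0 < s y)
    (hs1 : ∀ y ∈ U, s y < 1) {y : EuclideanSpace ℝ (Fin 5)} (hy : y ∈ U) : False := by
  let c : EuclideanSpace ℝ (Fin 5) → ℝ := fun y => √(1 - s y ^ 2)
  -- The `𝒟₂` part of `n` has length `c` in a metric that is twice the Euclidean one, so the factor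
  -- `2 / c` makes `|r|² = 2`.
  let r : EuclideanSpace ℝ (Fin 5) → C4 := fun y => (2 / c y) • (n y - s y • quatJ (p y))
  have hlt : ∀ y ∈ U, 0 < 1 - s y ^ 2 := fun y hy => by
    have h1 := hs0 y hy
    have h2 := hs1 y hy
    nlinarith
  have hc0 : ∀ y ∈ U, 0 < c y := fun y hy => Real.sqrt_pos.2 (hlt y hy)
  have hc2 : ∀ y ∈ U, c y ^ 2 = 1 - s y ^ 2 := fun y hy => Real.sq_sqrt (hlt y hy).le
  have hsm : ∀ y ∈ U, ContDiffAt ℝ ∞ s y := fun y hy => by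
    have h1 : ContDiffAt ℝ ∞ (fun y => (herm (quatJ (p y)) (n y)).re) y :=
      Complex.reCLM.contDiff.contDiffAt.comp y
        (contDiffAt_herm (contDiffAt_quatJ (H.smooth_p y hy)) (H.smooth_n y hy))
    refine h1.congr_of_eventuallyEq ?_
    filter_upwards [H.isOpen.mem_nhds hy] with z hz
    rw [hs z hz, Complex.ofReal_re]
  have hcm : ∀ y ∈ U, ContDiffAt ℝ ∞ c y := fun y hy =>
    (contDiffAt_const.sub ((hsm y hy).pow 2)).sqrt (hlt y hy).ne'
  have hrm : ∀ y ∈ U, ContDiffAt ℝ ∞ r y := fun y hy =>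
    (contDiffAt_const.div (hcm y hy) (hc0 y hy).ne').smul ((H.smooth_n y hy).sub
      ((hsm y hy).smul (contDiffAt_quatJ (H.smooth_p y hy))))
  have hnr : ∀ y ∈ U, n y = s y • quatJ (p y) + (c y / 2) • r y := fun y hy => by
    have := (hc0 y hy).ne'
    simp only [r, smul_smul]
    rw [show c y / 2 * (2 / c y) = 1 by field_simp, one_smul]
    abel
  have hjj : ∀ y ∈ U, herm (quatJ (p y)) (quatJ (p y)) = 1 := fun y hy => by
    rw [herm_quatJ_quatJ, H.herm_p y hy]
  have hjr : ∀ y ∈ U, herm (quatJ (p y)) (r y) = 0 := fun y hy => by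
    simp only [r]
    rw [herm_real_smul_right, herm_sub_right, herm_real_smul_right, hs y hy, hjj y hy]
    ring
  have hpr : ∀ y ∈ U, herm (p y) (r y) = 0 := fun y hy => by
    simp only [r]
    rw [herm_real_smul_right, herm_sub_right, herm_real_smul_right, H.herm_p_n y hy,
      herm_quatJ_right]
    ring
  have hnl : ∀ y ∈ U, ∀ v, herm (n y) v = s y * herm (quatJ (p y)) v + c y / 2 * herm (r y) v :=
    fun y hy v => by
      rw [hnr y hy, ← star_herm, herm_add_right, herm_real_smul_right, herm_real_smul_right,
        star_add, star_mul', star_mul', star_herm, star_herm]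
      simp
  have hrr : ∀ y ∈ U, herm (r y) (r y) = 2 := fun y hy => by
    have h1 := H.unit_n y hy
    rw [conicMetric_of_unit_horizontal (H.herm_p y hy) (H.herm_p_n y hy), hnl y hy, hs y hy,
      hnr y hy, herm_add_right, herm_real_smul_right, herm_real_smul_right, ← star_herm, hjr y hy,
      herm_self] at h1
    rw [herm_self]
    have h2 := hc2 y hy
    have h3 := (hc0 y hy).ne'
    simp at h1
    have h4 : c y ^ 2 * ((herm (r y) (r y)).re - 2) = 0 := by linear_combination 2 * h1 - 2 * h2
    have h5 : (herm (r y) (r y)).re = 2 := by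
      rcases mul_eq_zero.1 h4 with h | h
      · exact absurd (pow_eq_zero_iff (by simp) |>.1 h) h3
      · linarith
    rw [h5]
    simp
  have F : AdaptedFrame U p r s c :=
    { isOpen := H.isOpen
      smooth_p := H.smooth_p
      smooth_r := hrm
      smooth_s := hsm
      smooth_c := hcm
      s_pos := hs0
      c_pos := hc0
      sq_add_sq := fun y hy => by rw [hc2 y hy]; ring
      herm_p := H.herm_p
      herm_r := hrr
      herm_p_r := hpr
      herm_jp_r := hjr
      normal := fun y hy X => by
        have h1 := H.normal_n y hy X
        rw [conicMetric_of_unit_horizontal (H.herm_p y hy) (H.herm_p_n y hy), hnl y hy, hs y hy] at h1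
        simp at h1
        simp only [hermForm]
        linear_combination h1 }
  refine F.false_of_hopf (by simp) (fun x hx X h1 h2 h3 => ?_) (fun x hx => ?_) hy
  -- If the components along `jp, r, jr` vanish, `dp X` is a multiple of `p` by completeness of the
  -- frame.
  · refine H.immersion hf hx (a := herm (p x) (fderiv ℝ p x X)) ?_
    rw [← sub_eq_zero]
    apply herm_self_eq_zero
    have hrp : herm (r x) (p x) = 0 := by rw [← star_herm, hpr x hx, star_zero]
    have hjrp : herm (quatJ (r x)) (p x) = 0 := by rw [herm_quatJ_comm, hjr x hx, neg_zero]
    rw [herm_expand (H.herm_p x hx) (hrr x hx) (hpr x hx) (hjr x hx)]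
    simp only [herm_sub_right, herm_smul_right, h1, h2, h3, hrp, hjrp, H.herm_p x hx,
      herm_quatJ_left]
    simp
  · obtain ⟨ξ, μ, a, hξ, hμ⟩ := H.hopf hf hHopf hx
    have e1 : n x - herm (quatJ (p x)) (n x) • quatJ (p x) = (c x / 2) • r x := by
      rw [hs x hx, Complex.coe_smul, hnr x hx]
      abel
    have e2 : herm (quatJ (p x)) (n x) • quatJ (p x) = s x • quatJ (p x) := by
      rw [hs x hx, Complex.coe_smul]
    rw [e1, e2] at hξ
    refine ⟨μ, fun Y => ?_⟩
    have h1 := F.second_form hx hξ Y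
    have h2 := hμ Y
    have e : n =ᶠ[nhds x] fun y => s y • quatJ (p y) + (c y / 2) • r y := by
      filter_upwards [H.isOpen.mem_nhds hx] with z hz using hnr z hz
    rw [metricVariation_congr_normal e, h1.1, h1.2] at h2
    linear_combination h2

end CP3


/-! ### Phase normalization and conclusion. -/

namespace CP3

/-- A square root of the inverse phase of `z`. -/
noncomputable def invSqrtPhase (z : ℂ) : ℂ :=
  Complex.exp (((starRingEnd ℂ) (Complex.log z) - Complex.log z) / 4)

theorem norm_invSqrtPhase (z : ℂ) : ‖invSqrtPhase z‖ = 1 := by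
  rw [invSqrtPhase, Complex.norm_exp]
  simp

theorem invSqrtPhase_sq_mul (z : ℂ) : invSqrtPhase z ^ 2 * z = ‖z‖ := by
  conv_lhs => rw [← Complex.norm_mul_exp_arg_mul_I z]
  rw [Complex.norm_mul_exp_arg_mul_I, invSqrtPhase, ← Complex.exp_nat_mul]
  have e : ((2 : ℕ) : ℂ) * (((starRingEnd ℂ) (Complex.log z) - Complex.log z) / 4) =
      -(z.arg * Complex.I) := by
    apply Complex.ext <;> simp [Complex.log_im]
    ring
  rw [e, Complex.exp_neg]
  conv_lhs => arg 2; rw [← Complex.norm_mul_exp_arg_mul_I z]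
  field_simp [Complex.exp_ne_zero]

theorem contDiffAt_invSqrtPhase {z : ℂ} (hz : z ∈ Complex.slitPlane) :
    ContDiffAt ℝ ∞ invSqrtPhase z := by
  have h1 : ContDiffAt ℝ ∞ Complex.log z := (Complex.contDiffAt_log hz).restrict_scalars ℝ
  have h2 : ContDiffAt ℝ ∞ (fun z => (starRingEnd ℂ) (Complex.log z)) z :=
    Complex.conjCLE.contDiff.contDiffAt.comp z h1
  exact ((h2.sub h1).div_const 4).cexp

variable {M : Type*} [TopologicalSpace M] [ChartedSpace (EuclideanSpace ℝ (Fin 5)) M]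
  [IsManifold (𝓡 5) ∞ M]

theorem NormalLift.false_of_hopf {f : M → CP3} (hf : IsHypersurface f) (hHopf : IsHopf f) {x₀ : M}
    {U : Set (EuclideanSpace ℝ (Fin 5))} {p n : EuclideanSpace ℝ (Fin 5) → C4}
    (H : NormalLift f x₀ U p n) {y : EuclideanSpace ℝ (Fin 5)} (hy : y ∈ U)
    (hw : herm (quatJ (p y)) (n y) ≠ 0) : False := by
  let w : EuclideanSpace ℝ (Fin 5) → ℂ := fun y => herm (quatJ (p y)) (n y)
  have hws : ∀ y ∈ U, ContDiffAt ℝ ∞ w y := fun y hy =>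
    contDiffAt_herm (contDiffAt_quatJ (H.smooth_p y hy)) (H.smooth_n y hy)
  have hwc : ContinuousOn w U := fun y hy => (hws y hy).continuousAt.continuousWithinAt
  let U₁ := U ∩ w ⁻¹' {0}ᶜ
  have hU₁ : IsOpen U₁ := hwc.isOpen_inter_preimage H.isOpen isOpen_compl_singleton
  have H₁ : NormalLift f x₀ U₁ p n := H.mono hU₁ Set.inter_subset_left
  -- Either the normal is vertical wherever `w ≠ 0`, which nonintegrability excludes, or some point
  -- has both components nonzero.
  by_cases hv : ∀ y ∈ U₁, n y = w y • quatJ (p y)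
  · exact H₁.false_of_vertical hf hv ⟨hy, hw⟩
  push Not at hv
  obtain ⟨y₁, hy₁, hne⟩ := hv
  -- Splitting the unit length into its two parts: `‖w‖ < 1` wherever the `𝒟₂` part is nonzero.
  have hunit : ∀ y ∈ U, 2 * (herm (n y - w y • quatJ (p y)) (n y - w y • quatJ (p y))).re =
      1 - ‖w y‖ ^ 2 := fun y hy => by
    have h := H.unit_n y hy
    have e : herm (n y) (quatJ (p y)) = star (w y) := (star_herm _ _).symm
    rw [conicMetric_of_unit_horizontal (H.herm_p y hy) (H.herm_p_n y hy)] at h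
    rw [herm_sub_left, herm_sub_right, herm_sub_right, herm_smul_left, herm_smul_left,
      herm_smul_right, herm_smul_right, herm_quatJ_quatJ, H.herm_p y hy, e,
      ← Complex.normSq_eq_norm_sq, Complex.normSq_apply]
    change 2 * (herm (n y) (n y)).re - (star (w y) * w y).re = 1 at h
    change 2 * (herm (n y) (n y) - w y * star (w y) -
      (star (w y) * w y - star (w y) * (w y * 1))).re = _
    simp at h ⊢
    linarith
  let U₂ := U₁ ∩ (fun y => n y - w y • quatJ (p y)) ⁻¹' {0}ᶜ
  have hU₂ : IsOpen U₂ := by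
    refine ContinuousOn.isOpen_inter_preimage (fun y hy => ?_) hU₁ isOpen_compl_singleton
    exact ((H₁.smooth_n y hy).sub ((hws y hy.1).smul
      (contDiffAt_quatJ (H₁.smooth_p y hy)))).continuousAt.continuousWithinAt
  have hy₂ : y₁ ∈ U₂ := ⟨hy₁, fun h => hne (sub_eq_zero.1 h)⟩
  -- A constant preliminary rotation makes `u` positive at `y₁`, so that near `y₁` it avoids the
  -- branch cut of the logarithm.
  let κ := invSqrtPhase (w y₁)
  let u : EuclideanSpace ℝ (Fin 5) → ℂ := fun y => κ ^ 2 * w y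
  let U₃ := U₂ ∩ u ⁻¹' Complex.slitPlane
  have hus : ∀ y ∈ U₂, ContDiffAt ℝ ∞ u y := fun y hy => contDiffAt_const.mul (hws y hy.1.1)
  have hU₃ : IsOpen U₃ := ContinuousOn.isOpen_inter_preimage
    (fun y hy => (hus y hy).continuousAt.continuousWithinAt) hU₂ Complex.isOpen_slitPlane
  have hy₃ : y₁ ∈ U₃ := by
    refine ⟨hy₂, ?_⟩
    change κ ^ 2 * w y₁ ∈ Complex.slitPlane
    rw [invSqrtPhase_sq_mul, Complex.ofReal_mem_slitPlane]
    exact norm_pos_iff.2 hy₁.2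
  have H₃ : NormalLift f x₀ U₃ p n := H₁.mono hU₃ fun y hy => hy.1.1
  let σ : EuclideanSpace ℝ (Fin 5) → ℂ := fun y => κ * invSqrtPhase (u y)
  have hσ : ∀ y ∈ U₃, ContDiffAt ℝ ∞ σ y := fun y hy =>
    contDiffAt_const.mul (ContDiffAt.comp (g := invSqrtPhase) y (contDiffAt_invSqrtPhase hy.2)
      (hus y hy.1))
  have hκ : ‖κ‖ = 1 := norm_invSqrtPhase _
  have hσ1 : ∀ y ∈ U₃, ‖σ y‖ = 1 := fun y _ => by
    simp only [σ]
    rw [norm_mul, hκ, norm_invSqrtPhase, one_mul]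
  have hσw : ∀ y, σ y ^ 2 * w y = ‖w y‖ := fun y => by
    have h := invSqrtPhase_sq_mul (u y)
    have e : ‖u y‖ = ‖w y‖ := by
      simp only [u]
      rw [norm_mul, norm_pow, hκ, one_pow, one_mul]
    rw [e] at h
    rw [← h]
    simp only [σ, u]
    ring
  refine (H₃.gauge hσ hσ1).false_of_real hf hHopf (s := fun y => ‖w y‖) (fun y hy => ?_)
    (fun y hy => norm_pos_iff.2 hy.1.1.2) (fun y hy => ?_) hy₃
  -- As `j` is conjugate linear, a phase change by `σ` multiplies `h(jp, n)` by `σ²`; this is why a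
  -- square root of the phase is needed.
  · rw [← hσw, quatJ_smul, herm_smul_left, herm_smul_right, star_star]
    ring
  · have h1 := hunit y hy.1.1.1
    have h2 : 0 < (herm (n y - w y • quatJ (p y)) (n y - w y • quatJ (p y))).re :=
      lt_of_le_of_ne (herm_self_nonneg _) fun h => hy.1.2 (herm_self_eq_zero h.symm)
    have h3 := norm_nonneg (w y)
    nlinarith

/-- The affine section over the chart at `f x₀`, divided by its length. -/
theorem exists_localLift {f : M → CP3} (hf : IsHypersurface f) (x₀ : M) :
    ∃ U p, LocalLift f x₀ U p ∧ extChartAt (𝓡 5) x₀ x₀ ∈ U := by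
  set k := chartIndex (f x₀) with hk
  let F : EuclideanSpace ℝ (Fin 5) → C3 := localMap f x₀
  let U : Set (EuclideanSpace ℝ (Fin 5)) := (extChartAt (𝓡 5) x₀).target ∩
    (fun y => f ((extChartAt (𝓡 5) x₀).symm y)) ⁻¹' affinePiece k
  have hU : IsOpen U := by
    refine ContinuousOn.isOpen_inter_preimage ?_ (isOpen_extChartAt_target x₀)
      (affineChart k).open_source
    exact hf.contMDiff.continuous.comp_continuousOn (continuousOn_extChartAt_symm x₀)
  have hF : ∀ y ∈ U, ContDiffAt ℝ ∞ F y := fun y hy => by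
    have hs := (extChartAt (𝓡 5) x₀).map_target hy.1
    rw [extChartAt_source] at hs
    have h := ((contMDiffAt_iff_of_mem_source (I := 𝓡 5) (I' := 𝓘(ℝ, C3)) (y := f x₀) hs hy.2).1
      (hf.contMDiff ((extChartAt (𝓡 5) x₀).symm y))).2
    rw [ModelWithCorners.range_eq_univ, contDiffWithinAt_univ,
      (extChartAt (𝓡 5) x₀).right_inv hy.1] at h
    exact h
  let d : EuclideanSpace ℝ (Fin 5) → ℝ := fun y =>
    (herm (affineLift k (F y)) (affineLift k (F y))).re
  have hd : ∀ y, 0 < d y := fun y => herm_affineLift_pos k (F y)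
  have hz : ∀ y ∈ U, ContDiffAt ℝ ∞ (fun y => affineLift k (F y)) y := fun y hy =>
    (contDiff_affineLift k).contDiffAt.comp y (hF y hy)
  have hds : ∀ y ∈ U, ContDiffAt ℝ ∞ d y := fun y hy =>
    Complex.reCLM.contDiff.contDiffAt.comp y (contDiffAt_herm (hz y hy) (hz y hy))
  have hsq : ∀ y, √(d y) ≠ 0 := fun y => Real.sqrt_ne_zero'.2 (hd y)
  refine ⟨U, fun y => (√(d y))⁻¹ • affineLift k (F y), ⟨hU, Set.inter_subset_left,
    fun y hy => ?_, fun y hy => ?_, fun y hy h => ?_⟩, ?_⟩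
  · exact (((hds y hy).sqrt (hd y).ne').inv (hsq y)).smul (hz y hy)
  · have e := herm_smul_smul (((√(d y))⁻¹ : ℝ) : ℂ) (affineLift k (F y)) (affineLift k (F y))
    rw [Complex.coe_smul] at e
    rw [e, herm_self, Complex.norm_real, Real.norm_eq_abs, sq_abs, ← Complex.ofReal_mul, inv_pow,
      Real.sq_sqrt (hd y).le]
    change (((d y)⁻¹ * d y : ℝ) : ℂ) = 1
    rw [inv_mul_cancel₀ (hd y).ne', Complex.ofReal_one]
  · have e : mk ⟨affineLift k (F y), affineLift_ne_zero k (F y)⟩ =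
        f ((extChartAt (𝓡 5) x₀).symm y) := (affineChart k).left_inv hy.2
    rw [← e, mk_eq_mk_iff]
    exact ⟨(((√(d y))⁻¹ : ℝ) : ℂ), Complex.coe_smul _ _⟩
  · refine ⟨mem_extChartAt_target x₀, ?_⟩
    rw [Set.mem_preimage, extChartAt_to_inv]
    exact Classical.choose_spec (exists_mem_affinePiece (f x₀))

/-- The vertical component of a unit normal of a Hopf hypersurface vanishes. -/
theorem herm_quatJ_eq_zero_of_hopf {f : M → CP3} (hf : IsHypersurface f) (hHopf : IsHopf f) (q : M)
    {N : C3} (h : IsUnitNormal f q N) :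
    herm (quatJ (affineLift (chartIndex (f q)) (coord (chartIndex (f q)) (f q))))
      (tangentLift (chartIndex (f q)) N) = 0 := by
  obtain ⟨U, p, H, hy⟩ := exists_localLift hf q
  obtain ⟨hk, T, hTy, hT, he⟩ := H.exists_transition hy (q := q) (by rw [extChartAt_to_inv])
  have hsurj := H.surjective_transition hf hy hk hTy hT he
  set y := extChartAt (𝓡 5) q q with hydef
  have hw : coord (chartIndex (f q)) (f q) = affineCoord (chartIndex (f q)) (p y) :=
    coord_eq_of_mk ((H.mk_p y hy (H.ne_zero hy)).trans (by rw [hydef, extChartAt_to_inv]))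
  set k := chartIndex (f q) with hkdef
  by_contra h0
  -- A lift of `N` at `p`, not necessarily horizontal; neither the pulled-back metric nor `h(jp, ·)`
  -- sees its component along `p`.
  set n₀ : C4 := p y k • tangentLift k N with hn₀
  have hL : fderiv ℝ (affineCoord k) (p y) n₀ = N := by
    rw [fderiv_affineCoord k hk, hn₀, smul_smul, inv_mul_cancel₀ hk, one_smul, dproj_tangentLift]
  have h1 : conicMetric (p y) n₀ n₀ = 1 := by
    rw [conicMetric_eq_chartMetric k hk, hL, ← hw]
    exact h.1
  have h2 : ∀ X, conicMetric (p y) (fderiv ℝ p y X) n₀ = 0 := fun X => by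
    obtain ⟨X, rfl⟩ := hsurj X
    have e := fderiv_comp_affineCoord he hTy hk (H.smooth_p y hy) (hT.differentiableAt (by simp)) X
    rw [conicMetric_eq_chartMetric k hk, hL, ← hw, ← e]
    refine Eq.trans ?_ (h.2 X)
    exact congrArg (fun v => chartMetric k (coord k (f q)) v N) (mfderiv_apply_eq hf q X).symm
  have h3 : herm (quatJ (p y)) n₀ ≠ 0 := by
    rw [hw, affineLift_affineCoord k hk, quatJ_smul, herm_smul_left] at h0
    rw [hn₀, herm_smul_right]
    exact mul_ne_zero hk (right_ne_zero_of_mul h0)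
  obtain ⟨U', n, H', hy', hn⟩ := exists_normalLift hf H hy h1 h2 h3
  exact H'.false_of_hopf hf hHopf hy' hn

theorem isHorizontal_of_isHopf {f : M → CP3} (hf : IsHypersurface f) (hHopf : IsHopf f) :
    IsHorizontal f ∧ ∀ p N, IsUnitNormal f p N → N ∈ D2 (f p) := by
  have key : ∀ q (N : C3), IsUnitNormal f q N →
      herm (affineLift (chartIndex (f q)) (coord (chartIndex (f q)) (f q)))
        (lift2 (affineLift (chartIndex (f q)) (coord (chartIndex (f q)) (f q)))
          (tangentLift (chartIndex (f q)) N)) = 0 ∧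
      herm (quatJ (affineLift (chartIndex (f q)) (coord (chartIndex (f q)) (f q))))
        (lift2 (affineLift (chartIndex (f q)) (coord (chartIndex (f q)) (f q)))
          (tangentLift (chartIndex (f q)) N)) = 0 ∧
      lift1 (affineLift (chartIndex (f q)) (coord (chartIndex (f q)) (f q)))
          (tangentLift (chartIndex (f q)) N) = 0 ∧
      dproj (chartIndex (f q)) (coord (chartIndex (f q)) (f q))
        (lift2 (affineLift (chartIndex (f q)) (coord (chartIndex (f q)) (f q)))
          (tangentLift (chartIndex (f q)) N)) = N := by
    intro q N hN
    have h := herm_quatJ_eq_zero_of_hopf hf hHopf q hN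
    have hz := herm_affineLift_ne_zero (chartIndex (f q)) (coord (chartIndex (f q)) (f q))
    have e1 : lift1 (affineLift (chartIndex (f q)) (coord (chartIndex (f q)) (f q)))
          (tangentLift (chartIndex (f q)) N) = 0 := by
      rw [lift1, h, zero_div, zero_smul]
    refine ⟨herm_lift2 hz _, herm_quatJ_lift2 hz _, e1, ?_⟩
    rw [lift2, e1, sub_zero, horiz]
    funext i
    simp [dproj]
  refine ⟨fun q N hN => ?_, fun q N hN => ?_⟩
  · obtain ⟨-, -, h3, h4⟩ := key q N hN
    have hP : P (f q) N = N := by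
      refine Eq.trans (chartP_eq _ _ _) ?_
      rw [h3, sub_zero]
      exact h4
    rw [angle, hP, hN.1, Real.arccos_one, zero_div]
  · obtain ⟨h1, h2, -, h4⟩ := key q N hN
    exact ⟨_, h1, h2, h4⟩

end CP3

theorem mainTheorem6 {M : Type*} [TopologicalSpace M] [ChartedSpace (EuclideanSpace ℝ (Fin 5)) M]
    [IsManifold (𝓡 5) ∞ M] (f : M → CP3) (hf : CP3.IsHypersurface f) (hHopf : CP3.IsHopf f) :
    CP3.IsHorizontal f ∧ ∀ p N, CP3.IsUnitNormal f p N → N ∈ CP3.D2 (f p) :=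
  CP3.isHorizontal_of_isHopf hf hHopf
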